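/- Let $P$ be a simple polygon in the plane with vertices $v_0,\dots,v_{n-1}$ in counterclockwise order (indices modulo $n$), and let $q$ be a point in the interior of $P$ such that no edge of $P$ lies on a line through $q$. A point $x$ is *visible* if the segment $qx$ is contained in the closed region $P$. For consecutive vertices $v_k,v_{k+1}$ write $v_k\prec v_{k+1}$ if the edge from $v_k$ to $v_{k+1}$ is traversed counterclockwise as seen from $q$ (the angle at $q$ increases), and $v_k\succ v_{k+1}$ if it is traversed clockwise. A vertex $v_c$ at which the boundary makes a clockwise turn is *critical-max* if $v_{c-1}\prec v_c\succ v_{c+1}$, *critical-min* if $v_{c-1}\succ v_c\prec v_{c+1}$, and *critical* if it is one of the two. Let $2\le m\le n$ and let $\Delta$ be the chain of the $m$ consecutive vertices $p=v_i,v_{i+1},\dots,v_{i+m-1}=p'$ of the boundary. Assume that the endpoints $p$ and $p'$ are visible critical vertices, that no other vertex of $\Delta$ is a visible critical vertex, and that $p$ and $p'$ lie in different directions from $q$. If $p$ is critical-max, let $A$ be the point nearest to $q$ among the intersections, other than $p$, of the ray from $q$ through $p$ with $\Delta$; otherwise let $A=p$. If $p'$ is critical-min, let $B$ be the point nearest to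 $q$ among the intersections, other than $p'$, of the ray from $q$ through $p'$ with $\Delta$; otherwise let $B=p'$. Then $A$ and $B$ exist, $A$ precedes $B$ on $\Delta$, and the set of the visible points of $\Delta$ consists of $p$, the part of $\Delta$ from $A$ to $B$, and $p'$. Moreover there is an algorithm (one fixed program for a random access machine with a read-only input array, a write-only output, a constant number of index registers and a constant number of number registers, and the operations $+,-,\times$ and comparison on numbers at unit cost) which, given only the vertices of $\Delta$ (with their number $m$) and $q$, writes in $O(m)$ steps the sequence $$p,\ A,\ \text{the vertices of } \Delta \text{ strictly between } A \text{ and } B,\ B,\ p'$$ (points being written in homogeneous coordinates). Its workspace is $O(1)$ words: the index registers always hold natural numbers of size $O(m)$, and if all input coordinates are integers of absolute value at most $U$, then the number registers always hold integers of absolute value at most $C(U+1)^d$ for absolute constants $C,d$; that is, all registers have $O(\log n)$ bits when the input coordinates have $O(\log n)$ bits. -/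

import Mathlib

/-! The plane is `ℂ` with its Euclidean norm.  A closed polygon with `n` vertices is a map
`v : ZMod n → ℂ`; its `k`-th edge is the segment from `v k` to `v (k + 1)`. -/

noncomputable section

namespace ChainVisibility

/-! ### Polygons -/

/-- Cross product (twice the signed area of the triangle `0, a, b`). -/
def cross (a b : ℂ) : ℝ := a.re * b.im - a.im * b.re

/-- The closed polygonal curve does not meet itself: a point of the curve lies on only one of the
half-open edges `[v k, v (k + 1))`, and there at only one position. -/
def IsSimplePolygon {n : ℕ} (v : ZMod n → ℂ) : Prop :=
  3 ≤ n ∧ ∀ k l : ZMod n, ∀ s ∈ Set.Ico (0 : ℝ) 1, ∀ t ∈ Set.Ico (0 : ℝ) 1,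
    AffineMap.lineMap (v k) (v (k + 1)) s = AffineMap.lineMap (v l) (v (l + 1)) t → k = l ∧ s = t

/-- The boundary of the polygon. -/
def boundary {n : ℕ} (v : ZMod n → ℂ) : Set ℂ := ⋃ k : ZMod n, segment ℝ (v k) (v (k + 1))

/-- The winding number of the polygon about a point `z` off its boundary: the sum of the signed
angles, in `(-π, π)`, under which the edges are seen from `z`, divided by `2π`. -/
def windingNumber {n : ℕ} [NeZero n] (v : ZMod n → ℂ) (z : ℂ) : ℝ :=
  (∑ k : ZMod n, Complex.arg ((v (k + 1) - z) / (v k - z))) / (2 * Real.pi)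

/-- The points inside a simple polygon whose vertices are listed in counterclockwise order.
(A clockwise polygon has winding numbers `0` and `-1` only, so the existence of such a point
says that the vertices are listed counterclockwise.) -/
def inside {n : ℕ} [NeZero n] (v : ZMod n → ℂ) : Set ℂ :=
  {z | z ∉ boundary v ∧ windingNumber v z = 1}

/-- The closed polygonal region. -/
def region {n : ℕ} [NeZero n] (v : ZMod n → ℂ) : Set ℂ := boundary v ∪ inside v

/-- `x` is visible from `q` in the polygon. -/
def Visible {n : ℕ} [NeZero n] (v : ZMod n → ℂ) (q x : ℂ) : Prop :=
  segment ℝ q x ⊆ region v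

/-- Seen from `q`, the angle increases along the edge from `x` to `y`. -/
def AngleLT (q x y : ℂ) : Prop := 0 < cross (x - q) (y - q)

/-- The turn at `y` on the way `x, y, z` is clockwise. -/
def ClockwiseTurn (x y z : ℂ) : Prop := cross (y - x) (z - y) < 0

/-- The boundary turns clockwise at `v c`, where the angle seen from `q` has a local maximum. -/
def CriticalMax {n : ℕ} (v : ZMod n → ℂ) (q : ℂ) (c : ZMod n) : Prop :=
  AngleLT q (v (c - 1)) (v c) ∧ AngleLT q (v (c + 1)) (v c) ∧
    ClockwiseTurn (v (c - 1)) (v c) (v (c + 1))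

/-- The boundary turns clockwise at `v c`, where the angle seen from `q` has a local minimum. -/
def CriticalMin {n : ℕ} (v : ZMod n → ℂ) (q : ℂ) (c : ZMod n) : Prop :=
  AngleLT q (v c) (v (c - 1)) ∧ AngleLT q (v c) (v (c + 1)) ∧
    ClockwiseTurn (v (c - 1)) (v c) (v (c + 1))

def VisibleCritical {n : ℕ} [NeZero n] (v : ZMod n → ℂ) (q : ℂ) (c : ZMod n) : Prop :=
  (CriticalMax v q c ∨ CriticalMin v q c) ∧ Visible v q (v c)

/-! ### Chains -/

/-- The boundary, parametrized counterclockwise from `v i`; the vertex `v (i + k)` is at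
parameter `k`. -/
def curve {n : ℕ} (v : ZMod n → ℂ) (i : ZMod n) (t : ℝ) : ℂ :=
  AffineMap.lineMap (v (i + ⌊t⌋₊)) (v (i + ⌊t⌋₊ + 1)) (t - ⌊t⌋₊)

/-- The chain with the `m` vertices `v i, v (i + 1), …, v (i + (m - 1))`, as a set. -/
def chain {n : ℕ} (v : ZMod n → ℂ) (i : ZMod n) (m : ℕ) : Set ℂ :=
  curve v i '' Set.Icc 0 ((m - 1 : ℕ) : ℝ)

/-- The last vertex of the chain. -/
def chainEnd {n : ℕ} (i : ZMod n) (m : ℕ) : ZMod n := i + ((m - 1 : ℕ) : ZMod n)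

/-- The two endpoints of the chain are its only visible critical vertices, and they are seen from
`q` in different directions. -/
def IsVisibleCriticalChain {n : ℕ} [NeZero n] (v : ZMod n → ℂ) (q : ℂ) (i : ZMod n) (m : ℕ) :
    Prop :=
  2 ≤ m ∧ m ≤ n ∧
  VisibleCritical v q i ∧ VisibleCritical v q (chainEnd i m) ∧
  (∀ k : ℕ, 0 < k → k < m - 1 → ¬ VisibleCritical v q (i + k)) ∧
  ¬ SameRay ℝ (v i - q) (v (chainEnd i m) - q)

/-- The ray from `q` through `w`. -/
def ray (q w : ℂ) : Set ℂ := {x | ∃ s : ℝ, 0 ≤ s ∧ x = q + s * (w - q)}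

/-- The chain at parameter `t` is the point nearest to `q` among the intersections, other than `w`
itself, of the chain with the ray from `q` through `w`. -/
def IsNearestHit {n : ℕ} (v : ZMod n → ℂ) (q : ℂ) (i : ZMod n) (m : ℕ) (w : ℂ) (t : ℝ) : Prop :=
  t ∈ Set.Icc 0 ((m - 1 : ℕ) : ℝ) ∧ curve v i t ∈ ray q w \ {w} ∧
    ∀ x ∈ chain v i m, x ∈ ray q w \ {w} → dist q (curve v i t) ≤ dist q x

/-- The parameter of the point `A`. -/
def IsFirstCut {n : ℕ} (v : ZMod n → ℂ) (q : ℂ) (i : ZMod n) (m : ℕ) (a : ℝ) : Prop :=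
  (CriticalMax v q i → IsNearestHit v q i m (v i) a) ∧ (¬ CriticalMax v q i → a = 0)

/-- The parameter of the point `B`. -/
def IsLastCut {n : ℕ} (v : ZMod n → ℂ) (q : ℂ) (i : ZMod n) (m : ℕ) (b : ℝ) : Prop :=
  (CriticalMin v q (chainEnd i m) → IsNearestHit v q i m (v (chainEnd i m)) b) ∧
    (¬ CriticalMin v q (chainEnd i m) → b = ((m - 1 : ℕ) : ℝ))

open Classical in
/-- The list: first endpoint, `A`, the vertices strictly between `A` and `B`, `B`, last endpoint. -/
def outputPoints {n : ℕ} (v : ZMod n → ℂ) (i : ZMod n) (m : ℕ) (a b : ℝ) : List ℂ :=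
  [v i, curve v i a] ++
    ((List.range m).filter (fun k : ℕ => a < (k : ℝ) ∧ (k : ℝ) < b)).map
      (fun k : ℕ => v (i + (k : ZMod n))) ++
    [curve v i b, v (chainEnd i m)]

/-! ### The machine

A random access machine with a read-only input (an array of `m` points and a query point), a
write-only output, and as its workspace `α` registers for indices and `β` registers for numbers. -/

/-- The read-only input. -/
structure Input where
  len : ℕ
  pts : Fin len → ℂ
  query : ℂ

/-- Random access to the array; reading beyond its end gives `0`. -/
def Input.read (I : Input) (k : ℕ) : ℂ := if h : k < I.len then I.pts ⟨k, h⟩ else 0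

inductive Instr (α β : ℕ) : Type
  /-- index register `x ← c` -/
  | idxConst (x : Fin α) (c : ℕ)
  /-- `x ←` length of the array -/
  | idxLen (x : Fin α)
  /-- `x ← y` -/
  | idxCopy (x y : Fin α)
  /-- `x ← x + 1` -/
  | idxSucc (x : Fin α)
  /-- `x ← x - 1`, truncated at `0` -/
  | idxPred (x : Fin α)
  /-- number register `r ← c` -/
  | numConst (r : Fin β) (c : ℤ)
  /-- `r ←` first coordinate of the array element with index `x` -/
  | readX (r : Fin β) (x : Fin α)
  /-- `r ←` second coordinate of the array element with index `x` -/
  | readY (r : Fin β) (x : Fin α)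
  /-- `r ←` first coordinate of the query point -/
  | queryX (r : Fin β)
  /-- `r ←` second coordinate of the query point -/
  | queryY (r : Fin β)
  /-- `r ← s + t` -/
  | add (r s t : Fin β)
  /-- `r ← s - t` -/
  | sub (r s t : Fin β)
  /-- `r ← s * t` -/
  | mul (r s t : Fin β)
  /-- jump to line `l` -/
  | jump (l : ℕ)
  /-- jump to line `l` if `x < y` -/
  | jumpIdxLT (x y : Fin α) (l : ℕ)
  /-- jump to line `l` if `r < s` -/
  | jumpNumLT (r s : Fin β) (l : ℕ)
  /-- append the words in `r, s, t` to the output -/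
  | write (r s t : Fin β)

/-- A configuration: program counter, workspace, and the output written so far. -/
structure Config (α β : ℕ) where
  pc : ℕ
  idx : Fin α → ℕ
  num : Fin β → ℝ
  out : List (ℝ × ℝ × ℝ)

def Config.init (α β : ℕ) : Config α β := ⟨0, fun _ => 0, fun _ => 0, []⟩

open Classical in
/-- The effect of one instruction. -/
def Instr.exec {α β : ℕ} (I : Input) (c : Config α β) : Instr α β → Config α β
  | .idxConst x k => { c with pc := c.pc + 1, idx := Function.update c.idx x k }
  | .idxLen x => { c with pc := c.pc + 1, idx := Function.update c.idx x I.len }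
  | .idxCopy x y => { c with pc := c.pc + 1, idx := Function.update c.idx x (c.idx y) }
  | .idxSucc x => { c with pc := c.pc + 1, idx := Function.update c.idx x (c.idx x + 1) }
  | .idxPred x => { c with pc := c.pc + 1, idx := Function.update c.idx x (c.idx x - 1) }
  | .numConst r z => { c with pc := c.pc + 1, num := Function.update c.num r (z : ℝ) }
  | .readX r x => { c with pc := c.pc + 1, num := Function.update c.num r (I.read (c.idx x)).re }
  | .readY r x => { c with pc := c.pc + 1, num := Function.update c.num r (I.read (c.idx x)).im }
  | .queryX r => { c with pc := c.pc + 1, num := Function.update c.num r I.query.re }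
  | .queryY r => { c with pc := c.pc + 1, num := Function.update c.num r I.query.im }
  | .add r s t => { c with pc := c.pc + 1, num := Function.update c.num r (c.num s + c.num t) }
  | .sub r s t => { c with pc := c.pc + 1, num := Function.update c.num r (c.num s - c.num t) }
  | .mul r s t => { c with pc := c.pc + 1, num := Function.update c.num r (c.num s * c.num t) }
  | .jump l => { c with pc := l }
  | .jumpIdxLT x y l => { c with pc := if c.idx x < c.idx y then l else c.pc + 1 }
  | .jumpNumLT r s l => { c with pc := if c.num r < c.num s then l else c.pc + 1 }
  | .write r s t => { c with pc := c.pc + 1, out := c.out ++ [(c.num r, c.num s, c.num t)] }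

/-- The machine has halted when the program counter has left the program. -/
def Halted {α β : ℕ} (prog : List (Instr α β)) (c : Config α β) : Prop := prog.length ≤ c.pc

/-- One step, at unit cost; a halted configuration does not change any more. -/
def step {α β : ℕ} (prog : List (Instr α β)) (I : Input) (c : Config α β) : Config α β :=
  match prog[c.pc]? with
  | some ins => ins.exec I c
  | none => c

/-- The configuration after `T` steps. -/
def run {α β : ℕ} (prog : List (Instr α β)) (I : Input) (T : ℕ) : Config α β :=
  (step prog I)^[T] (Config.init α β)

/-- The machine writes points in homogeneous coordinates: the words `x, y, w` with `w ≠ 0` stand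
for the point `(x / w, y / w)`. -/
def Represents (out : List (ℝ × ℝ × ℝ)) (L : List ℂ) : Prop :=
  List.Forall₂ (fun o z => o.2.2 ≠ 0 ∧ z.re = o.1 / o.2.2 ∧ z.im = o.2.1 / o.2.2) out L

/-- The input that consists of the chain and the viewpoint alone. -/
def chainInput {n : ℕ} (v : ZMod n → ℂ) (q : ℂ) (i : ZMod n) (m : ℕ) : Input where
  len := m
  pts := fun k => v (i + ((k : ℕ) : ZMod n))
  query := q

/-- The real number `x` is an integer of absolute value at most `U`. -/
def IsIntBounded (U : ℕ) (x : ℝ) : Prop := ∃ z : ℤ, x = z ∧ |z| ≤ U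

/-- All coordinates in the input are integers of absolute value at most `U`. -/
def Input.IntBounded (I : Input) (U : ℕ) : Prop :=
  (∀ k, IsIntBounded U (I.pts k).re ∧ IsIntBounded U (I.pts k).im) ∧
    IsIntBounded U I.query.re ∧ IsIntBounded U I.query.im

end ChainVisibility

end

open ChainVisibility

namespace ChainVisibility

open Complex Filter Topology Set

/-! ### Continuous functions with values in a lattice -/

/-! The boundary is studied in polar coordinates about `q`. A continuous logarithm of `loop v i t -
q` gives continuous functions `θ` and `ρ` on the whole line (`exists_polarView`). Winding number `1`
means that one turn adds `2π` to `θ` (`PolarView.period`), simplicity makes the lifted curve `t ↦ (θ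
t, ρ t)` injective (`PolarView.eq_of_angle_eq`), and on each edge `θ` is strictly monotone. In the
`(θ, ρ)`-plane the viewpoint lies infinitely far below, and lines of sight are vertical.

Three facts carry the geometry. First, crossing an edge changes the winding number by one, so a line
of sight can run on beyond a boundary point only at a vertex where the contributions of the two
edges cancel, that is, where the angle has a local extremum (`extremal_vertex_of_visible`).

Second, visible points come in angular order (`PolarView.angle_le_of_visible`). The direction of the
chord from parameter `u` to a later parameter `t` has a continuous branch on the half-plane `u < t`,
normalized to point to the right for distant parameters. By the first fact, the chords at a visible
point may touch the downward vertical direction but never pass through it. This confines the branch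
to one interval if the earlier end is visible and to another one if the later end is; if both are,
what remains is `[-π/2, π/2]`, so the angle does not decrease.

Third, the same branch compares the radii on the two sides of a visible extremal vertex and shows
that the boundary turns clockwise there, so that the vertex is critical
(`PolarView.visibleCritical_of_visible`).

Hence strictly inside the chain nothing stands in front of a visible point. Each angle strictly
between those of the endpoints then belongs to exactly one visible parameter; these parameters are
ordered by angle and leave no gap, so they fill an interval, whose ends are the parameters of `A`
and `B` (`exists_visible_interval`).

For the algorithm, `A` is found without any visibility test (`exists_visible_part`): among the edges
that pass the ray of `p` counterclockwise, the one that leaves the ray at `A` is the unique nearest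
one. If the chain starts clockwise, `p` lies on no such edge; if it starts counterclockwise, `A = p`
is found by the same rule. `B` is found likewise. Positions on the ray are quotients of cross
products and are compared by cross-multiplication, so two linear scans and a copying loop suffice.
Correctness of the machine code rests on a loop invariant (`ScanInv`), the word size on a bound for
each register that every instruction preserves. -/

theorem eq_of_continuousOn_of_int {X : Type*} [TopologicalSpace X] {S : Set X}
    (hS : IsPreconnected S) {f : X → ℝ} (hf : ContinuousOn f S)
    (hint : ∀ x ∈ S, ∃ k : ℤ, f x = k) {x y : X} (hx : x ∈ S) (hy : y ∈ S) : f x = f y := by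
  have : DiscreteTopology (range ((↑) : ℤ → ℝ)) :=
    Int.isClosedEmbedding_coe_real.isEmbedding.toHomeomorph.symm.isEmbedding.discreteTopology
  refine hS.constant_of_mapsTo (T := range ((↑) : ℤ → ℝ)) ⟨this⟩ hf ?_ hx hy
  intro z hz
  obtain ⟨k, hk⟩ := hint z hz
  exact ⟨k, hk.symm⟩

/-- Two continuous logarithms of the same function on a connected set agree if they agree at one
point. -/
theorem eqOn_of_exp_eqOn {X : Type*} [TopologicalSpace X] {S : Set X} (hS : IsPreconnected S)
    {f g : X → ℂ} (hf : ContinuousOn f S) (hg : ContinuousOn g S)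
    (h : ∀ x ∈ S, exp (f x) = exp (g x)) {x₀ : X} (hx₀ : x₀ ∈ S) (h₀ : f x₀ = g x₀) :
    ∀ x ∈ S, f x = g x := by
  intro x hx
  have key : ∀ z ∈ S, ∃ k : ℤ, f z = g z + k * (2 * Real.pi * I) := fun z hz =>
    exp_eq_exp_iff_exists_int.1 (h z hz)
  have hpi : (2 * Real.pi) ≠ 0 := by positivity
  have hc : ContinuousOn (fun z => (f z - g z).im / (2 * Real.pi)) S :=
    (continuous_im.comp_continuousOn (hf.sub hg)).div_const _
  have := eq_of_continuousOn_of_int hS hc (fun z hz => by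
    obtain ⟨k, hk⟩ := key z hz
    exact ⟨k, by rw [hk]; simp⟩) hx hx₀
  obtain ⟨k, hk⟩ := key x hx
  rw [h₀] at this
  simp only [hk, add_sub_cancel_left, sub_self, zero_im, zero_div] at this
  have h2 : (k : ℝ) = 0 := by
    have h3 : ((k : ℂ) * (2 * Real.pi * I)).im = k * (2 * Real.pi) := by simp
    rw [h3] at this
    field_simp at this
    exact this
  have : k = 0 := by exact_mod_cast h2
  rw [hk, this]; simp

/-! ### The winding number off the boundary -/

/-- If the quotient were a real number `r ≤ 0`, then `z = (b - r a) / (1 - r)` would be a convex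
combination of `a` and `b`. -/
theorem div_mem_slitPlane {a b z : ℂ} (h : z ∉ segment ℝ a b) :
    (b - z) / (a - z) ∈ slitPlane := by
  have haz : a - z ≠ 0 := fun h0 => h (by rw [← sub_eq_zero.1 h0]; exact left_mem_segment _ _ _)
  rw [mem_slitPlane_iff]
  by_contra! hc
  obtain ⟨hre, him⟩ := hc
  set r := (b - z) / (a - z) with hr
  have hb : b - z = r.re * (a - z) := by
    have : r = (r.re : ℂ) := by apply Complex.ext <;> simp [him]
    rw [← this, hr]; field_simp
  apply h
  have h1 : (0 : ℝ) < 1 - r.re := by linarith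
  refine ⟨-r.re / (1 - r.re), 1 / (1 - r.re), by apply div_nonneg <;> linarith, by positivity,
    by field_simp; ring, ?_⟩
  have h2 : (1 - (r.re : ℂ)) ≠ 0 := by exact_mod_cast h1.ne'
  have hz : z * (1 - r.re) = b - r.re * a := by linear_combination -hb
  simp only [real_smul]; push_cast
  field_simp
  linear_combination -hz

variable {n : ℕ}

theorem notMem_segment_of_notMem_boundary {v : ZMod n → ℂ} {z : ℂ} (hz : z ∉ boundary v)
    (k : ZMod n) : z ∉ segment ℝ (v k) (v (k + 1)) :=
  fun h => hz (mem_iUnion.2 ⟨k, h⟩)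

theorem isClosed_segment (a b : ℂ) : IsClosed (segment ℝ a b) := by
  rw [← convexHull_pair]
  exact ((toFinite _).isCompact_convexHull (𝕜 := ℝ)).isClosed

theorem isCompact_segment (a b : ℂ) : IsCompact (segment ℝ a b) := by
  rw [← convexHull_pair]
  exact (toFinite _).isCompact_convexHull (𝕜 := ℝ)

theorem isCompact_boundary [NeZero n] (v : ZMod n → ℂ) : IsCompact (boundary v) :=
  isCompact_iUnion fun _ => isCompact_segment _ _

theorem continuousAt_edgeArg {a b z : ℂ} (h : z ∉ segment ℝ a b) :
    ContinuousAt (fun z => arg ((b - z) / (a - z))) z := by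
  have haz : a - z ≠ 0 := fun h0 => h (by rw [← sub_eq_zero.1 h0]; exact left_mem_segment _ _ _)
  exact (continuousAt_arg (div_mem_slitPlane h)).comp (f := fun z => (b - z) / (a - z))
    (ContinuousAt.div (by fun_prop) (by fun_prop) haz)

theorem continuousAt_windingNumber [NeZero n] {v : ZMod n → ℂ} {z : ℂ} (hz : z ∉ boundary v) :
    ContinuousAt (windingNumber v) z := by
  unfold windingNumber
  refine ContinuousAt.div_const ?_ _
  exact tendsto_finsetSum _ fun k _ =>
    continuousAt_edgeArg (notMem_segment_of_notMem_boundary hz k)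

/-- The quotients of consecutive vertices multiply to `1` around the cycle, and so do their unit
parts; hence `exp (i · Σ arg) = 1`. -/
theorem exists_int_windingNumber [NeZero n] {v : ZMod n → ℂ} {z : ℂ} (hz : z ∉ boundary v) :
    ∃ k : ℤ, windingNumber v z = k := by
  have hne : ∀ k, v k - z ≠ 0 := fun k h0 => notMem_segment_of_notMem_boundary hz k
    (by rw [← sub_eq_zero.1 h0]; exact left_mem_segment _ _ _)
  have hprod : ∏ k : ZMod n, (v (k + 1) - z) / (v k - z) = 1 := by
    have hshift : ∏ k : ZMod n, (v (k + 1) - z) = ∏ k : ZMod n, (v k - z) :=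
      Equiv.prod_comp (Equiv.addRight (1 : ZMod n)) (fun k => v k - z)
    rw [Finset.prod_div_distrib, hshift,
      div_self (Finset.prod_ne_zero_iff.2 fun k _ => hne k)]
  have hexp : exp ((∑ k : ZMod n, arg ((v (k + 1) - z) / (v k - z)) : ℝ) * I) = 1 := by
    rw [ofReal_sum, Finset.sum_mul, exp_sum]
    have : ∀ k, exp ((arg ((v (k + 1) - z) / (v k - z)) : ℝ) * I)
        = ((v (k + 1) - z) / (v k - z)) / (‖(v (k + 1) - z) / (v k - z)‖ : ℝ) := by
      intro k
      have hx : ((‖(v (k + 1) - z) / (v k - z)‖ : ℝ) : ℂ) ≠ 0 := by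
        simp [hne]
      rw [eq_div_iff hx, mul_comm, norm_mul_exp_arg_mul_I]
    simp_rw [this]
    rw [Finset.prod_div_distrib, hprod, ← ofReal_prod, ← norm_prod, hprod]
    simp
  obtain ⟨k, hk⟩ := Complex.exp_eq_one_iff.1 hexp
  refine ⟨k, ?_⟩
  have h2 := congrArg Complex.im hk
  unfold windingNumber
  rw [div_eq_iff (by positivity)]
  simpa using h2

theorem windingNumber_eq_of_isPreconnected [NeZero n] {v : ZMod n → ℂ} {S : Set ℂ}
    (hS : IsPreconnected S) (hb : ∀ z ∈ S, z ∉ boundary v) {x y : ℂ} (hx : x ∈ S) (hy : y ∈ S) :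
    windingNumber v x = windingNumber v y :=
  eq_of_continuousOn_of_int hS
    (fun z hz => (continuousAt_windingNumber (hb z hz)).continuousWithinAt)
    (fun z hz => exists_int_windingNumber (hb z hz)) hx hy

theorem isClosed_region [NeZero n] (v : ZMod n → ℂ) : IsClosed (region v) := by
  rw [← isOpen_compl_iff, isOpen_iff_mem_nhds]
  intro z hz
  have hzb : z ∉ boundary v := fun h => hz (Or.inl h)
  have hzw : windingNumber v z ≠ 1 := fun h => hz (Or.inr ⟨hzb, h⟩)
  filter_upwards [(isCompact_boundary v).isClosed.isOpen_compl.mem_nhds hzb,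
    (continuousAt_windingNumber hzb).eventually_ne hzw] with y hy1 hy2
  rintro (h | h)
  · exact hy1 h
  · exact hy2 h.2

theorem visible_iff [NeZero n] (v : ZMod n → ℂ) (q x : ℂ) :
    Visible v q x ↔ ∀ s ∈ Icc (0 : ℝ) 1, q + s * (x - q) ∈ region v := by
  unfold Visible
  rw [segment_eq_image', image_subset_iff]
  simp [subset_def]

theorem isClosed_setOf_visible [NeZero n] (v : ZMod n → ℂ) (q : ℂ) :
    IsClosed {x | Visible v q x} := by
  simp_rw [visible_iff, ofPred_forall]
  refine isClosed_iInter fun s => isClosed_iInter fun _ => ?_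
  exact (isClosed_region v).preimage (f := fun x => q + s * (x - q)) (by fun_prop)

theorem Visible.of_le [NeZero n] {v : ZMod n → ℂ} {q x : ℂ} (h : Visible v q x) {c : ℝ}
    (hc : c ∈ Icc (0 : ℝ) 1) : Visible v q (q + c * (x - q)) := by
  rw [visible_iff] at h ⊢
  intro s hs
  have := h (s * c) ⟨mul_nonneg hs.1 hc.1, mul_le_one₀ hs.2 hc.1 hc.2⟩
  convert this using 1
  push_cast; ring

/-- A nearest boundary point on a ray from an inside point is visible. -/
theorem visible_of_forall_lt [NeZero n] {v : ZMod n → ℂ} {q x : ℂ} (hq : q ∈ inside v)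
    (hx : x ∈ boundary v) (h : ∀ s ∈ Ico (0 : ℝ) 1, q + s * (x - q) ∉ boundary v) :
    Visible v q x := by
  rw [visible_iff]
  intro s hs
  rcases hs.2.lt_or_eq with hs1 | rfl
  · refine Or.inr ⟨h s ⟨hs.1, hs1⟩, ?_⟩
    rw [← hq.2]
    refine windingNumber_eq_of_isPreconnected (S := (fun s : ℝ => q + s * (x - q)) '' Ico 0 1)
      (isPreconnected_Ico.image _ (by fun_prop)) ?_ ⟨s, ⟨hs.1, hs1⟩, rfl⟩ ⟨0, by simp, by simp⟩
    rintro _ ⟨s, hs, rfl⟩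
    exact h s hs
  · left; simpa using hx

end ChainVisibility

namespace ChainVisibility

open Complex Filter Topology Set

/-! ### Crossing an edge changes the winding number -/

/-- The angle under which the segment from `a` to `b` is seen from `z`. -/
noncomputable def edgeArg (a b z : ℂ) : ℝ := arg ((b - z) / (a - z))

theorem im_div_pos_iff {a b : ℂ} (ha : a ≠ 0) : 0 < (b / a).im ↔ 0 < cross a b := by
  have h : (b / a).im = cross a b / normSq a := by
    rw [div_im, cross]; ring
  rw [h, div_pos_iff_of_pos_right (normSq_pos.2 ha)]

theorem im_div_neg_iff {a b : ℂ} (ha : a ≠ 0) : (b / a).im < 0 ↔ cross a b < 0 := by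
  have h : (b / a).im = cross a b / normSq a := by
    rw [div_im, cross]; ring
  rw [h, div_lt_iff₀ (normSq_pos.2 ha), zero_mul]

theorem tendsto_radial (z d : ℂ) :
    Tendsto (fun ε : ℝ => z + ε * d) (𝓝[>] 0) (𝓝 z) := by
  have : Tendsto (fun ε : ℝ => z + ε * d) (𝓝 0) (𝓝 (z + (0 : ℝ) * d)) :=
    Continuous.tendsto (by fun_prop) _
  simpa using this.mono_left nhdsWithin_le_nhds

theorem tendsto_edgeArg_of_notMem {a b z : ℂ} (h : z ∉ segment ℝ a b) (d : ℂ) :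
    Tendsto (fun ε : ℝ => edgeArg a b (z + ε * d)) (𝓝[>] 0) (𝓝 (edgeArg a b z)) :=
  (continuousAt_edgeArg h).tendsto.comp (tendsto_radial z d)

theorem tendsto_nhds_of_eq {X : Type*} {l : Filter X} {f : X → ℝ} {x y : ℝ}
    (h : Tendsto f l (𝓝 x)) (e : x = y) : Tendsto f l (𝓝 y) := e ▸ h

theorem ne_zero_of_cross_ne_zero {a b : ℂ} (h : cross a b ≠ 0) : a ≠ 0 ∧ b ≠ 0 := by
  constructor <;> (rintro rfl; simp [cross] at h)

/-- At an inner point of the edge the quotient is a negative real. Moving off the edge along `d`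
approaches it from one side of the branch cut of `arg`, and `cross d (b - a)` decides from which. -/
theorem tendsto_edgeArg_interior {a b d : ℂ} {s : ℝ} (hs : s ∈ Ioo (0 : ℝ) 1)
    (hd : cross d (b - a) ≠ 0) :
    Tendsto (fun ε : ℝ => edgeArg a b (a + s * (b - a) + ε * d)) (𝓝[>] 0)
      (𝓝 (if 0 < cross d (b - a) then -Real.pi else Real.pi)) := by
  set z := a + s * (b - a) with hz
  have hba := (ne_zero_of_cross_ne_zero hd).2
  have hs0 : (s : ℂ) ≠ 0 := by exact_mod_cast hs.1.ne'
  have haz : a - z = -s * (b - a) := by rw [hz]; ring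
  have hbz : b - z = (1 - s) * (b - a) := by rw [hz]; ring
  have hne : a - z ≠ 0 := by rw [haz]; exact mul_ne_zero (neg_ne_zero.2 hs0) hba
  have hr : (b - z) / (a - z) = ((-(1 - s) / s : ℝ) : ℂ) := by
    rw [haz, hbz]; push_cast; field_simp
  have hre : ((b - z) / (a - z)).re < 0 := by
    rw [hr, ofReal_re]
    exact div_neg_of_neg_of_pos (by linarith [hs.2]) hs.1
  have him : ((b - z) / (a - z)).im = 0 := by rw [hr, ofReal_im]
  have hcont : Tendsto (fun ε : ℝ => (b - (z + ε * d)) / (a - (z + ε * d))) (𝓝[>] 0)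
      (𝓝 ((b - z) / (a - z))) := by
    have h1 : ContinuousAt (fun w : ℂ => (b - w) / (a - w)) z :=
      ContinuousAt.div (by fun_prop) (by fun_prop) hne
    exact h1.tendsto.comp (tendsto_radial z d)
  have hev : ∀ᶠ ε : ℝ in 𝓝[>] 0, a - (z + ε * d) ≠ 0 := by
    have h1 : ContinuousAt (fun w : ℂ => a - w) z := by fun_prop
    exact (h1.tendsto.comp (tendsto_radial z d)).eventually_ne hne
  have hcr : ∀ ε : ℝ, cross (a - (z + ε * d)) (b - (z + ε * d)) = -(ε * cross d (b - a)) := by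
    intro ε; rw [hz]; simp [cross]; ring
  unfold edgeArg
  split_ifs with h
  · refine (tendsto_arg_nhdsWithin_im_neg_of_re_neg_of_im_zero hre him).comp
      (tendsto_nhdsWithin_iff.2 ⟨hcont, ?_⟩)
    filter_upwards [hev, self_mem_nhdsWithin] with ε h1 h2
    refine (im_div_neg_iff h1).2 ?_
    rw [hcr]
    have : 0 < ε * cross d (b - a) := mul_pos h2 h
    linarith
  · refine (tendsto_arg_nhdsWithin_im_nonneg_of_re_neg_of_im_zero hre him).comp
      (tendsto_nhdsWithin_iff.2 ⟨hcont, ?_⟩)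
    filter_upwards [hev, self_mem_nhdsWithin] with ε h1 h2
    refine ((im_div_pos_iff h1).2 ?_).le
    rw [hcr]
    have : ε * cross d (b - a) < 0 := mul_neg_of_pos_of_neg h2 (lt_of_le_of_ne (not_lt.1 h) hd)
    linarith

/-- The quotient itself diverges at an end of the edge, but only through the positive factor `ε⁻¹`,
which `arg` ignores. -/
theorem tendsto_edgeArg_left {a b d : ℂ} (hd : cross d (b - a) ≠ 0) :
    Tendsto (fun ε : ℝ => edgeArg a b (a + ε * d)) (𝓝[>] 0) (𝓝 (arg (-((b - a) / d)))) := by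
  have hd0 := (ne_zero_of_cross_ne_zero hd).1
  have hmem : -((b - a) / d) ∈ slitPlane := by
    refine Or.inr ?_
    rw [neg_im, neg_ne_zero]
    rcases lt_or_gt_of_ne hd with h | h
    · exact ((im_div_neg_iff hd0).2 h).ne
    · exact ((im_div_pos_iff hd0).2 h).ne'
  have h1 : Tendsto (fun ε : ℝ => -((b - (a + ε * d)) / d)) (𝓝[>] 0) (𝓝 (-((b - a) / d))) := by
    have : ContinuousAt (fun w : ℂ => -((b - w) / d)) a := by fun_prop
    exact this.tendsto.comp (tendsto_radial a d)
  refine ((continuousAt_arg hmem).tendsto.comp h1).congr' ?_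
  filter_upwards [self_mem_nhdsWithin] with ε hε
  have hε : (0 : ℝ) < ε := hε
  simp only [Function.comp, edgeArg]
  have : (b - (a + ε * d)) / (a - (a + ε * d)) = ((ε⁻¹ : ℝ) : ℂ) * -((b - (a + ε * d)) / d) := by
    have : (ε : ℂ) ≠ 0 := by exact_mod_cast hε.ne'
    rw [sub_add_cancel_left]; push_cast; field_simp
  rw [this, arg_real_mul _ (inv_pos.2 hε)]

theorem tendsto_edgeArg_right {a b d : ℂ} (hd : cross d (b - a) ≠ 0) :
    Tendsto (fun ε : ℝ => edgeArg a b (b + ε * d)) (𝓝[>] 0) (𝓝 (arg (-(d / (a - b))))) := by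
  have hba := (ne_zero_of_cross_ne_zero hd).2
  have hab : a - b ≠ 0 := by rw [← neg_sub]; exact neg_ne_zero.2 hba
  have hcr : cross (a - b) d = cross d (b - a) := by simp [cross]; ring
  have hmem : -(d / (a - b)) ∈ slitPlane := by
    refine Or.inr ?_
    rw [neg_im, neg_ne_zero]
    rw [← hcr] at hd
    rcases lt_or_gt_of_ne hd with h | h
    · exact ((im_div_neg_iff hab).2 h).ne
    · exact ((im_div_pos_iff hab).2 h).ne'
  have h1 : Tendsto (fun ε : ℝ => -(d / (a - (b + ε * d)))) (𝓝[>] 0) (𝓝 (-(d / (a - b)))) := by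
    have : ContinuousAt (fun w : ℂ => -(d / (a - w))) b :=
      (ContinuousAt.div (by fun_prop) (by fun_prop) hab).neg
    exact this.tendsto.comp (tendsto_radial b d)
  refine ((continuousAt_arg hmem).tendsto.comp h1).congr' ?_
  filter_upwards [self_mem_nhdsWithin] with ε hε
  have hε : (0 : ℝ) < ε := hε
  simp only [Function.comp, edgeArg]
  have : (b - (b + ε * d)) / (a - (b + ε * d)) = (ε : ℂ) * -(d / (a - (b + ε * d))) := by
    rw [sub_add_cancel_left]; ring
  rw [this, arg_real_mul _ hε]

/-- This is the jump at an end of an edge when `d` is replaced by `-d`: half of the jump at an inner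
point. -/
theorem arg_neg_sub_arg {y : ℂ} (hy : y.im ≠ 0) :
    arg (-y) - arg y = if 0 < y.im then -Real.pi else Real.pi := by
  split_ifs with h
  · rw [arg_neg_eq_arg_sub_pi_of_im_pos h]; ring
  · rw [arg_neg_eq_arg_add_pi_of_im_neg (lt_of_le_of_ne (not_lt.1 h) hy)]; ring

/-- The jump of `edgeArg` along the direction `d` at a point of the edge. -/
theorem tendsto_edgeArg_sub {a b d z : ℂ} {s : ℝ} (hs : s ∈ Icc (0 : ℝ) 1)
    (hz : z = a + s * (b - a)) (hd : cross d (b - a) ≠ 0) :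
    Tendsto (fun ε : ℝ => edgeArg a b (z + ε * d) - edgeArg a b (z + ε * -d)) (𝓝[>] 0)
      (𝓝 ((if s = 0 ∨ s = 1 then 1 else 2) * if 0 < cross d (b - a) then -Real.pi else Real.pi)) := by
  have hneg : cross (-d) (b - a) = -cross d (b - a) := by simp [cross]; ring
  have hd' : cross (-d) (b - a) ≠ 0 := by rw [hneg]; exact neg_ne_zero.2 hd
  have hd0 := (ne_zero_of_cross_ne_zero hd).1
  by_cases h0 : s = 0
  · have hza : z = a := by rw [hz, h0]; simp
    rw [hza]
    refine tendsto_nhds_of_eq ((tendsto_edgeArg_left hd).sub (tendsto_edgeArg_left hd')) ?_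
    have hy : ((b - a) / d).im ≠ 0 := by
      rcases lt_or_gt_of_ne hd with h | h
      · exact ((im_div_neg_iff hd0).2 h).ne
      · exact ((im_div_pos_iff hd0).2 h).ne'
    rw [div_neg, neg_neg, arg_neg_sub_arg hy, if_pos (Or.inl h0)]
    simp only [im_div_pos_iff hd0, one_mul]
  by_cases h1 : s = 1
  · have hzb : z = b := by rw [hz, h1]; simp
    have hab : a - b ≠ 0 := by
      rw [← neg_sub]; exact neg_ne_zero.2 (ne_zero_of_cross_ne_zero hd).2
    have hcr : cross (a - b) d = cross d (b - a) := by simp [cross]; ring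
    rw [hzb]
    refine tendsto_nhds_of_eq ((tendsto_edgeArg_right hd).sub (tendsto_edgeArg_right hd')) ?_
    have hy : (d / (a - b)).im ≠ 0 := by
      rw [← hcr] at hd
      rcases lt_or_gt_of_ne hd with h | h
      · exact ((im_div_neg_iff hab).2 h).ne
      · exact ((im_div_pos_iff hab).2 h).ne'
    rw [neg_div, neg_neg, arg_neg_sub_arg hy, if_pos (Or.inr h1)]
    simp only [im_div_pos_iff hab, one_mul, hcr]
  · have hs' : s ∈ Ioo (0 : ℝ) 1 := ⟨lt_of_le_of_ne hs.1 (Ne.symm h0), lt_of_le_of_ne hs.2 h1⟩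
    rw [hz]
    refine tendsto_nhds_of_eq ((tendsto_edgeArg_interior hs' hd).sub (tendsto_edgeArg_interior hs' hd')) ?_
    rw [hneg, if_neg (show ¬(s = 0 ∨ s = 1) by tauto)]
    rcases lt_or_gt_of_ne hd with h | h
    · rw [if_neg h.not_gt, if_pos (by linarith)]; ring
    · rw [if_pos h, if_neg (by linarith)]; ring

variable {n : ℕ}

theorem lineMap_eq (a b : ℂ) (s : ℝ) : AffineMap.lineMap a b s = a + s * (b - a) := by
  rw [AffineMap.lineMap_apply, vsub_eq_sub, vadd_eq_add, real_smul, add_comm]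

/-- For `c > 0`, the side from which the direction `d` crosses the edge is thus the orientation of
the edge as seen from `q`. -/
theorem cross_eq_mul_of_mem_edge {a b q d z : ℂ} {s c : ℝ} (hz : z = a + s * (b - a))
    (hz' : z = q + c * d) : cross (a - q) (b - q) = c * cross d (b - a) := by
  have ha : a - q = c * d - s * (b - a) := by linear_combination hz' - hz
  have hb : b - q = (a - q) + (b - a) := by ring
  have e1 : cross (a - q) (b - q) = cross (a - q) (b - a) := by
    rw [hb]; simp [cross]; ring
  rw [e1, ha]; simp [cross]; ring

theorem mem_segment_iff_exists (a b z : ℂ) :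
    z ∈ segment ℝ a b ↔ ∃ s ∈ Icc (0 : ℝ) 1, z = a + s * (b - a) := by
  rw [segment_eq_image']
  simp only [mem_image, real_smul]
  exact ⟨fun ⟨s, h1, h2⟩ => ⟨s, h1, h2.symm⟩, fun ⟨s, h1, h2⟩ => ⟨s, h1, h2.symm⟩⟩

theorem eventually_notMem_segment {a b q d z : ℂ} {c : ℝ} (hz : z = q + c * d)
    (hw : cross (a - q) (b - q) ≠ 0) :
    ∀ᶠ ε : ℝ in 𝓝[>] 0, z + ε * d ∉ segment ℝ a b := by
  by_cases h : z ∈ segment ℝ a b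
  · obtain ⟨s, hs, hs'⟩ := (mem_segment_iff_exists _ _ _).1 h
    rw [cross_eq_mul_of_mem_edge hs' hz] at hw
    filter_upwards [self_mem_nhdsWithin] with ε hε hmem
    obtain ⟨t, ht, ht'⟩ := (mem_segment_iff_exists _ _ _).1 hmem
    have : (ε : ℂ) * d = (t - s : ℝ) * (b - a) := by
      push_cast; linear_combination ht' - hs'
    have h2 : ε * cross d (b - a) = 0 := by
      have h3 : cross (ε * d) (b - a) = 0 := by rw [this]; simp [cross]; ring
      rw [← h3]; simp [cross]; ring
    rcases mul_eq_zero.1 h2 with h4 | h4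
    · exact (ne_of_gt hε) h4
    · exact hw (by rw [h4, mul_zero])
  · exact (tendsto_radial z d).eventually ((isClosed_segment a b).isOpen_compl.mem_nhds h)

/-- A visible point sees past a boundary point only at a vertex where the angle seen from `q` has a
local extremum. -/
theorem extremal_vertex_of_visible [NeZero n] {v : ZMod n → ℂ} {q y : ℂ} (hs : IsSimplePolygon v)
    (hw : ∀ k : ZMod n, cross (v k - q) (v (k + 1) - q) ≠ 0) (hy : Visible v q y) {c : ℝ}
    (hc : c ∈ Ioo (0 : ℝ) 1) {k : ZMod n} {s : ℝ} (hsI : s ∈ Ico (0 : ℝ) 1)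
    (hx : v k + s * (v (k + 1) - v k) = q + c * (y - q)) :
    s = 0 ∧ cross (v (k - 1) - q) (v k - q) * cross (v k - q) (v (k + 1) - q) < 0 := by
  set d := y - q with hd
  set z := q + c * d with hz
  have hznb : ∀ d' : ℂ, (d' = d ∨ d' = -d) → ∀ᶠ ε : ℝ in 𝓝[>] 0, z + ε * d' ∉ boundary v := by
    intro d' hd'
    have : ∀ l : ZMod n, ∀ᶠ ε : ℝ in 𝓝[>] 0, z + ε * d' ∉ segment ℝ (v l) (v (l + 1)) := by
      intro l
      rcases hd' with rfl | rfl
      · exact eventually_notMem_segment hz (hw l)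
      · exact eventually_notMem_segment (c := -c) (by rw [hz]; push_cast; ring) (hw l)
    filter_upwards [eventually_all.2 this] with ε hε
    simpa [boundary] using hε
  -- Just before and just after `z` the line of sight runs inside the polygon, so the angles under
  -- which the edges are seen add up to `2π` on both sides.
  have hsum : ∀ d' : ℂ, (d' = d ∨ d' = -d) → ∀ᶠ ε : ℝ in 𝓝[>] 0,
      ∑ l : ZMod n, edgeArg (v l) (v (l + 1)) (z + ε * d') = 2 * Real.pi := by
    intro d' hd'
    have hsmall : ∀ᶠ ε : ℝ in 𝓝[>] 0, ε < min c (1 - c) :=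
      Filter.Eventually.filter_mono nhdsWithin_le_nhds
        (eventually_lt_nhds (lt_min hc.1 (by linarith [hc.2])))
    filter_upwards [hznb d' hd', hsmall, self_mem_nhdsWithin] with ε h1 h2 h3
    have h3 : 0 < ε := h3
    have hreg : z + ε * d' ∈ region v := by
      have h2a := lt_of_lt_of_le h2 (min_le_left _ _)
      have h2b := lt_of_lt_of_le h2 (min_le_right _ _)
      rw [visible_iff] at hy
      rcases hd' with rfl | rfl
      · convert hy (c + ε) ⟨by linarith, by linarith⟩ using 1
        rw [hz]; push_cast; ring
      · convert hy (c - ε) ⟨by linarith, by linarith⟩ using 1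
        rw [hz]; push_cast; ring
    rcases hreg with h4 | h4
    · exact absurd h4 h1
    · have h5 := h4.2
      unfold windingNumber at h5
      rw [div_eq_one_iff_eq (by positivity)] at h5
      exact h5
  have hn1 : (1 : ZMod n) ≠ 0 := by
    have : Fact (1 < n) := ⟨by have := hs.1; omega⟩
    exact one_ne_zero
  -- positions of the point on the closed edges
  have hpos : ∀ l : ZMod n, ∀ t ∈ Icc (0 : ℝ) 1, z = v l + t * (v (l + 1) - v l) →
      (l = k ∧ t = s) ∨ (l = k - 1 ∧ t = 1 ∧ s = 0) := by
    intro l t ht htz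
    rcases ht.2.lt_or_eq with h | rfl
    · exact Or.inl (hs.2 l k t ⟨ht.1, h⟩ s hsI (by rw [lineMap_eq, lineMap_eq, ← htz, hx]))
    · right
      have := hs.2 (l + 1) k 0 (by simp) s hsI (by
        rw [lineMap_eq, lineMap_eq, hx, htz]; simp)
      exact ⟨by rw [← this.1]; ring, rfl, this.2.symm⟩
  -- the jumps
  have hjump : ∀ l : ZMod n, ∀ t ∈ Icc (0 : ℝ) 1, z = v l + t * (v (l + 1) - v l) →
      Tendsto (fun ε : ℝ => edgeArg (v l) (v (l + 1)) (z + ε * d)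
        - edgeArg (v l) (v (l + 1)) (z + ε * -d)) (𝓝[>] 0)
      (𝓝 ((if t = 0 ∨ t = 1 then 1 else 2) *
        if 0 < cross (v l - q) (v (l + 1) - q) then -Real.pi else Real.pi)) := by
    intro l t ht htz
    have e := cross_eq_mul_of_mem_edge htz hz
    have hne : cross d (v (l + 1) - v l) ≠ 0 := by
      intro h0; apply hw l; rw [e, h0, mul_zero]
    have := tendsto_edgeArg_sub ht htz hne
    simpa only [e, mul_pos_iff_of_pos_left hc.1] using this
  have hzero : ∀ l : ZMod n, z ∉ segment ℝ (v l) (v (l + 1)) →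
      Tendsto (fun ε : ℝ => edgeArg (v l) (v (l + 1)) (z + ε * d)
        - edgeArg (v l) (v (l + 1)) (z + ε * -d)) (𝓝[>] 0) (𝓝 0) := by
    intro l hl
    simpa using (tendsto_edgeArg_of_notMem hl d).sub (tendsto_edgeArg_of_notMem hl (-d))
  -- The sums on the two sides agree, so the jumps of the single edges must cancel.
  have htot : ∀ J : ZMod n → ℝ, (∀ l, Tendsto (fun ε : ℝ => edgeArg (v l) (v (l + 1)) (z + ε * d)
        - edgeArg (v l) (v (l + 1)) (z + ε * -d)) (𝓝[>] 0) (𝓝 (J l))) → ∑ l, J l = 0 := by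
    intro J hJ
    have h1 := tendsto_finsetSum (Finset.univ : Finset (ZMod n)) fun l _ => hJ l
    have h2 : Tendsto (fun ε : ℝ => ∑ l, (edgeArg (v l) (v (l + 1)) (z + ε * d)
        - edgeArg (v l) (v (l + 1)) (z + ε * -d))) (𝓝[>] 0) (𝓝 0) := by
      refine tendsto_const_nhds.congr' ?_
      filter_upwards [hsum d (Or.inl rfl), hsum (-d) (Or.inr rfl)] with ε h3 h4
      rw [Finset.sum_sub_distrib, h3, h4, sub_self]
    exact tendsto_nhds_unique h1 h2
  have hsk := hjump k s ⟨hsI.1, hsI.2.le⟩ hx.symm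
  have hnot : ∀ l, l ≠ k → (s = 0 → l ≠ k - 1) → z ∉ segment ℝ (v l) (v (l + 1)) := by
    intro l h1 h2 hmem
    obtain ⟨t, ht, htz⟩ := (mem_segment_iff_exists _ _ _).1 hmem
    rcases hpos l t ht htz with h | h
    · exact h1 h.1
    · exact h2 h.2.2 h.1
  have hpi := Real.pi_pos
  by_cases hs0 : s = 0
  · refine ⟨hs0, ?_⟩
    have hkk : k - 1 ≠ k := by
      intro h; apply hn1; linear_combination -h
    have hz1 : z = v (k - 1) + (1 : ℝ) * (v (k - 1 + 1) - v (k - 1)) := by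
      rw [← hx, hs0]; simp
    have hsk' := hjump (k - 1) 1 (by simp) hz1
    have := htot (fun l => if l = k then
        (if 0 < cross (v k - q) (v (k + 1) - q) then -Real.pi else Real.pi) else if l = k - 1 then
        (if 0 < cross (v (k - 1) - q) (v k - q) then -Real.pi else Real.pi) else 0) (by
      intro l
      by_cases h1 : l = k
      · subst h1; simpa [hs0] using hsk
      · by_cases h2 : l = k - 1
        · subst h2; simpa [hkk] using hsk'
        · simpa [h1, h2] using hzero l (hnot l h1 fun _ => h2))
    rw [Fintype.sum_eq_add k (k - 1) hkk.symm (by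
      -- At a vertex only the two incident edges jump, each by `π` up to sign; cancellation forces
      -- opposite orientations.
      intro l hl; simp [hl.1, hl.2])] at this
    simp only [if_true, if_neg hkk] at this
    have hw1 := hw k
    have hw2 := hw (k - 1)
    rw [sub_add_cancel] at hw2
    split_ifs at this with h1 h2 h2
    · linarith
    · exact mul_neg_of_neg_of_pos (lt_of_le_of_ne (not_lt.1 h2) hw2) h1
    · exact mul_neg_of_pos_of_neg h2 (lt_of_le_of_ne (not_lt.1 h1) hw1)
    · linarith
  -- At an inner point of an edge there is a single jump of `2π` up to sign, and nothing to cancel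
  -- it.
  · exfalso
    have := htot (fun l => if l = k then
        2 * (if 0 < cross (v k - q) (v (k + 1) - q) then -Real.pi else Real.pi) else 0) (by
      intro l
      by_cases h1 : l = k
      · subst h1; simpa [hs0, hsI.2.ne] using hsk
      · simpa [h1] using hzero l (hnot l h1 fun h => absurd h hs0))
    simp only [Finset.sum_ite_eq', Finset.mem_univ, if_true] at this
    split_ifs at this <;> linarith

end ChainVisibility

namespace ChainVisibility

open Complex Filter Topology Set

variable {n : ℕ}

/-! ### The boundary as a periodic curve, in polar coordinates -/

/-- The periodic extension of `curve`. -/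
noncomputable def loop (v : ZMod n → ℂ) (i : ZMod n) (t : ℝ) : ℂ :=
  v (i + (⌊t⌋ : ℤ)) + (Int.fract t : ℝ) * (v (i + (⌊t⌋ : ℤ) + 1) - v (i + (⌊t⌋ : ℤ)))

/-- The right end `k + 1` is included although the floor has changed there: both edge formulas give
the common vertex. This allows each edge to be treated as a closed piece. -/
theorem loop_of_mem (v : ZMod n → ℂ) (i : ZMod n) {k : ℤ} {t : ℝ} (ht : t ∈ Icc (k : ℝ) (k + 1)) :
    loop v i t = v (i + k) + (t - k : ℝ) * (v (i + k + 1) - v (i + k)) := by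
  rcases ht.2.lt_or_eq with h | h
  · have : ⌊t⌋ = k := Int.floor_eq_iff.2 ⟨ht.1, h⟩
    rw [loop, Int.fract, this]
  · have h2 : t = ((k + 1 : ℤ) : ℝ) := by push_cast; exact h
    have : ⌊t⌋ = k + 1 := by rw [h2, Int.floor_intCast]
    rw [loop, Int.fract, this, h]; push_cast; simp [add_assoc]

theorem loop_int (v : ZMod n → ℂ) (i : ZMod n) (k : ℤ) : loop v i k = v (i + k) := by
  rw [loop_of_mem v i (k := k) ⟨le_rfl, by linarith⟩]; simp

theorem curve_eq_loop (v : ZMod n → ℂ) (i : ZMod n) {t : ℝ} (ht : 0 ≤ t) :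
    curve v i t = loop v i t := by
  have h : ((⌊t⌋₊ : ℕ) : ℤ) = ⌊t⌋ := by rw [Int.natCast_floor_eq_floor ht]
  have h2 : ((⌊t⌋₊ : ℕ) : ZMod n) = ((⌊t⌋ : ℤ) : ZMod n) := by rw [← h]; simp
  have h3 : ((⌊t⌋₊ : ℕ) : ℝ) = ((⌊t⌋ : ℤ) : ℝ) := by rw [← h]; simp
  rw [curve, lineMap_eq, loop, h2, h3, Int.fract]

theorem continuous_of_continuousOn_Icc_int {X : Type*} [TopologicalSpace X] {f : ℝ → X}
    (h : ∀ k : ℤ, ContinuousOn f (Icc (k : ℝ) (k + 1))) : Continuous f := by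
  rw [continuous_iff_continuousAt]
  intro t
  rw [continuousAt_iff_continuous_left_right]
  constructor
  · have h1 : ((⌈t⌉ - 1 : ℤ) : ℝ) < t := by push_cast; linarith [Int.ceil_lt_add_one t]
    have h2 : t ≤ ((⌈t⌉ - 1 : ℤ) : ℝ) + 1 := by push_cast; linarith [Int.le_ceil t]
    refine ((h (⌈t⌉ - 1)) t ⟨h1.le, h2⟩).mono_of_mem_nhdsWithin ?_
    filter_upwards [self_mem_nhdsWithin, mem_nhdsWithin_of_mem_nhds (lt_mem_nhds h1)] with s hs hs2
    exact ⟨le_of_lt hs2, le_trans hs h2⟩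
  · have h1 : (⌊t⌋ : ℝ) ≤ t := Int.floor_le t
    have h2 : t < (⌊t⌋ : ℝ) + 1 := Int.lt_floor_add_one t
    refine ((h ⌊t⌋) t ⟨h1, h2.le⟩).mono_of_mem_nhdsWithin ?_
    filter_upwards [self_mem_nhdsWithin, mem_nhdsWithin_of_mem_nhds (gt_mem_nhds h2)] with s hs hs2
    exact ⟨le_trans h1 hs, le_of_lt hs2⟩

theorem continuous_loop (v : ZMod n → ℂ) (i : ZMod n) : Continuous (loop v i) := by
  refine continuous_of_continuousOn_Icc_int fun k => ?_
  refine ContinuousOn.congr (f := fun t : ℝ =>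
    v (i + k) + (t - k : ℝ) * (v (i + k + 1) - v (i + k))) (by fun_prop) ?_
  intro t ht
  exact loop_of_mem v i ht

theorem loop_mem_boundary (v : ZMod n → ℂ) (i : ZMod n) (t : ℝ) : loop v i t ∈ boundary v := by
  refine mem_iUnion.2 ⟨i + (⌊t⌋ : ℤ), (mem_segment_iff_exists _ _ _).2 ⟨Int.fract t,
    ⟨Int.fract_nonneg t, (Int.fract_lt_one t).le⟩, rfl⟩⟩

theorem exists_loop_eq_of_mem_boundary {v : ZMod n → ℂ} (i : ZMod n) {z : ℂ}
    (hz : z ∈ boundary v) : ∃ t : ℝ, loop v i t = z := by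
  obtain ⟨k, hk⟩ := mem_iUnion.1 hz
  obtain ⟨s, hs, rfl⟩ := (mem_segment_iff_exists _ _ _).1 hk
  obtain ⟨j, hj⟩ := ZMod.intCast_surjective (k - i)
  refine ⟨j + s, ?_⟩
  rw [loop_of_mem v i (k := j) ⟨by linarith [hs.1], by linarith [hs.2]⟩, hj]
  simp

theorem loop_add_period (v : ZMod n → ℂ) (i : ZMod n) (t : ℝ) (j : ℤ) :
    loop v i (t + j * n) = loop v i t := by
  have h : t + j * n = t + ((j * n : ℤ) : ℝ) := by push_cast; ring
  rw [h, loop, loop, Int.floor_add_intCast, Int.fract_add_intCast]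
  push_cast; simp

theorem exists_int_of_loop_eq [NeZero n] {v : ZMod n → ℂ} (hs : IsSimplePolygon v) (i : ZMod n)
    {s t : ℝ} (h : loop v i s = loop v i t) : ∃ j : ℤ, t = s + j * n := by
  have := hs.2 (i + (⌊s⌋ : ℤ)) (i + (⌊t⌋ : ℤ)) (Int.fract s) ⟨Int.fract_nonneg _, Int.fract_lt_one _⟩
    (Int.fract t) ⟨Int.fract_nonneg _, Int.fract_lt_one _⟩ (by
      rw [lineMap_eq, lineMap_eq]; exact h)
  have h1 := (ZMod.intCast_eq_intCast_iff_dvd_sub _ _ _).1 (add_left_cancel this.1)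
  obtain ⟨j, hj⟩ := h1
  refine ⟨j, ?_⟩
  have h2 : (⌊t⌋ : ℝ) - ⌊s⌋ = n * j := by exact_mod_cast hj
  have h3 := Int.floor_add_fract s
  have h4 := Int.floor_add_fract t
  rw [← h3, ← h4, this.2]; linear_combination h2

/-- `cross` of the `k`-th edge of the boundary, counted from `v i`: its sign tells whether the
angle seen from `q` increases. -/
noncomputable def edgeCross (v : ZMod n → ℂ) (q : ℂ) (i : ZMod n) (k : ℤ) : ℝ :=
  cross (v (i + k) - q) (v (i + k + 1) - q)

theorem edgeCross_sub_one (v : ZMod n → ℂ) (q : ℂ) (i : ZMod n) (k : ℤ) :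
    edgeCross v q i (k - 1) = cross (v (i + k - 1) - q) (v (i + k) - q) := by
  unfold edgeCross
  push_cast
  congr 3 <;> ring

/-- Polar coordinates `(exp ρ, θ)` about `q` of the boundary of a simple polygon around `q`, none of
whose edges points to `q`. -/
structure PolarView [NeZero n] (v : ZMod n → ℂ) (q : ℂ) (i : ZMod n) (θ ρ : ℝ → ℝ) : Prop where
  simple : IsSimplePolygon v
  inside : q ∈ inside v
  transversal : ∀ k : ZMod n, cross (v k - q) (v (k + 1) - q) ≠ 0
  cont_angle : Continuous θ
  cont_radius : Continuous ρ
  loop_sub : ∀ t, loop v i t - q = exp (ρ t + θ t * I)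

theorem isSimplyConnected_of_convex {E : Type*} [AddCommGroup E] [Module ℝ E] [TopologicalSpace E]
    [ContinuousAdd E] [ContinuousSMul ℝ E] {S : Set E} (hS : Convex ℝ S) (hne : S.Nonempty) :
    IsSimplyConnected S := by
  have := hS.contractibleSpace hne
  exact SimplyConnectedSpace.ofContractible S

/-- As `q` is off the boundary, `loop v i t - q` never vanishes, and it has a continuous logarithm
on the simply connected line. -/
theorem exists_polarView [NeZero n] {v : ZMod n → ℂ} {q : ℂ} (i : ZMod n) (hs : IsSimplePolygon v)
    (hq : q ∈ inside v) (hw : ∀ k : ZMod n, cross (v k - q) (v (k + 1) - q) ≠ 0) :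
    ∃ θ ρ : ℝ → ℝ, PolarView v q i θ ρ := by
  obtain ⟨f, hf, hf'⟩ := exists_continuousOn_eqOn_exp_comp (U := (univ : Set ℝ))
    (g := fun t => loop v i t - q) (isSimplyConnected_of_convex convex_univ univ_nonempty) isOpen_univ
    ((continuous_loop v i).sub continuous_const).continuousOn (by
      rintro ⟨t, -, ht⟩
      exact hq.1 (sub_eq_zero.1 ht ▸ loop_mem_boundary v i t))
  rw [continuousOn_univ] at hf
  refine ⟨fun t => (f t).im, fun t => (f t).re, hs, hq, hw, continuous_im.comp hf,
    continuous_re.comp hf, fun t => ?_⟩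
  rw [re_add_im]
  exact (hf' (mem_univ t)).symm

/-- Along a straight edge the area swept out from `q` is proportional to the parameter. -/
theorem cross_loop {v : ZMod n → ℂ} {q : ℂ} {i : ZMod n} {k : ℤ} {s t : ℝ}
    (hs : s ∈ Icc (k : ℝ) (k + 1)) (ht : t ∈ Icc (k : ℝ) (k + 1)) :
    cross (loop v i s - q) (loop v i t - q) = (t - s) * edgeCross v q i k := by
  rw [loop_of_mem v i hs, loop_of_mem v i ht]
  simp [edgeCross, cross]; ring

namespace PolarView

variable [NeZero n] {v : ZMod n → ℂ} {q : ℂ} {i : ZMod n} {θ ρ : ℝ → ℝ}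

theorem loop_ne (h : PolarView v q i θ ρ) (t : ℝ) : loop v i t - q ≠ 0 := by
  rw [h.loop_sub]; exact exp_ne_zero _

theorem edgeCross_ne (h : PolarView v q i θ ρ) (k : ℤ) : edgeCross v q i k ≠ 0 :=
  h.transversal _

theorem loop_eq_of_angle_eq (h : PolarView v q i θ ρ) {s t : ℝ} {j : ℤ}
    (hst : θ s = θ t + j * (2 * Real.pi)) :
    loop v i s = q + (Real.exp (ρ s - ρ t) : ℝ) * (loop v i t - q) := by
  rw [← sub_eq_iff_eq_add', h.loop_sub, h.loop_sub, ofReal_exp, ← exp_add]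
  refine exp_eq_exp_iff_exists_int.2 ⟨j, ?_⟩
  rw [hst]; push_cast; ring

theorem exists_int_angle_eq (h : PolarView v q i θ ρ) {s t c : ℝ} (hc : 0 < c)
    (hst : loop v i s = q + c * (loop v i t - q)) :
    ρ s = Real.log c + ρ t ∧ ∃ j : ℤ, θ s = θ t + j * (2 * Real.pi) := by
  have h1 : loop v i s - q = c * (loop v i t - q) := by rw [hst]; ring
  have h0 : exp (Real.log c : ℂ) = c := by rw [← ofReal_exp, Real.exp_log hc]
  rw [h.loop_sub, h.loop_sub, ← h0, ← exp_add] at h1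
  obtain ⟨j, hj⟩ := exp_eq_exp_iff_exists_int.1 h1
  have hre := congrArg Complex.re hj
  have him := congrArg Complex.im hj
  simp at hre him
  exact ⟨hre, j, him⟩

theorem notMem_segment (h : PolarView v q i θ ρ) {k : ℤ} {s t : ℝ}
    (hs : s ∈ Icc (k : ℝ) (k + 1)) (ht : t ∈ Icc (k : ℝ) (k + 1)) :
    q ∉ segment ℝ (loop v i s) (loop v i t) := by
  intro hmem
  obtain ⟨c, hc, hq⟩ := (mem_segment_iff_exists _ _ _).1 hmem
  refine h.inside.1 (hq ▸ ?_)
  have : loop v i s + c * (loop v i t - loop v i s) = loop v i (s + c * (t - s)) := by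
    rw [loop_of_mem v i hs, loop_of_mem v i ht, loop_of_mem v i (k := k)]
    · push_cast; ring
    · constructor <;> nlinarith [hs.1, hs.2, ht.1, ht.2, hc.1, hc.2]
  rw [this]
  exact loop_mem_boundary v i _

/-- Both sides are imaginary parts of continuous logarithms of the same quotient along the edge, and
both vanish at `t = s`. The principal branch is continuous here because `q` is not on the edge. -/
theorem angle_sub (h : PolarView v q i θ ρ) {k : ℤ} {s t : ℝ}
    (hs : s ∈ Icc (k : ℝ) (k + 1)) (ht : t ∈ Icc (k : ℝ) (k + 1)) :
    θ t - θ s = arg ((loop v i t - q) / (loop v i s - q)) := by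
  have hc := h.cont_angle
  have hc' := h.cont_radius
  have := eqOn_of_exp_eqOn (S := Icc (k : ℝ) (k + 1)) isPreconnected_Icc
    (f := fun t : ℝ => (ρ t + θ t * I) - (ρ s + θ s * I))
    (g := fun t : ℝ => log ((loop v i t - q) / (loop v i s - q)))
    (Continuous.continuousOn (by fun_prop)) (by
      intro x hx
      have hl := continuous_loop v i
      exact (ContinuousAt.clog (((hl.sub continuous_const).div_const _).continuousAt)
        (div_mem_slitPlane (h.notMem_segment hs hx))).continuousWithinAt) (by
      intro x _
      rw [exp_sub, ← h.loop_sub, ← h.loop_sub, exp_log (div_ne_zero (h.loop_ne _) (h.loop_ne _))])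
    hs (by simp [div_self (h.loop_ne s)]) t ht
  have := congrArg Complex.im this
  simpa [log_im] using this

theorem angle_lt (h : PolarView v q i θ ρ) {k : ℤ} {s t : ℝ}
    (hs : s ∈ Icc (k : ℝ) (k + 1)) (ht : t ∈ Icc (k : ℝ) (k + 1)) (hst : s < t)
    (hw : 0 < edgeCross v q i k) : θ s < θ t := by
  have h1 := h.angle_sub hs ht
  have h2 : 0 < ((loop v i t - q) / (loop v i s - q)).im := by
    rw [im_div_pos_iff (h.loop_ne s), cross_loop hs ht]
    exact mul_pos (by linarith) hw
  have h3 := arg_nonneg_iff.2 h2.le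
  have h4 : arg ((loop v i t - q) / (loop v i s - q)) ≠ 0 := fun h0 =>
    h2.ne' (arg_eq_zero_iff.1 h0).2
  have := lt_of_le_of_ne h3 h4.symm
  linarith

theorem angle_gt (h : PolarView v q i θ ρ) {k : ℤ} {s t : ℝ}
    (hs : s ∈ Icc (k : ℝ) (k + 1)) (ht : t ∈ Icc (k : ℝ) (k + 1)) (hst : s < t)
    (hw : edgeCross v q i k < 0) : θ t < θ s := by
  have h1 := h.angle_sub hs ht
  have h2 : ((loop v i t - q) / (loop v i s - q)).im < 0 := by
    rw [im_div_neg_iff (h.loop_ne s), cross_loop hs ht]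
    exact mul_neg_of_pos_of_neg (by linarith) hw
  have := arg_neg_iff.2 h2
  linarith

/-- Summing the increments of `θ` over the `n` edges gives `2π` times the winding number of `q`.
This settles `t = 0`; for other `t` the increment is continuous with values in `2πℤ`, hence
constant. -/
theorem period (h : PolarView v q i θ ρ) (t : ℝ) :
    θ (t + n) = θ t + 2 * Real.pi ∧ ρ (t + n) = ρ t := by
  have hc := h.cont_angle
  have hn : θ n - θ 0 = 2 * Real.pi := by
    have h1 : ∀ j : ℕ, θ j - θ 0 = ∑ l ∈ Finset.range j,
        arg ((v (i + l + 1) - q) / (v (i + l) - q)) := by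
      intro j
      induction j with
      | zero => simp
      | succ j ih =>
        rw [Finset.sum_range_succ, ← ih]
        have := h.angle_sub (k := j) (s := j) (t := j + 1) ⟨by simp, by simp⟩ ⟨by simp, by simp⟩
        have e1 : loop v i (j : ℝ) = v (i + j) := by
          have := loop_int v i (j : ℤ); simpa using this
        have e2 : loop v i ((j : ℝ) + 1) = v (i + j + 1) := by
          have := loop_int v i ((j + 1 : ℕ) : ℤ); push_cast at this; rw [this, add_assoc]
        rw [e1, e2] at this
        push_cast; linarith
    have h2 := h.inside.2
    unfold windingNumber at h2
    rw [div_eq_one_iff_eq (by positivity)] at h2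
    rw [h1, ← h2, ← Equiv.sum_comp (Equiv.addLeft i)]
    simp only [Equiv.coe_addLeft]
    refine Finset.sum_bij' (fun (l : ℕ) _ => (l : ZMod n)) (fun x _ => x.val) ?_ ?_ ?_ ?_ ?_
    · simp
    · intro x _; simpa using ZMod.val_lt x
    · intro l hl; exact ZMod.val_cast_of_lt (by simpa using hl)
    · intro x _; simp
    · intro l _; rfl
  have key : ∀ t, ρ (t + n) = ρ t ∧ ∃ j : ℤ, θ (t + n) = θ t + j * (2 * Real.pi) := by
    intro t
    have := h.exists_int_angle_eq (s := t + n) (t := t) one_pos (by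
      have := loop_add_period v i t 1
      simp only [Int.cast_one, one_mul] at this
      rw [this]; push_cast; ring)
    simpa using this
  refine ⟨?_, (key t).1⟩
  have hpi : (2 * Real.pi) ≠ 0 := by positivity
  have := eq_of_continuousOn_of_int (S := (univ : Set ℝ)) isPreconnected_univ
    (f := fun t => (θ (t + n) - θ t) / (2 * Real.pi)) (Continuous.continuousOn (by fun_prop)) (by
      intro x _
      obtain ⟨j, hj⟩ := (key x).2
      exact ⟨j, by rw [hj]; field_simp; ring⟩) (mem_univ t) (mem_univ 0)
  simp only [zero_add] at this
  rw [hn, div_self hpi, div_eq_one_iff_eq hpi] at this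
  linarith

theorem period_int (h : PolarView v q i θ ρ) (t : ℝ) (j : ℤ) :
    θ (t + j * n) = θ t + j * (2 * Real.pi) ∧ ρ (t + j * n) = ρ t := by
  induction j with
  | zero => simp
  | succ j ih =>
    have := h.period (t + j * n)
    have e : t + ((j + 1 : ℤ) : ℝ) * n = t + j * n + n := by push_cast; ring
    push_cast at ih e ⊢
    rw [e, this.1, this.2, ih.1, ih.2]
    exact ⟨by ring, rfl⟩
  | pred j ih =>
    have := h.period (t + ((-j - 1 : ℤ) : ℝ) * n)
    have e : t + ((-j - 1 : ℤ) : ℝ) * n + n = t + ((-j : ℤ) : ℝ) * n := by push_cast; ring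
    rw [e, ih.1, ih.2] at this
    refine ⟨?_, this.2.symm⟩
    have h1 := this.1
    push_cast at h1 ⊢
    linarith

/-- Equal polar coordinates mean equal boundary points, so the parameters differ by whole periods;
but each period changes `θ` by `2π`. -/
theorem eq_of_angle_eq (h : PolarView v q i θ ρ) {s t : ℝ} (h1 : θ s = θ t) (h2 : ρ s = ρ t) :
    s = t := by
  obtain ⟨j, hj⟩ := exists_int_of_loop_eq h.simple i (s := s) (t := t) (by
    rw [h.loop_eq_of_angle_eq (s := s) (t := t) (j := 0) (by simp [h1]), h2]; simp)
  have := (h.period_int s j).1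
  rw [← hj, ← h1] at this
  have h3 : (j : ℝ) * (2 * Real.pi) = 0 := by linarith
  have h4 : (j : ℝ) = 0 := by
    rcases mul_eq_zero.1 h3 with h | h
    · exact h
    · exact absurd h (by positivity)
  rw [hj, h4]; ring

theorem exists_angle_eq (h : PolarView v q i θ ρ) (φ : ℝ) : ∃ t, θ t = φ := by
  have hpi : 0 < 2 * Real.pi := by positivity
  obtain ⟨j, hj1, hj2⟩ : ∃ j : ℤ, θ 0 + j * (2 * Real.pi) ≤ φ ∧ φ ≤ θ 0 + (j + 1 : ℤ) * (2 * Real.pi) := by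
    refine ⟨⌊(φ - θ 0) / (2 * Real.pi)⌋, ?_, ?_⟩
    · have := Int.floor_le ((φ - θ 0) / (2 * Real.pi))
      rw [le_div_iff₀ hpi] at this; linarith
    · have := Int.lt_floor_add_one ((φ - θ 0) / (2 * Real.pi))
      rw [div_lt_iff₀ hpi] at this; push_cast; linarith
  rw [← (h.period_int 0 j).1] at hj1
  rw [← (h.period_int 0 (j + 1)).1] at hj2
  obtain ⟨t, ht⟩ := mem_range_of_exists_le_of_exists_ge h.cont_angle ⟨_, hj1⟩ ⟨_, hj2⟩
  exact ⟨t, ht⟩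

/-- Every ray from `q` meets the compact boundary in a nearest point, and this point is visible. Its
parameter is shifted by whole periods to make the angle equal to `φ` itself and not only modulo
`2π`. -/
theorem exists_firstHit (h : PolarView v q i θ ρ) (φ : ℝ) :
    ∃ s, Visible v q (loop v i s) ∧ θ s = φ ∧ ∀ t, θ t = φ → ρ s ≤ ρ t := by
  obtain ⟨t₀, ht₀⟩ := h.exists_angle_eq φ
  have hcomp : IsCompact {r : ℝ | r ∈ Icc (0 : ℝ) 1 ∧ q + r * (loop v i t₀ - q) ∈ boundary v} := by
    refine isCompact_Icc.inter_right ?_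
    exact (isCompact_boundary v).isClosed.preimage (f := fun r : ℝ => q + r * (loop v i t₀ - q))
      (by fun_prop)
  obtain ⟨r, ⟨hr, hrb⟩, hmin⟩ := hcomp.exists_isLeast
    ⟨1, ⟨by simp, by simpa using loop_mem_boundary v i t₀⟩⟩
  have hr0 : 0 < r := by
    rcases hr.1.lt_or_eq with h0 | h0
    · exact h0
    · rw [← h0] at hrb; exact absurd (by simpa using hrb) h.inside.1
  obtain ⟨s', hs'⟩ := exists_loop_eq_of_mem_boundary i hrb
  obtain ⟨hρ, j, hj⟩ := h.exists_int_angle_eq hr0 hs'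
  have hs2 := h.period_int s' (-j)
  have hls : loop v i (s' + (-j : ℤ) * n) = loop v i s' := loop_add_period v i s' (-j)
  have hθ : θ (s' + (-j : ℤ) * n) = φ := by rw [hs2.1, hj, ht₀]; push_cast; ring
  refine ⟨s' + (-j : ℤ) * n, ?_, hθ, ?_⟩
  · rw [hls, hs']
    refine visible_of_forall_lt h.inside hrb ?_
    intro u hu hb
    have : u * r ∈ {r : ℝ | r ∈ Icc (0 : ℝ) 1 ∧ q + r * (loop v i t₀ - q) ∈ boundary v} := by
      refine ⟨⟨mul_nonneg hu.1 hr.1, mul_le_one₀ hu.2.le hr.1 hr.2⟩, ?_⟩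
      convert hb using 1; push_cast; ring
    have := hmin this
    nlinarith [hu.2]
  · intro t ht
    by_contra! hlt
    have e := h.loop_eq_of_angle_eq (s := t) (t := t₀) (j := 0) (by simp [ht, ht₀])
    have hb := loop_mem_boundary v i t
    rw [e] at hb
    rw [hs2.2, hρ] at hlt
    have h1 : Real.exp (ρ t - ρ t₀) < r := by
      rw [← Real.lt_log_iff_exp_lt hr0]; linarith
    have := hmin ⟨⟨(Real.exp_pos _).le, h1.le.trans hr.2⟩, hb⟩
    linarith

theorem visible_of_angle_eq (h : PolarView v q i θ ρ) {s t : ℝ} (hs : Visible v q (loop v i s))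
    {j : ℤ} (h1 : θ t = θ s + j * (2 * Real.pi)) (h2 : ρ t ≤ ρ s) : Visible v q (loop v i t) := by
  rw [h.loop_eq_of_angle_eq h1]
  exact hs.of_le ⟨(Real.exp_pos _).le, Real.exp_le_one_iff.2 (by linarith)⟩

/-- A boundary point strictly in front of a visible point is a vertex at which the angle has a
local extremum. -/
theorem exists_vertex_of_visible (h : PolarView v q i θ ρ) {s t : ℝ}
    (hs : Visible v q (loop v i s)) (h1 : θ t = θ s) (h2 : ρ t < ρ s) :
    ∃ k : ℤ, t = k ∧ edgeCross v q i (k - 1) * edgeCross v q i k < 0 := by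
  have e := h.loop_eq_of_angle_eq (s := t) (t := s) (j := 0) (by simp [h1])
  have := extremal_vertex_of_visible h.simple h.transversal hs
    ⟨Real.exp_pos _, Real.exp_lt_one_iff.2 (by linarith)⟩ (k := i + (⌊t⌋ : ℤ)) (s := Int.fract t)
    ⟨Int.fract_nonneg t, Int.fract_lt_one t⟩ e
  refine ⟨⌊t⌋, ?_, ?_⟩
  · have h3 := Int.floor_add_fract t
    linarith [this.1]
  · rw [edgeCross_sub_one]
    exact this.2

end PolarView

end ChainVisibility

namespace ChainVisibility

open Complex Filter Topology Set

/-! ### Visible points come in angular order -/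

/-- A continuous function that only touches the value `c` does not pass through it. -/
theorem mul_nonneg_of_touching {g : ℝ → ℝ} {c x₀ x₁ : ℝ} (hx : x₀ ≤ x₁)
    (hg : ContinuousOn g (Icc x₀ x₁))
    (ht : ∀ x ∈ Icc x₀ x₁, g x = c →
      (∀ᶠ y in 𝓝[≠] x, y ∈ Icc x₀ x₁ → c < g y) ∨ (∀ᶠ y in 𝓝[≠] x, y ∈ Icc x₀ x₁ → g y < c)) :
    0 ≤ (g x₀ - c) * (g x₁ - c) := by
  have main : ∀ (f : ℝ → ℝ) (c : ℝ), ContinuousOn f (Icc x₀ x₁) →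
      (∀ x ∈ Icc x₀ x₁, f x = c → (∀ᶠ y in 𝓝[≠] x, y ∈ Icc x₀ x₁ → c < f y) ∨
        (∀ᶠ y in 𝓝[≠] x, y ∈ Icc x₀ x₁ → f y < c)) → f x₀ < c → f x₁ ≤ c := by
    intro f c hf ht h0
    by_contra! h1
    set S := {x | x ∈ Icc x₀ x₁ ∧ f x < c} with hS
    have hx₀S : x₀ ∈ S := ⟨⟨le_rfl, hx⟩, h0⟩
    have hbdd : BddAbove S := ⟨x₁, fun x hx => hx.1.2⟩
    -- At the last moment `τ` up to which values below `c` occur, `g` equals `c`. It cannot be above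
    -- `c` around `τ`, because values below `c` occur just before (or at) `τ`; it cannot be below
    -- `c` around `τ`, because none occur afterwards.
    set τ := sSup S with hτ
    have hτI : τ ∈ Icc x₀ x₁ := ⟨le_csSup hbdd hx₀S, csSup_le ⟨_, hx₀S⟩ fun x hx => hx.1.2⟩
    have hcl : IsClosed {x | x ∈ Icc x₀ x₁ ∧ f x ≤ c} :=
      hf.preimage_isClosed_of_isClosed isClosed_Icc isClosed_Iic
    have hle : f τ ≤ c := by
      have : τ ∈ closure S := csSup_mem_closure ⟨_, hx₀S⟩ hbdd
      have hsub : S ⊆ {x | x ∈ Icc x₀ x₁ ∧ f x ≤ c} := fun x hx => ⟨hx.1, hx.2.le⟩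
      exact (closure_minimal hsub hcl this).2
    have hτ1 : τ < x₁ := lt_of_le_of_ne hτI.2 fun h => by rw [h] at hle; linarith
    have hlarge : ∀ δ > 0, ∃ y, τ < y ∧ y < τ + δ ∧ y ∈ Icc x₀ x₁ := fun δ hδ =>
      ⟨min (τ + δ / 2) x₁, lt_min (by linarith) hτ1, (min_le_left _ _).trans_lt (by linarith),
        hτI.1.trans (le_min (by linarith) hτ1.le), min_le_right _ _⟩
    have hnS : ∀ y, τ < y → y ∉ S := fun y hy hyS => not_le.2 hy (le_csSup hbdd hyS)
    have heq : f τ = c := by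
      refine le_antisymm hle ?_
      by_contra! hlt
      have := (hf τ hτI).eventually (gt_mem_nhds hlt)
      rw [eventually_nhdsWithin_iff, Metric.eventually_nhds_iff] at this
      obtain ⟨δ, hδ, h⟩ := this
      obtain ⟨y, h1, h2, h3⟩ := hlarge δ hδ
      refine hnS y h1 ⟨h3, h ?_ h3⟩
      rw [Real.dist_eq, abs_lt]; constructor <;> linarith
    rcases ht τ hτI heq with h | h
    · rw [eventually_nhdsWithin_iff, Metric.eventually_nhds_iff] at h
      obtain ⟨δ, hδ, h⟩ := h
      obtain ⟨y, hyS, hy⟩ := exists_lt_of_lt_csSup ⟨_, hx₀S⟩ (show τ - δ < sSup S by linarith)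
      have hyτ : y ≤ τ := le_csSup hbdd hyS
      have hne : y ≠ τ := fun e => by rw [e] at hyS; linarith [hyS.2]
      have := h (y := y) (by rw [Real.dist_eq, abs_lt]; constructor <;> linarith) hne hyS.1
      linarith [hyS.2]
    · rw [eventually_nhdsWithin_iff, Metric.eventually_nhds_iff] at h
      obtain ⟨δ, hδ, h⟩ := h
      obtain ⟨y, h1, h2, h3⟩ := hlarge δ hδ
      exact hnS y h1 ⟨h3, h (by rw [Real.dist_eq, abs_lt]; constructor <;> linarith) h1.ne' h3⟩
  rcases lt_trichotomy (g x₀) c with h | h | h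
  · have := main g c hg ht h
    nlinarith
  · rw [h]; simp
  · have := main (fun x => -g x) (-c) hg.neg (by
      intro x hx hxc
      rcases ht x hx (by linarith) with h | h
      · right; filter_upwards [h] with y hy hyI; linarith [hy hyI]
      · left; filter_upwards [h] with y hy hyI; linarith [hy hyI]) (by linarith)
    nlinarith

variable {n : ℕ} [NeZero n] {v : ZMod n → ℂ} {q : ℂ} {i : ZMod n} {θ ρ : ℝ → ℝ}

namespace PolarView

/-- By periodicity, `θ t` differs from `2π t / n` by a bounded amount. -/
theorem exists_angle_lt_of_far (h : PolarView v q i θ ρ) :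
    ∃ N > 0, ∀ u t : ℝ, N ≤ t - u → θ u < θ t := by
  obtain ⟨B, hB⟩ := isCompact_Icc.exists_bound_of_continuousOn (s := Icc (0 : ℝ) n)
    h.cont_angle.continuousOn
  have hn : (0 : ℝ) < n := by exact_mod_cast NeZero.pos n
  have hpi := Real.pi_pos
  have hB0 : 0 ≤ B := (norm_nonneg _).trans (hB 0 ⟨le_rfl, hn.le⟩)
  have key : ∀ t : ℝ, |θ t - (t / n) * (2 * Real.pi)| ≤ B + 2 * Real.pi := by
    intro t
    have h1 := h.period_int (t - ⌊t / n⌋ * n) ⌊t / n⌋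
    rw [sub_add_cancel] at h1
    have h2 := Int.floor_le (t / n)
    have h3 := Int.lt_floor_add_one (t / n)
    have h4 : (⌊t / n⌋ : ℝ) * n ≤ t := by rwa [le_div_iff₀ hn] at h2
    have h5 : t < (⌊t / n⌋ + 1 : ℝ) * n := by rwa [div_lt_iff₀ hn] at h3
    have h6 := hB (t - ⌊t / n⌋ * n) ⟨by linarith, by linarith⟩
    rw [Real.norm_eq_abs, abs_le] at h6
    rw [h1.1, abs_le]
    constructor <;> nlinarith
  refine ⟨n * (B / Real.pi + 3), by positivity, fun u t hut => ?_⟩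
  have h1 := abs_le.1 (key u)
  have h2 := abs_le.1 (key t)
  have h3 : B / Real.pi + 3 ≤ t / n - u / n := by
    rw [← sub_div, le_div_iff₀ hn]; linarith
  have h4 : (B / Real.pi + 3) * (2 * Real.pi) ≤ (t / n - u / n) * (2 * Real.pi) := by gcongr
  have h5 : (B / Real.pi + 3) * (2 * Real.pi) = 2 * B + 6 * Real.pi := by field_simp; ring
  linarith

/-- A continuous choice of the direction, in the `(θ, ρ)`-plane, of the chord from parameter `u` to
a later parameter `t`, pointing to the right when `t` is far from `u`. -/
theorem exists_chordAngle (h : PolarView v q i θ ρ) :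
    ∃ α : ℝ × ℝ → ℝ, ContinuousOn α {p | p.1 < p.2} ∧
      (∀ u t : ℝ, u < t → ∃ R > 0,
        θ t - θ u = R * Real.cos (α (u, t)) ∧ ρ t - ρ u = R * Real.sin (α (u, t))) ∧
      ∃ N > 0, ∀ u t : ℝ, N ≤ t - u → |α (u, t)| < Real.pi / 2 := by
  obtain ⟨N, hN, hfar⟩ := h.exists_angle_lt_of_far
  have hθ := h.cont_angle
  have hρ := h.cont_radius
  set g : ℝ × ℝ → ℂ := fun p => ((θ p.2 - θ p.1 : ℝ) : ℂ) + ((ρ p.2 - ρ p.1 : ℝ) : ℂ) * I with hg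
  have hgc : Continuous g := by fun_prop
  have hgre : ∀ p, (g p).re = θ p.2 - θ p.1 := fun p => by simp [hg]
  have hgim : ∀ p, (g p).im = ρ p.2 - ρ p.1 := fun p => by simp [hg]
  set U : Set (ℝ × ℝ) := {p | p.1 < p.2} with hU
  have hUo : IsOpen U := isOpen_lt continuous_fst continuous_snd
  have hlin : IsLinearMap ℝ (fun p : ℝ × ℝ => p.2 - p.1) :=
    ((LinearMap.snd ℝ ℝ ℝ) - (LinearMap.fst ℝ ℝ ℝ)).isLinear
  have hUc : Convex ℝ U := by
    have := convex_halfSpace_gt hlin 0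
    simpa [hU] using this
  -- The chord vector never vanishes on the half-plane, since the lifted curve is injective; so it
  -- has a continuous logarithm there.
  obtain ⟨f, hf, hf'⟩ := exists_continuousOn_eqOn_exp_comp
    (isSimplyConnected_of_convex hUc ⟨(0, 1), by simp [hU]⟩) hUo hgc.continuousOn (by
      rintro ⟨p, hp, hp0⟩
      have h1 := hgre p
      have h2 := hgim p
      rw [hp0, zero_re] at h1
      rw [hp0, zero_im] at h2
      exact (ne_of_lt hp) (h.eq_of_angle_eq (by linarith) (by linarith)))
  set F : Set (ℝ × ℝ) := {p | N ≤ p.2 - p.1} with hF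
  have hFU : F ⊆ U := fun p hp => by
    have : N ≤ p.2 - p.1 := hp
    show p.1 < p.2
    linarith
  have hFpos : ∀ p ∈ F, 0 < (g p).re := fun p hp => by rw [hgre]; linarith [hfar _ _ hp]
  have hint : ∀ p ∈ F, ∃ k : ℤ, ((f p).im - arg (g p)) / (2 * Real.pi) = k := by
    intro p hp
    have h1 : exp (f p) = exp (log (g p)) := by
      rw [exp_log, ← hf' (hFU hp)]
      · rfl
      · intro h0; have := hFpos p hp; rw [h0] at this; simp at this
    obtain ⟨k, hk⟩ := exp_eq_exp_iff_exists_int.1 h1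
    refine ⟨k, ?_⟩
    have := congrArg Complex.im hk
    simp only [add_im, log_im, mul_im, intCast_re, intCast_im] at this
    rw [this]
    simp
  have hmem : ((0, N) : ℝ × ℝ) ∈ F := by simp [hF]
  have hcont : ContinuousOn (fun p => ((f p).im - arg (g p)) / (2 * Real.pi)) F := by
    refine ((continuous_im.comp_continuousOn (hf.mono hFU)).sub ?_).div_const _
    intro p hp
    exact ((continuousAt_arg (Or.inl (hFpos p hp))).comp hgc.continuousAt).continuousWithinAt
  obtain ⟨k, hk⟩ := hint _ hmem
  -- The correction `k`, read off at one pair of distant parameters, serves for all of them because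
  -- they form a connected set.
  refine ⟨fun p => (f p).im - k * (2 * Real.pi),
    (continuous_im.comp_continuousOn hf).sub continuousOn_const, ?_, N, hN, ?_⟩
  · intro u t hut
    refine ⟨Real.exp (f (u, t)).re, Real.exp_pos _, ?_, ?_⟩
    · rw [Real.cos_sub_int_mul_two_pi, ← exp_re, ← hgre (u, t), ← hf' hut]; rfl
    · rw [Real.sin_sub_int_mul_two_pi, ← exp_im, ← hgim (u, t), ← hf' hut]; rfl
  · intro u t hut
    have h1 := eq_of_continuousOn_of_int (convex_halfSpace_ge hlin N).isPreconnected hcont hint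
      (x := (u, t)) hut hmem
    rw [hk, div_eq_iff (by positivity)] at h1
    have h2 : (f (u, t)).im - k * (2 * Real.pi) = arg (g (u, t)) := by linarith
    simp only [h2]
    exact abs_arg_lt_pi_div_two_iff.2 (Or.inl (hFpos _ hut))

/-- A boundary point in front of a visible one is a vertex whose two edges have opposite
orientations, and the angle is strictly monotone on each of them. -/
theorem eventually_angle (h : PolarView v q i θ ρ) {s t : ℝ} (hs : Visible v q (loop v i s))
    (h1 : θ t = θ s) (h2 : ρ t < ρ s) :
    (∀ᶠ y in 𝓝[≠] t, θ s < θ y) ∨ (∀ᶠ y in 𝓝[≠] t, θ y < θ s) := by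
  obtain ⟨k, rfl, hk⟩ := h.exists_vertex_of_visible hs h1 h2
  have hnear : ∀ᶠ y in 𝓝[≠] (k : ℝ), y ∈ Ioo (k - 1 : ℝ) (k + 1) ∧ y ≠ k := by
    filter_upwards [mem_nhdsWithin_of_mem_nhds (Ioo_mem_nhds (show (k - 1 : ℝ) < k by linarith)
      (show (k : ℝ) < k + 1 by linarith)), self_mem_nhdsWithin] with y h1 h2
    exact ⟨h1, h2⟩
  have hl : ∀ y : ℝ, y ∈ Ioo (k - 1 : ℝ) (k + 1) → y < k →
      y ∈ Icc ((k - 1 : ℤ) : ℝ) ((k - 1 : ℤ) + 1) := by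
    intro y hy hyk; push_cast; exact ⟨hy.1.le, by linarith⟩
  have hk1 : (k : ℝ) ∈ Icc ((k - 1 : ℤ) : ℝ) ((k - 1 : ℤ) + 1) := by
    push_cast; constructor <;> linarith
  have hk2 : (k : ℝ) ∈ Icc (k : ℝ) (k + 1) := by constructor <;> linarith
  rcases mul_neg_iff.1 hk with ⟨ha, hb⟩ | ⟨ha, hb⟩
  · right
    filter_upwards [hnear] with y hy
    rcases lt_or_gt_of_ne hy.2 with hyk | hyk
    · linarith [h.angle_lt (hl y hy.1 hyk) hk1 hyk ha]
    · linarith [h.angle_gt hk2 ⟨hyk.le, hy.1.2.le⟩ hyk hb]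
  · left
    filter_upwards [hnear] with y hy
    rcases lt_or_gt_of_ne hy.2 with hyk | hyk
    · linarith [h.angle_gt (hl y hy.1 hyk) hk1 hyk ha]
    · linarith [h.angle_lt hk2 ⟨hyk.le, hy.1.2.le⟩ hyk hb]

/-- The direction from a visible boundary point to the others does not pass through the vertical
direction towards `q`. -/
theorem mul_nonneg_of_visible (h : PolarView v q i θ ρ) {s : ℝ} (hs : Visible v q (loop v i s))
    {g : ℝ → ℝ} {c x₀ x₁ : ℝ} (hx : x₀ ≤ x₁) (hg : ContinuousOn g (Icc x₀ x₁))
    (hR : ∀ y ∈ Icc x₀ x₁, ∃ R > 0, θ y - θ s = R * Real.sin (g y - c) ∧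
      ρ y - ρ s = -(R * Real.cos (g y - c))) : 0 ≤ (g x₀ - c) * (g x₁ - c) := by
  refine mul_nonneg_of_touching hx hg ?_
  intro x hxI hxc
  -- At level `c` the chord from `s` points straight towards `q`: the point at `x` has the same
  -- angle as the visible point and a smaller radius.
  obtain ⟨R, hR0, h1, h2⟩ := hR x hxI
  rw [hxc, sub_self] at h1 h2
  simp only [Real.sin_zero, Real.cos_zero, mul_zero, mul_one] at h1 h2
  have hnear : ∀ᶠ y in 𝓝[≠] x, y ∈ Icc x₀ x₁ → |g y - c| < Real.pi := by
    have h3 := (hg x hxI).eventually (Metric.ball_mem_nhds (g x) Real.pi_pos)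
    rw [eventually_nhdsWithin_iff] at h3
    refine Filter.Eventually.filter_mono nhdsWithin_le_nhds ?_
    filter_upwards [h3] with y hy hyI
    have := hy hyI
    rwa [Real.dist_eq, hxc] at this
  rcases h.eventually_angle hs (show θ x = θ s by linarith) (by linarith) with h3 | h3
  · left
    filter_upwards [h3, hnear] with y hy hy' hyI
    obtain ⟨R, hR0, h1, -⟩ := hR y hyI
    by_contra! hle
    have := abs_lt.1 (hy' hyI)
    have hsin : Real.sin (g y - c) ≤ 0 := Real.sin_nonpos_of_nonpos_of_neg_pi_le (by linarith) this.1.le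
    nlinarith
  · right
    filter_upwards [h3, hnear] with y hy hy' hyI
    obtain ⟨R, hR0, h1, -⟩ := hR y hyI
    by_contra! hle
    have := abs_lt.1 (hy' hyI)
    have hsin : 0 ≤ Real.sin (g y - c) := Real.sin_nonneg_of_nonneg_of_le_pi (by linarith) this.2.le
    nlinarith

/-- The bounds of the chord direction at a visible point, and what follows from them. -/
theorem exists_chordAngle_bounds (h : PolarView v q i θ ρ) :
    ∃ α : ℝ × ℝ → ℝ, ContinuousOn α {p | p.1 < p.2} ∧
      (∀ u t : ℝ, u < t → ∃ R > 0,
        θ t - θ u = R * Real.cos (α (u, t)) ∧ ρ t - ρ u = R * Real.sin (α (u, t))) ∧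
      (∀ s t : ℝ, s < t → Visible v q (loop v i s) →
        α (s, t) ∈ Icc (-(Real.pi / 2)) (3 * Real.pi / 2)) ∧
      (∀ u s : ℝ, u < s → Visible v q (loop v i s) →
        α (u, s) ∈ Icc (-(3 * Real.pi / 2)) (Real.pi / 2)) := by
  obtain ⟨α, hα, hR, N, hN, hfar⟩ := h.exists_chordAngle
  refine ⟨α, hα, hR, ?_, ?_⟩
  · intro s t hst hs
    -- Let the later end run off to the right. The branch ends up strictly between `-π/2` and
    -- `3π/2`, which are two consecutive occurrences of the downward direction, so it was between
    -- them, in the weak sense, from the start.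
    have hx : t ≤ t + N := by linarith
    have hg : ContinuousOn (fun y => α (s, y)) (Icc t (t + N)) :=
      hα.comp (by fun_prop) fun y hy => lt_of_lt_of_le hst hy.1
    have hf := abs_lt.1 (hfar s (t + N) (by linarith))
    have e1 := h.mul_nonneg_of_visible hs (c := -(Real.pi / 2)) hx hg (by
      intro y hy
      obtain ⟨R, hR0, h1, h2⟩ := hR s y (lt_of_lt_of_le hst hy.1)
      refine ⟨R, hR0, ?_, ?_⟩
      · rw [h1, sub_neg_eq_add, Real.sin_add_pi_div_two]
      · rw [h2, sub_neg_eq_add, Real.cos_add_pi_div_two]; ring)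
    have e2 := h.mul_nonneg_of_visible hs (c := 3 * Real.pi / 2) hx hg (by
      intro y hy
      obtain ⟨R, hR0, h1, h2⟩ := hR s y (lt_of_lt_of_le hst hy.1)
      have e : α (s, y) - 3 * Real.pi / 2 = α (s, y) + Real.pi / 2 - 2 * Real.pi := by ring
      refine ⟨R, hR0, ?_, ?_⟩
      · rw [h1, e, Real.sin_sub_two_pi, Real.sin_add_pi_div_two]
      · rw [h2, e, Real.cos_sub_two_pi, Real.cos_add_pi_div_two]; ring)
    constructor <;> nlinarith
  · intro u s hus hs
    -- Now the visible point is the later end. The chord seen from there is the opposite one, so it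
    -- points towards `q` at `π/2` and at `-3π/2`.
    have hx : u - N ≤ u := by linarith
    have hg : ContinuousOn (fun y => α (y, s)) (Icc (u - N) u) :=
      hα.comp (by fun_prop) fun y hy => lt_of_le_of_lt hy.2 hus
    have hf := abs_lt.1 (hfar (u - N) s (by linarith))
    have e1 := h.mul_nonneg_of_visible hs (c := Real.pi / 2) hx hg (by
      intro y hy
      obtain ⟨R, hR0, h1, h2⟩ := hR y s (lt_of_le_of_lt hy.2 hus)
      refine ⟨R, hR0, ?_, ?_⟩
      · rw [Real.sin_sub_pi_div_two]; linarith
      · rw [Real.cos_sub_pi_div_two]; linarith)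
    have e2 := h.mul_nonneg_of_visible hs (c := -(3 * Real.pi / 2)) hx hg (by
      intro y hy
      obtain ⟨R, hR0, h1, h2⟩ := hR y s (lt_of_le_of_lt hy.2 hus)
      have e : α (y, s) - -(3 * Real.pi / 2) = α (y, s) - Real.pi / 2 + 2 * Real.pi := by ring
      refine ⟨R, hR0, ?_, ?_⟩
      · rw [e, Real.sin_add_two_pi, Real.sin_sub_pi_div_two]; linarith
      · rw [e, Real.cos_add_two_pi, Real.cos_sub_pi_div_two]; linarith)
    constructor <;> nlinarith

/-- Along the boundary, the visible points are met in the order of their angles. -/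
theorem angle_le_of_visible (h : PolarView v q i θ ρ) {s t : ℝ} (hst : s < t)
    (hs : Visible v q (loop v i s)) (ht : Visible v q (loop v i t)) : θ s ≤ θ t := by
  obtain ⟨α, -, hR, h1, h2⟩ := h.exists_chordAngle_bounds
  obtain ⟨R, hR0, h3, -⟩ := hR s t hst
  -- The bounds from the two visible ends leave only `[-π/2, π/2]`.
  have hc := Real.cos_nonneg_of_mem_Icc ⟨by linarith [(h1 s t hst hs).1], (h2 s t hst ht).2⟩
  nlinarith [mul_nonneg hR0.le hc]

theorem exists_mem_Icc_eq {f : ℝ → ℝ} {a b y : ℝ} (hab : a ≤ b) (hf : ContinuousOn f (Icc a b))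
    (hy : (f a ≤ y ∧ y ≤ f b) ∨ (f b ≤ y ∧ y ≤ f a)) : ∃ x ∈ Icc a b, f x = y := by
  rcases hy with hy | hy
  · exact intermediate_value_Icc hab hf hy
  · exact intermediate_value_Icc' hab hf hy

/-- If the angle has a local maximum at a visible vertex, the boundary recedes there. -/
theorem radius_lt_of_max (h : PolarView v q i θ ρ) {u s t : ℝ} (hus : u < s) (hst : s < t)
    (hs : Visible v q (loop v i s)) (hu : θ u < θ s) (hut : θ u = θ t)
    (h1 : ∀ y ∈ Icc u s, θ u ≤ θ y) (h2 : ∀ y ∈ Icc s t, θ t ≤ θ y) : ρ u < ρ t := by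
  obtain ⟨α, hα, hR, hb1, hb2⟩ := h.exists_chordAngle_bounds
  have hpi := Real.pi_pos
  have c1 : ContinuousOn (fun y => α (u, y)) (Icc s t) :=
    hα.comp (by fun_prop) fun y hy => lt_of_lt_of_le hus hy.1
  have c2 : ContinuousOn (fun y => α (y, t)) (Icc u s) :=
    hα.comp (by fun_prop) fun y hy => lt_of_le_of_lt hy.2 hst
  obtain ⟨R₁, hR₁, e1, -⟩ := hR u s hus
  obtain ⟨R₂, hR₂, e2, -⟩ := hR s t hst
  obtain ⟨R, hR0, e3, e4⟩ := hR u t (hus.trans hst)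
  have a1 : α (u, s) < Real.pi / 2 := by
    refine lt_of_le_of_ne (hb2 u s hus hs).2 fun e => ?_
    rw [e, Real.cos_pi_div_two] at e1; linarith
  have a2 : Real.pi / 2 < α (s, t) := by
    by_contra! hle
    have := Real.cos_nonneg_of_mem_Icc ⟨by linarith [(hb1 s t hst hs).1], hle⟩
    nlinarith [mul_nonneg hR₂.le this]
  -- Let the first end move from `u` to `s`. If the direction started at or below `0`, it would be
  -- `0` at some `y`, and then `θ y < θ t`.
  have a3 : 0 < α (u, t) := by
    by_contra! hle
    obtain ⟨y, hy, hy0⟩ := exists_mem_Icc_eq hus.le c2 (y := 0) (Or.inl ⟨hle, by linarith⟩)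
    obtain ⟨R, hR0, e, -⟩ := hR y t (lt_of_le_of_lt hy.2 hst)
    rw [hy0, Real.cos_zero] at e
    linarith [h1 y hy]
  -- Let the second end move from `s` to `t`. Past `π/2` some chord would point to the left, so that
  -- `θ y < θ u`; the cap `π` keeps the chosen direction in the range where the cosine is negative.
  have a4 : α (u, t) ≤ Real.pi / 2 := by
    by_contra! hgt
    obtain ⟨y, hy, hy0⟩ := exists_mem_Icc_eq hst.le c1 (y := min (α (u, t)) Real.pi)
      (Or.inl ⟨le_min (by linarith) (by linarith), min_le_left _ _⟩)
    obtain ⟨R, hR0, e, -⟩ := hR u y (lt_of_lt_of_le hus hy.1)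
    have hc : Real.cos (α (u, y)) < 0 := by
      rw [hy0]
      exact Real.cos_neg_of_pi_div_two_lt_of_lt (lt_min hgt (by linarith))
        ((min_le_right _ _).trans_lt (by linarith))
    nlinarith [h2 y hy, mul_neg_of_pos_of_neg hR0 hc]
  have := Real.sin_pos_of_pos_of_lt_pi a3 (by linarith)
  nlinarith [mul_pos hR0 this]

/-- If the angle has a local minimum at a visible vertex, the boundary approaches there. -/
theorem radius_gt_of_min (h : PolarView v q i θ ρ) {u s t : ℝ} (hus : u < s) (hst : s < t)
    (hs : Visible v q (loop v i s)) (hu : θ s < θ u) (hut : θ u = θ t)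
    (h1 : ∀ y ∈ Icc u s, θ y ≤ θ u) (h2 : ∀ y ∈ Icc s t, θ y ≤ θ t) : ρ t < ρ u := by
  obtain ⟨α, hα, hR, hb1, hb2⟩ := h.exists_chordAngle_bounds
  have hpi := Real.pi_pos
  have c1 : ContinuousOn (fun y => α (u, y)) (Icc s t) :=
    hα.comp (by fun_prop) fun y hy => lt_of_lt_of_le hus hy.1
  have c2 : ContinuousOn (fun y => α (y, t)) (Icc u s) :=
    hα.comp (by fun_prop) fun y hy => lt_of_le_of_lt hy.2 hst
  obtain ⟨R₁, hR₁, e1, -⟩ := hR u s hus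
  obtain ⟨R₂, hR₂, e2, -⟩ := hR s t hst
  obtain ⟨R, hR0, e3, e4⟩ := hR u t (hus.trans hst)
  have a1 : α (u, s) < -(Real.pi / 2) := by
    by_contra! hle
    have := Real.cos_nonneg_of_mem_Icc ⟨by linarith, (hb2 u s hus hs).2⟩
    nlinarith [mul_nonneg hR₁.le this]
  have a2 : -(Real.pi / 2) < α (s, t) := by
    refine lt_of_le_of_ne (hb1 s t hst hs).1 fun e => ?_
    rw [← e, Real.cos_neg, Real.cos_pi_div_two] at e2; linarith
  -- As in the case of a maximum, but it is now the second end whose motion excludes the direction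
  -- `0`, and the first end whose motion excludes directions below `-π/2`.
  have a3 : α (u, t) < 0 := by
    by_contra! hle
    obtain ⟨y, hy, hy0⟩ := exists_mem_Icc_eq hst.le c1 (y := 0) (Or.inl ⟨by linarith, hle⟩)
    obtain ⟨R, hR0, e, -⟩ := hR u y (lt_of_lt_of_le hus hy.1)
    rw [hy0, Real.cos_zero] at e
    linarith [h2 y hy]
  have a4 : -(Real.pi / 2) ≤ α (u, t) := by
    by_contra! hgt
    obtain ⟨y, hy, hy0⟩ := exists_mem_Icc_eq hus.le c2 (y := max (α (u, t)) (-Real.pi))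
      (Or.inl ⟨le_max_left _ _, max_le (by linarith) (by linarith)⟩)
    obtain ⟨R, hR0, e, -⟩ := hR y t (lt_of_le_of_lt hy.2 hst)
    have hc : Real.cos (α (y, t)) < 0 := by
      rw [hy0, ← Real.cos_neg]
      have m1 := max_lt hgt (show -Real.pi < -(Real.pi / 2) by linarith)
      have m2 := le_max_right (α (u, t)) (-Real.pi)
      exact Real.cos_neg_of_pi_div_two_lt_of_lt (by linarith) (by linarith)
    nlinarith [h1 y hy, mul_neg_of_pos_of_neg hR0 hc]
  have := Real.sin_neg_of_neg_of_neg_pi_lt a3 (by linarith)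
  nlinarith [mul_neg_of_pos_of_neg hR0 this]

/-- A visible vertex at which the angle has a local extremum is critical. -/
theorem visibleCritical_of_visible (h : PolarView v q i θ ρ) {k : ℤ}
    (hs : Visible v q (loop v i k)) (hk : edgeCross v q i (k - 1) * edgeCross v q i k < 0) :
    VisibleCritical v q (i + k) := by
  have hkl : (k : ℝ) ∈ Icc ((k - 1 : ℤ) : ℝ) ((k - 1 : ℤ) + 1) := by
    push_cast; constructor <;> linarith
  have hkr : (k : ℝ) ∈ Icc (k : ℝ) (k + 1) := by constructor <;> linarith
  have hl : ∀ y ∈ Icc (k - 1 : ℝ) k, y ∈ Icc ((k - 1 : ℤ) : ℝ) ((k - 1 : ℤ) + 1) := by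
    intro y hy; push_cast; exact ⟨hy.1, by linarith [hy.2]⟩
  have hvis : Visible v q (v (i + k)) := by rwa [← loop_int v i k]
  -- The turn is read off from two points of the incident edges on one ray. If the later point is
  -- `c` times as far from `q` as the earlier one, the cross product of the edges is a positive
  -- multiple of `(1 - c)` times that of the incoming edge.
  have turn : ∀ u t : ℝ, u ∈ Ico (k - 1 : ℝ) k → t ∈ Ioc (k : ℝ) (k + 1) → θ u = θ t →
      (1 - Real.exp (ρ t - ρ u)) * edgeCross v q i (k - 1) < 0 →
      ClockwiseTurn (v (i + k - 1)) (v (i + k)) (v (i + k + 1)) := by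
    intro u t hu ht hut hneg
    have e1 := h.loop_eq_of_angle_eq (s := t) (t := u) (j := 0) (by simp [hut])
    have e2 := cross_loop (v := v) (q := q) (i := i) (hl u ⟨hu.1, hu.2.le⟩) hkl
    have e3 := loop_of_mem v i (hl u ⟨hu.1, hu.2.le⟩)
    have e4 := loop_of_mem v i (k := k) ⟨ht.1.le, ht.2⟩
    have hi : i + ((k - 1 : ℤ) : ZMod n) = i + k - 1 := by push_cast; ring
    rw [hi, sub_add_cancel] at e3
    rw [loop_int] at e2
    set c := Real.exp (ρ t - ρ u)
    have key : (k - u) * (t - k) * cross (v (i + k) - v (i + k - 1)) (v (i + k + 1) - v (i + k))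
        = (1 - c) * ((k - u) * edgeCross v q i (k - 1)) := by
      rw [← e2]
      have f1 : ((k - u : ℝ) : ℂ) * (v (i + k) - v (i + k - 1)) = (v (i + k) - q) - (loop v i u - q) := by
        rw [e3]; push_cast; ring
      have f2 : ((t - k : ℝ) : ℂ) * (v (i + k + 1) - v (i + k))
          = c * (loop v i u - q) - (v (i + k) - q) := by
        linear_combination e1 - e4
      have f3 : cross (((k - u : ℝ) : ℂ) * (v (i + k) - v (i + k - 1)))
          (((t - k : ℝ) : ℂ) * (v (i + k + 1) - v (i + k))) = (k - u) * (t - k) *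
            cross (v (i + k) - v (i + k - 1)) (v (i + k + 1) - v (i + k)) := by
        simp [cross]; ring
      rw [← f3, f1, f2]; simp [cross]; ring
    have p1 : 0 < k - u := by linarith [hu.2]
    have p2 : 0 < t - k := by linarith [ht.1]
    unfold ClockwiseTurn
    by_contra! hge
    have := mul_nonneg (mul_pos p1 p2).le hge
    nlinarith [mul_neg_of_pos_of_neg p1 hneg]
  have hθ := h.cont_angle
  have hw1 : edgeCross v q i (k - 1) = _ := edgeCross_sub_one v q i k
  have hanti : ∀ a b : ℂ, cross a b = -cross b a := fun a b => by simp [cross]; ring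
  refine ⟨?_, hvis⟩
  rcases mul_neg_iff.1 hk with ⟨ha, hb⟩ | ⟨ha, hb⟩
  · have m1 : θ (k - 1 : ℝ) < θ k := h.angle_lt (hl _ ⟨le_rfl, by linarith⟩) hkl (by linarith) ha
    have m2 : θ (k + 1 : ℝ) < θ k := h.angle_gt hkr ⟨by linarith, le_rfl⟩ (by linarith) hb
    -- The larger of the angles at the far ends of the two edges is attained on both edges.
    set φ := max (θ (k - 1 : ℝ)) (θ (k + 1 : ℝ)) with hφ
    have hφk : φ < θ k := max_lt m1 m2
    obtain ⟨u, hu, huφ⟩ := exists_mem_Icc_eq (show (k - 1 : ℝ) ≤ k by linarith) hθ.continuousOn (y := φ)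
      (Or.inl ⟨le_max_left _ _, hφk.le⟩)
    obtain ⟨t, ht, htφ⟩ := exists_mem_Icc_eq (show (k : ℝ) ≤ k + 1 by linarith) hθ.continuousOn (y := φ)
      (Or.inr ⟨le_max_right _ _, hφk.le⟩)
    have huk : u < k := lt_of_le_of_ne hu.2 fun e => by rw [e] at huφ; linarith
    have htk : (k : ℝ) < t := lt_of_le_of_ne ht.1 fun e => by rw [← e] at htφ; linarith
    have hr := h.radius_lt_of_max huk htk hs (by linarith) (by linarith) (by
      intro y hy
      rcases hy.1.eq_or_lt with e | e
      · rw [e]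
      · exact (h.angle_lt (hl u hu) (hl y ⟨hu.1.trans hy.1, hy.2⟩) e ha).le) (by
      intro y hy
      rcases hy.2.eq_or_lt with e | e
      · rw [e]
      · exact (h.angle_gt (k := k) ⟨hy.1, e.le.trans ht.2⟩ ht e hb).le)
    left
    refine ⟨by rw [AngleLT, ← hw1]; exact ha, ?_, turn u t ⟨hu.1, huk⟩ ⟨htk, ht.2⟩ (by linarith) ?_⟩
    · rw [AngleLT, hanti]; unfold edgeCross at hb; linarith
    · have : 1 < Real.exp (ρ t - ρ u) := Real.one_lt_exp_iff.2 (by linarith)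
      exact mul_neg_of_neg_of_pos (by linarith) ha
  · have m1 : θ k < θ (k - 1 : ℝ) := h.angle_gt (hl _ ⟨le_rfl, by linarith⟩) hkl (by linarith) ha
    have m2 : θ k < θ (k + 1 : ℝ) := h.angle_lt hkr ⟨by linarith, le_rfl⟩ (by linarith) hb
    set φ := min (θ (k - 1 : ℝ)) (θ (k + 1 : ℝ)) with hφ
    have hφk : θ k < φ := lt_min m1 m2
    obtain ⟨u, hu, huφ⟩ := exists_mem_Icc_eq (show (k - 1 : ℝ) ≤ k by linarith) hθ.continuousOn (y := φ)
      (Or.inr ⟨hφk.le, min_le_left _ _⟩)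
    obtain ⟨t, ht, htφ⟩ := exists_mem_Icc_eq (show (k : ℝ) ≤ k + 1 by linarith) hθ.continuousOn (y := φ)
      (Or.inl ⟨hφk.le, min_le_right _ _⟩)
    have huk : u < k := lt_of_le_of_ne hu.2 fun e => by rw [e] at huφ; linarith
    have htk : (k : ℝ) < t := lt_of_le_of_ne ht.1 fun e => by rw [← e] at htφ; linarith
    have hr := h.radius_gt_of_min huk htk hs (by linarith) (by linarith) (by
      intro y hy
      rcases hy.1.eq_or_lt with e | e
      · rw [e]
      · exact (h.angle_gt (hl u hu) (hl y ⟨hu.1.trans hy.1, hy.2⟩) e ha).le) (by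
      intro y hy
      rcases hy.2.eq_or_lt with e | e
      · rw [e]
      · exact (h.angle_lt (k := k) ⟨hy.1, e.le.trans ht.2⟩ ht e hb).le)
    right
    refine ⟨?_, by rw [AngleLT]; exact hb, turn u t ⟨hu.1, huk⟩ ⟨htk, ht.2⟩ (by linarith) ?_⟩
    · rw [AngleLT, hanti, ← hw1]; linarith
    · have : Real.exp (ρ t - ρ u) < 1 := Real.exp_lt_one_iff.2 (by linarith)
      exact mul_neg_of_pos_of_neg (by linarith) ha

/-- A boundary point strictly in front of a visible point is a visible critical vertex. -/
theorem exists_visibleCritical (h : PolarView v q i θ ρ) {s t : ℝ}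
    (hs : Visible v q (loop v i s)) (h1 : θ t = θ s) (h2 : ρ t < ρ s) :
    ∃ k : ℤ, t = k ∧ VisibleCritical v q (i + k) := by
  obtain ⟨k, rfl, hk⟩ := h.exists_vertex_of_visible hs h1 h2
  exact ⟨k, rfl, h.visibleCritical_of_visible
    (h.visible_of_angle_eq (j := 0) hs (by simp [h1]) h2.le) hk⟩

end PolarView

end ChainVisibility

namespace ChainVisibility

open Filter Topology Set

/-! ### The visible part of a curve in polar coordinates -/

/-- Otherwise `a` lies strictly behind `L` on the same ray, because nothing in the interior may
stand in front of `L`. As the angle rises just after `L`, the points there pass in front of those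
just after `a`, which are supposed to be nearest in their directions. -/
theorem left_end_eq {θ ρ : ℝ → ℝ} {L R a b : ℝ} (hθ : Continuous θ) (hρ : Continuous ρ)
    (inj : ∀ s t, θ s = θ t → ρ s = ρ t → s = t)
    (block : ∀ t, θ t = θ L → ρ t < ρ L → t ∉ Ioo L R)
    (hLa : L ≤ a) (hab : a < b) (hbR : b ≤ R) (hθa : θ a = θ L)
    (hmin : ∀ s ∈ Ioo a b, θ L < θ s ∧ ∀ t, θ t = θ s → ρ s ≤ ρ t)
    (hδ : ∃ δ > 0, ∀ t ∈ Ioo L (L + δ), θ L < θ t) : a = L := by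
  by_contra hne
  have hLa' : L < a := lt_of_le_of_ne hLa (Ne.symm hne)
  have hρ' : ρ L < ρ a := by
    rcases lt_trichotomy (ρ a) (ρ L) with h | h | h
    · exact absurd ⟨hLa', hab.trans_le hbR⟩ (block a hθa h)
    · exact absurd (inj _ _ hθa h) hne
    · exact h
  obtain ⟨mid, hm1, hm2⟩ := exists_between hρ'
  obtain ⟨δ, hδ0, hδ⟩ := hδ
  obtain ⟨ε, hε0, hε⟩ := Metric.eventually_nhds_iff.1
    (hρ.continuousAt.eventually (gt_mem_nhds hm1) : ∀ᶠ t in 𝓝 L, ρ t < mid)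
  set η := min δ ε / 2 with hη
  have hη0 : 0 < η := by positivity
  have hηδ : η < δ := by have := min_le_left δ ε; linarith
  have hηε : η < ε := by have := min_le_right δ ε; linarith
  have hpos : θ a < θ (L + η) := by rw [hθa]; exact hδ _ ⟨by linarith, by linarith⟩
  have hev : ∀ᶠ s in 𝓝[>] a, s ∈ Ioo a b ∧ mid < ρ s ∧ θ s < θ (L + η) := by
    filter_upwards [Ioo_mem_nhdsGT hab,
      mem_nhdsWithin_of_mem_nhds (hρ.continuousAt.eventually (lt_mem_nhds hm2)),
      mem_nhdsWithin_of_mem_nhds (hθ.continuousAt.eventually (gt_mem_nhds hpos))] with s h1 h2 h3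
    exact ⟨h1, h2, h3⟩
  obtain ⟨s, hs, hs2, hs3⟩ := hev.exists
  obtain ⟨t, ht, hts⟩ := intermediate_value_Icc (show L ≤ L + η by linarith) hθ.continuousOn
    ⟨(hmin s hs).1.le, hs3.le⟩
  have h1 := (hmin s hs).2 t hts
  have h2 : ρ t < mid := hε (by rw [Real.dist_eq, abs_lt]; constructor <;> linarith [ht.1, ht.2])
  linarith

/-- If the visible parameters `V` come in angular order, every direction has a nearest parameter,
which is visible, and inside `(L, R)` nothing stands in front of a visible parameter, then the visible
parameters in `[L, R]` form an interval, apart from the endpoints. -/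
theorem exists_visible_interval {θ ρ : ℝ → ℝ} {V : Set ℝ} {L R : ℝ} (hθ : Continuous θ)
    (hρ : Continuous ρ) (hV : IsClosed V) (mono : ∀ s ∈ V, ∀ t ∈ V, s < t → θ s ≤ θ t)
    (first : ∀ φ, ∃ s ∈ V, θ s = φ ∧ ∀ t, θ t = φ → ρ s ≤ ρ t)
    (inj : ∀ s t, θ s = θ t → ρ s = ρ t → s = t)
    (block : ∀ s ∈ V, ∀ t, θ t = θ s → ρ t < ρ s → t ∉ Ioo L R)
    (hL : L ∈ V) (hR : R ∈ V) (hLR : θ L < θ R) :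
    ∃ a b, L ≤ a ∧ a < b ∧ b ≤ R ∧ θ a = θ L ∧ θ b = θ R ∧ Icc a b ⊆ V ∧
      (∀ t ∈ Ioo a b, θ L < θ t ∧ θ t < θ R) ∧
      (∀ t ∈ V, t ∈ Icc L R → t = L ∨ t ∈ Icc a b ∨ t = R) ∧
      ((∃ δ > 0, ∀ t ∈ Ioo L (L + δ), θ L < θ t) → a = L) ∧
      ((∃ δ > 0, ∀ t ∈ Ioo (R - δ) R, θ t < θ R) → b = R) := by
  have hlR : L < R := by
    rcases lt_trichotomy L R with h | h | h
    · exact h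
    · rw [h] at hLR; exact absurd hLR (lt_irrefl _)
    · exact absurd (mono R hR L hL h) (not_le.2 hLR)
  have hin : ∀ s ∈ V, θ L < θ s → θ s < θ R → s ∈ Ioo L R := by
    intro s hs h1 h2
    constructor
    · rcases lt_trichotomy L s with h | h | h
      · exact h
      · rw [h] at h1; exact absurd h1 (lt_irrefl _)
      · exact absurd (mono s hs L hL h) (not_le.2 h1)
    · rcases lt_trichotomy s R with h | h | h
      · exact h
      · rw [h] at h2; exact absurd h2 (lt_irrefl _)
      · exact absurd (mono R hR s hs h) (not_le.2 h2)
  -- Of two visible parameters with this angle, the nearer one would stand in front of the other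
  -- inside `(L, R)`.
  have uniq : ∀ s ∈ V, ∀ t ∈ V, θ s = θ t → θ L < θ s → θ s < θ R → s = t := by
    intro s hs t ht hst h1 h2
    rcases lt_trichotomy (ρ s) (ρ t) with h | h | h
    · exact absurd (hin s hs h1 h2) (block t ht s hst h)
    · exact inj s t hst h
    · exact absurd (hin t ht (hst ▸ h1) (hst ▸ h2)) (block s hs t hst.symm h)
  have smono : ∀ s ∈ V, ∀ t ∈ V, s < t → θ L < θ s → θ s < θ R → θ s < θ t := by
    intro s hs t ht hst h1 h2
    refine lt_of_le_of_ne (mono s hs t ht hst) fun e => ?_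
    exact hst.ne (uniq s hs t ht e h1 h2)
  set W := {s | s ∈ V ∧ θ L < θ s ∧ θ s < θ R} with hW
  have hWin : ∀ s ∈ W, s ∈ Ioo L R := fun s hs => hin s hs.1 hs.2.1 hs.2.2
  have hfirst : ∀ φ, θ L < φ → φ < θ R → ∃ s ∈ W, θ s = φ := by
    intro φ h1 h2
    obtain ⟨s, hs, hsφ, -⟩ := first φ
    exact ⟨s, ⟨hs, hsφ ▸ h1, hsφ ▸ h2⟩, hsφ⟩
  have hsmin : ∀ s ∈ W, ∀ t, θ t = θ s → ρ s ≤ ρ t := by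
    intro s hs t ht
    obtain ⟨s', hs', hsφ, hmin⟩ := first (θ s)
    have := uniq s hs.1 s' hs' hsφ.symm hs.2.1 hs.2.2
    rw [← this] at hmin
    exact hmin t ht
  have hconn : ∀ s ∈ W, ∀ t ∈ W, ∀ x, s < x → x < t → x ∈ W := by
    intro s hs t ht x hsx hxt
    have hangle : ∀ y ∈ V, s ≤ y → y ≤ t → y ∈ W := by
      intro y hy h1 h2
      refine ⟨hy, ?_, ?_⟩
      · rcases h1.eq_or_lt with e | e
        · rw [← e]; exact hs.2.1
        · exact hs.2.1.trans_le (mono s hs.1 y hy e)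
      · rcases h2.eq_or_lt with e | e
        · rw [e]; exact ht.2.2
        · exact (mono y hy t ht.1 e).trans_lt ht.2.2
    by_contra hx
    have hxV : x ∉ V := fun h => hx (hangle x h hsx.le hxt.le)
    -- Let `(y, z)` be the gap of `V` around `x`. An angle strictly between those of `y` and `z`
    -- belongs to a visible parameter, which by monotonicity falls into the gap.
    obtain ⟨y, hy, hymax⟩ := (isCompact_Icc.inter_left hV : IsCompact (V ∩ Icc s x)).exists_isGreatest
      ⟨s, hs.1, le_rfl, hsx.le⟩
    obtain ⟨z, hz, hzmin⟩ := (isCompact_Icc.inter_left hV : IsCompact (V ∩ Icc x t)).exists_isLeast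
      ⟨t, ht.1, hxt.le, le_rfl⟩
    have hyx : y < x := lt_of_le_of_ne hy.2.2 fun e => hxV (e ▸ hy.1)
    have hxz : x < z := lt_of_le_of_ne hz.2.1 fun e => hxV (e ▸ hz.1)
    have hyW := hangle y hy.1 hy.2.1 (hyx.le.trans hxt.le)
    have hzW := hangle z hz.1 (hsx.le.trans hz.2.1) hz.2.2
    obtain ⟨φ, h1, h2⟩ := exists_between (smono y hy.1 z hz.1 (hyx.trans hxz) hyW.2.1 hyW.2.2)
    obtain ⟨r, hrW, hr⟩ := hfirst φ (hyW.2.1.trans h1) (h2.trans hzW.2.2)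
    have hry : y < r := by
      by_contra! h
      rcases h.eq_or_lt with e | e
      · rw [e] at hr; linarith
      · linarith [mono r hrW.1 y hy.1 e]
    have hrz : r < z := by
      by_contra! h
      rcases h.eq_or_lt with e | e
      · rw [← e] at hr; linarith
      · linarith [mono z hz.1 r hrW.1 e]
    rcases le_total r x with h | h
    · linarith [hymax ⟨hrW.1, hy.2.1.trans hry.le, h⟩]
    · linarith [hzmin ⟨hrW.1, h, hrz.le.trans hz.2.2⟩]
  obtain ⟨φ₀, hφ1, hφ2⟩ := exists_between hLR
  obtain ⟨w, hw, -⟩ := hfirst φ₀ hφ1 hφ2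
  have hbb : BddBelow W := ⟨L, fun s hs => (hWin s hs).1.le⟩
  have hba : BddAbove W := ⟨R, fun s hs => (hWin s hs).2.le⟩
  set a := sInf W with ha
  set b := sSup W with hb
  have hWV : closure W ⊆ V := closure_minimal (fun s hs => hs.1) hV
  have haV : a ∈ V := hWV (csInf_mem_closure ⟨w, hw⟩ hbb)
  have hbV : b ∈ V := hWV (csSup_mem_closure ⟨w, hw⟩ hba)
  have hLa : L ≤ a := le_csInf ⟨w, hw⟩ fun s hs => (hWin s hs).1.le
  have hbR : b ≤ R := csSup_le ⟨w, hw⟩ fun s hs => (hWin s hs).2.le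
  have hθa : θ a = θ L := by
    refine le_antisymm ?_ ?_
    · by_contra! h
      obtain ⟨φ, h1, h2⟩ := exists_between (lt_min h hLR)
      obtain ⟨s, hs, hsφ⟩ := hfirst φ h1 (h2.trans_le (min_le_right _ _))
      have h3 := h2.trans_le (min_le_left _ _)
      rcases (csInf_le hbb hs).eq_or_lt with e | e
      · rw [← ha] at e; rw [e] at h3; linarith
      · linarith [mono a haV s hs.1 e]
    · rcases hLa.eq_or_lt with e | e
      · rw [← e]
      · exact mono L hL a haV e
  have hθb : θ b = θ R := by
    refine le_antisymm ?_ ?_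
    · rcases hbR.eq_or_lt with e | e
      · rw [e]
      · exact mono b hbV R hR e
    · by_contra! h
      obtain ⟨φ, h1, h2⟩ := exists_between (max_lt h hLR)
      obtain ⟨s, hs, hsφ⟩ := hfirst φ ((le_max_right _ _).trans_lt h1) h2
      have h3 := (le_max_left _ _).trans_lt h1
      rcases (le_csSup hba hs).eq_or_lt with e | e
      · rw [← hb] at e; rw [← e] at h3; linarith
      · linarith [mono s hs.1 b hbV e]
  have hab : a < b := by
    refine lt_of_le_of_ne ((csInf_le hbb hw).trans (le_csSup hba hw)) fun e => ?_
    rw [e] at hθa; linarith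
  have hIoo : ∀ t ∈ Ioo a b, t ∈ W := by
    intro t ht
    obtain ⟨s, hs, hst⟩ := exists_lt_of_csInf_lt ⟨w, hw⟩ ht.1
    obtain ⟨u, hu, htu⟩ := exists_lt_of_lt_csSup ⟨w, hw⟩ ht.2
    exact hconn s hs u hu t hst htu
  have hIcc : Icc a b ⊆ V := by
    intro t ht
    rcases ht.1.eq_or_lt with e | e
    · rw [← e]; exact haV
    rcases ht.2.eq_or_lt with e' | e'
    · rw [e']; exact hbV
    exact (hIoo t ⟨e, e'⟩).1
  refine ⟨a, b, hLa, hab, hbR, hθa, hθb, hIcc, fun t ht => (hIoo t ht).2, ?_, ?_, ?_⟩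
  · intro t ht htI
    have h1 : θ L ≤ θ t := by
      rcases htI.1.eq_or_lt with e | e
      · rw [e]
      · exact mono L hL t ht e
    have h2 : θ t ≤ θ R := by
      rcases htI.2.eq_or_lt with e | e
      · rw [e]
      · exact mono t ht R hR e
    -- A visible `t` in the direction of `L` is compared with `a`. If it is nearer, it is not
    -- interior and so is `L`; if it is equally near, it is `a`. If it is farther, then `a = L`, and
    -- any `t > a` would come after visible parameters of larger angle.
    rcases h1.eq_or_lt with e1 | e1
    · rcases lt_trichotomy (ρ t) (ρ a) with h | h | h
      · have := block a haV t (by rw [hθa, e1]) h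
        left
        by_contra hne
        refine this ⟨lt_of_le_of_ne htI.1 (Ne.symm hne), lt_of_le_of_ne htI.2 fun e => ?_⟩
        rw [e] at e1; linarith
      · right; left
        rw [inj t a (by rw [hθa, e1]) h]; exact ⟨le_rfl, hab.le⟩
      · have := block t ht a (by rw [hθa, e1]) h
        have haL : a = L := by
          by_contra hne
          exact this ⟨lt_of_le_of_ne hLa (Ne.symm hne), hab.trans_le hbR⟩
        left
        by_contra hne
        have hLt : a < t := by rw [haL]; exact lt_of_le_of_ne htI.1 (Ne.symm hne)
        obtain ⟨s, hs1, hs2⟩ := exists_between (lt_min hLt hab)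
        have hsW := hIoo s ⟨hs1, hs2.trans_le (min_le_right _ _)⟩
        linarith [mono s hsW.1 t ht (hs2.trans_le (min_le_left _ _)), hsW.2.1]
    rcases h2.eq_or_lt with e2 | e2
    · rcases lt_trichotomy (ρ t) (ρ b) with h | h | h
      · have := block b hbV t (by rw [hθb, e2]) h
        right; right
        by_contra hne
        refine this ⟨lt_of_le_of_ne htI.1 fun e => ?_, lt_of_le_of_ne htI.2 hne⟩
        rw [← e] at e2; linarith
      · right; left
        rw [inj t b (by rw [hθb, e2]) h]; exact ⟨hab.le, le_rfl⟩
      · have := block t ht b (by rw [hθb, e2]) h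
        have hbR' : b = R := by
          by_contra hne
          exact this ⟨hLa.trans_lt hab, lt_of_le_of_ne hbR hne⟩
        right; right
        by_contra hne
        have hLt : t < b := by rw [hbR']; exact lt_of_le_of_ne htI.2 hne
        obtain ⟨s, hs1, hs2⟩ := exists_between (max_lt hLt hab)
        have hsW := hIoo s ⟨(le_max_right _ _).trans_lt hs1, hs2⟩
        linarith [mono t ht s hsW.1 ((le_max_left _ _).trans_lt hs1), hsW.2.2]
    · have htW : t ∈ W := ⟨ht, e1, e2⟩
      right; left; exact ⟨csInf_le hbb htW, le_csSup hba htW⟩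
  · exact left_end_eq hθ hρ inj (block L hL) hLa hab hbR hθa
      fun s hs => ⟨(hIoo s hs).2.1, hsmin s (hIoo s hs)⟩
  · rintro ⟨δ, hδ0, hδ⟩
    have hiff : ∀ x y z : ℝ, -x ∈ Ioo y z ↔ x ∈ Ioo (-z) (-y) := by
      intro x y z; simp only [mem_Ioo]; constructor <;> rintro ⟨h1, h2⟩ <;> constructor <;> linarith
    -- The right end is the left end after reversing both the parameter and the angle.
    have := left_end_eq (θ := fun x => -θ (-x)) (ρ := fun x => ρ (-x)) (L := -R) (R := -L)
      (a := -b) (b := -a) (by fun_prop) (by fun_prop)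
      (fun s t h1 h2 => neg_injective (inj _ _ (neg_injective h1) h2))
      (fun t h1 h2 h3 => by
        simp only [neg_neg, neg_inj] at h1 h2
        exact block R hR (-t) h1 h2 ((hiff _ _ _).2 h3))
      (by linarith) (by linarith) (by linarith) (by simp [hθb])
      (fun s hs => by
        have hsW := hIoo (-s) ((hiff _ _ _).2 hs)
        refine ⟨by simpa using hsW.2.2, fun t ht => ?_⟩
        exact hsmin (-s) hsW (-t) (neg_injective ht))
      ⟨δ, hδ0, fun t ht => by
        have := hδ (-t) ((hiff _ _ _).2 (by constructor <;> linarith [ht.1, ht.2]))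
        simpa using this⟩
    linarith

end ChainVisibility

namespace ChainVisibility

open Complex Filter Topology Set

/-! ### The edges that carry the two cut points -/

/-- `edgeNum p q k / edgeDen p q d k` is the position, in multiples of `d`, at which the `k`-th edge
of the chain `p` meets the line through `q` in direction `d`. -/
noncomputable def edgeNum (p : ℕ → ℂ) (q : ℂ) (k : ℕ) : ℝ := cross (p k - q) (p (k + 1) - q)

noncomputable def edgeDen (p : ℕ → ℂ) (q d : ℂ) (k : ℕ) : ℝ :=
  cross d (p (k + 1) - q) - cross d (p k - q)

/-- The `k`-th edge passes the ray in direction `d` counterclockwise and does not end on it. -/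
def LeavesRay (p : ℕ → ℂ) (q d : ℂ) (k : ℕ) : Prop :=
  0 < edgeNum p q k ∧ cross d (p k - q) ≤ 0 ∧ 0 < cross d (p (k + 1) - q)

/-- The `k`-th edge passes the ray in direction `d` counterclockwise and does not start on it. -/
def ReachesRay (p : ℕ → ℂ) (q d : ℂ) (k : ℕ) : Prop :=
  0 < edgeNum p q k ∧ cross d (p k - q) < 0 ∧ 0 ≤ cross d (p (k + 1) - q)

/-- Among the edges with property `cand` of a chain with `m` vertices, the `k`-th one is the only
one that meets the ray nearest to `q`. -/
def IsNearestEdge (p : ℕ → ℂ) (q d : ℂ) (m : ℕ) (cand : ℕ → Prop) (k : ℕ) : Prop :=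
  k + 1 < m ∧ cand k ∧ ∀ j, j + 1 < m → cand j → j ≠ k →
    edgeNum p q k * edgeDen p q d j < edgeNum p q j * edgeDen p q d k

variable {n : ℕ}

theorem loop_nat (v : ZMod n → ℂ) (i : ZMod n) (k : ℕ) : loop v i k = v (i + k) := by
  have := loop_int v i (k : ℤ); simpa using this

theorem loop_nat_succ (v : ZMod n → ℂ) (i : ZMod n) (k : ℕ) :
    loop v i (k + 1) = v (i + (k + 1 : ℕ)) := by
  have := loop_nat v i (k + 1); simpa using this

theorem edgeCross_nat (v : ZMod n → ℂ) (q : ℂ) (i : ZMod n) (k : ℕ) :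
    edgeCross v q i k = edgeNum (fun j => v (i + j)) q k := by
  simp [edgeCross, edgeNum, add_assoc]

/-- The position of a ray point on an edge thus determines the signs of the cross products that the
scan tests. -/
theorem mul_cross_edge {v : ZMod n → ℂ} {q d : ℂ} {i : ZMod n} {k : ℕ} {x s : ℝ}
    (hx : x ∈ Icc (k : ℝ) (k + 1)) (h : loop v i x = q + s * d) :
    s * cross d (v (i + k) - q) = -((x - k) * edgeNum (fun j => v (i + j)) q k) ∧
    s * cross d (v (i + (k + 1 : ℕ)) - q) = (k + 1 - x) * edgeNum (fun j => v (i + j)) q k := by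
  have hx' : x ∈ Icc (((k : ℕ) : ℤ) : ℝ) (((k : ℕ) : ℤ) + 1) := by simpa using hx
  have e1 := cross_loop (v := v) (q := q) (i := i) (k := k) (t := k) hx' ⟨by simp, by simp⟩
  have e2 := cross_loop (v := v) (q := q) (i := i) (k := k) (t := k + 1) hx' ⟨by simp, by simp⟩
  rw [edgeCross_nat, h, add_sub_cancel_left] at e1 e2
  rw [loop_nat] at e1
  rw [loop_nat_succ] at e2
  have hlin : ∀ z, cross (s * d) z = s * cross d z := fun z => by simp [cross]; ring
  rw [hlin] at e1 e2
  exact ⟨by linarith, by linarith⟩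

/-- Along the edge `cross d (· - q)` is affine with slope `edgeDen`, so its zero lies at the
fraction `-cross d (v (i + k) - q) / edgeDen` of the edge. Strict signs at the ends exclude the
ends. -/
theorem loop_of_edge_meets {v : ZMod n → ℂ} {q d : ℂ} {i : ZMod n} {k : ℕ}
    (h1 : cross d (v (i + k) - q) ≤ 0) (h2 : 0 ≤ cross d (v (i + (k + 1 : ℕ)) - q))
    (h3 : 0 < edgeDen (fun j => v (i + j)) q d k) :
    ∃ x ∈ Icc (k : ℝ) (k + 1), loop v i x = q + (edgeNum (fun j => v (i + j)) q k /
      edgeDen (fun j => v (i + j)) q d k : ℝ) * d ∧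
      (0 < cross d (v (i + (k + 1 : ℕ)) - q) → x < k + 1) ∧
      (cross d (v (i + k) - q) < 0 → (k : ℝ) < x) := by
  set D := edgeDen (fun j => v (i + j)) q d k with hD
  set ck := cross d (v (i + k) - q) with hck
  set ck1 := cross d (v (i + (k + 1 : ℕ)) - q) with hck1
  have hDe : D = ck1 - ck := rfl
  have hx : (k : ℝ) + -ck / D ∈ Icc (k : ℝ) (k + 1) := by
    have a1 : 0 ≤ -ck / D := div_nonneg (by linarith) h3.le
    have a2 : -ck / D ≤ 1 := by rw [div_le_one h3]; linarith
    constructor <;> linarith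
  refine ⟨k + -ck / D, hx, ?_, ?_, ?_⟩
  · rw [loop_of_mem v i (k := k) (by simpa using hx)]
    have hD0 : (D : ℂ) ≠ 0 := by exact_mod_cast h3.ne'
    have key : (D : ℂ) * (v (i + k) - q) + (-ck : ℝ) * (v (i + (k + 1 : ℕ)) - v (i + k))
        = (edgeNum (fun j => v (i + j)) q k : ℝ) * d := by
      rw [hDe, hck, hck1]
      apply Complex.ext <;> simp [edgeNum, cross] <;> ring
    have e : i + ((k : ℤ) : ZMod n) + 1 = i + ((k + 1 : ℕ) : ZMod n) := by push_cast; ring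
    rw [e]
    push_cast at key ⊢
    rw [div_mul_eq_mul_div, ← key]
    field_simp
    ring
  · intro h
    have : -ck / D < 1 := by rw [div_lt_one h3]; linarith
    linarith
  · intro h
    have : 0 < -ck / D := div_pos (by linarith) h3
    linarith

set_option maxHeartbeats 1000000 in
/-- The visible part of a chain between consecutive visible critical vertices, and the edges on
which it starts and ends. -/
theorem exists_visible_part [NeZero n] {v : ZMod n → ℂ} {q : ℂ} {i : ZMod n} {m : ℕ}
    (hs : IsSimplePolygon v) (hq : q ∈ inside v)
    (hw : ∀ k : ZMod n, cross (v k - q) (v (k + 1) - q) ≠ 0)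
    (hc : IsVisibleCriticalChain v q i m) :
    ∃ (a b : ℝ) (kA kB : ℕ), a < b ∧ IsFirstCut v q i m a ∧ IsLastCut v q i m b ∧
      {x ∈ chain v i m | Visible v q x} =
        {v i} ∪ curve v i '' Set.Icc a b ∪ {v (chainEnd i m)} ∧
      ((kA : ℝ) ≤ a ∧ a < kA + 1) ∧ ((kB : ℝ) < b ∧ b ≤ kB + 1) ∧
      IsNearestEdge (fun j => v (i + j)) q (v i - q) m
        (LeavesRay (fun j => v (i + j)) q (v i - q)) kA ∧
      IsNearestEdge (fun j => v (i + j)) q (v (chainEnd i m) - q) m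
        (ReachesRay (fun j => v (i + j)) q (v (chainEnd i m) - q)) kB ∧
      curve v i a = q + (edgeNum (fun j => v (i + j)) q kA /
        edgeDen (fun j => v (i + j)) q (v i - q) kA : ℝ) * (v i - q) ∧
      curve v i b = q + (edgeNum (fun j => v (i + j)) q kB /
        edgeDen (fun j => v (i + j)) q (v (chainEnd i m) - q) kB : ℝ) *
          (v (chainEnd i m) - q) := by
  obtain ⟨hm2, hmn, hcL, hcR, hcI, hray⟩ := hc
  obtain ⟨θ, ρ, h⟩ := exists_polarView i hs hq hw
  set e := chainEnd i m with he
  set p : ℕ → ℂ := fun j => v (i + j) with hp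
  have hpi := Real.pi_pos
  obtain ⟨M, rfl⟩ : ∃ M, m = M + 2 := ⟨m - 2, by omega⟩
  have hM : ((M + 2 - 1 : ℕ) : ℝ) = M + 1 := by
    rw [show M + 2 - 1 = M + 1 by omega]; push_cast; ring
  set R : ℝ := M + 1 with hR
  have hR0 : 0 < R := by positivity
  have hRn : R < n := by
    have : M + 1 < n := by omega
    rw [hR]; exact_mod_cast this
  have he' : e = i + ((M + 1 : ℕ) : ZMod n) := by
    rw [he, chainEnd, show M + 2 - 1 = M + 1 by omega]
  have l0 : loop v i 0 = v i := by simpa using loop_nat v i 0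
  have lR : loop v i R = v e := by rw [he', ← loop_nat_succ v i M]
  have hVL : Visible v q (loop v i 0) := by rw [l0]; exact hcL.2
  have hVR : Visible v q (loop v i R) := by rw [lR]; exact hcR.2
  -- the endpoints are seen in different directions
  have hdir : ∀ j : ℤ, θ R ≠ θ 0 + j * (2 * Real.pi) := by
    intro j hj
    have := h.loop_eq_of_angle_eq hj
    rw [lR, l0] at this
    apply hray
    have e1 : v e - q = (Real.exp (ρ R - ρ 0)) • (v i - q) := by
      rw [this, real_smul]; ring
    rw [e1]
    exact SameRay.sameRay_pos_smul_right _ (Real.exp_pos _)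
  have hLR : θ 0 < θ R := lt_of_le_of_ne (h.angle_le_of_visible hR0 hVL hVR) fun e => by
    have := hdir 0; simp [e] at this
  -- The angular order is applied to the end of the chain and the next copy of its start, at
  -- parameter `n`.
  have hRL : θ R < θ 0 + 2 * Real.pi := by
    have h1 := h.period 0
    have h2 := loop_add_period v i 0 1
    rw [zero_add] at h1
    simp only [Int.cast_one, one_mul, zero_add] at h2
    have := h.angle_le_of_visible hRn hVR (by rw [h2]; exact hVL)
    rw [h1.1] at this
    exact lt_of_le_of_ne this fun e => hdir 1 (by simpa using e)
  -- the visible interval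
  obtain ⟨a, b, h0a, hab, hbR, hθa, hθb, hV, hstrict, hsplit, haL, hbR'⟩ :=
    exists_visible_interval (V := {t | Visible v q (loop v i t)}) (L := 0) (R := R)
      h.cont_angle h.cont_radius ((isClosed_setOf_visible v q).preimage (continuous_loop v i))
      (fun s hs t ht hst => h.angle_le_of_visible hst hs ht)
      (fun φ => h.exists_firstHit φ) (fun s t => h.eq_of_angle_eq)
      (by
        intro s hs t h1 h2 htI
        -- This is where the hypothesis on the chain enters: anything in front of a visible point is
        -- a visible critical vertex, and there is none strictly inside.
        obtain ⟨k, rfl, hk⟩ := h.exists_visibleCritical hs h1 h2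
        have k1 : 0 < k := by exact_mod_cast htI.1
        have k2 : k < M + 1 := by have := htI.2; rw [hR] at this; exact_mod_cast this
        obtain ⟨k, rfl⟩ := Int.eq_ofNat_of_zero_le k1.le
        refine hcI k (by omega) (by omega) ?_
        simpa using hk) hVL hVR hLR
  have hb0 : 0 ≤ b := h0a.trans hab.le
  -- signs of the first and the last edge
  have hanti : ∀ x y : ℂ, cross x y = -cross y x := fun x y => by simp [cross]; ring
  have hp0 : p 0 = v i := by simp [hp]
  have hp1 : p 1 = v (i + 1) := by simp [hp]
  have hpM1 : p (M + 1) = v e := by simp only [hp]; rw [he']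
  have hpM : p M = v (e - 1) := by simp only [hp]; rw [he']; congr 1; push_cast; ring
  have hmaxL : CriticalMax v q i → edgeNum p q 0 < 0 := by
    intro hcm
    have := hcm.2.1
    rw [AngleLT, hanti, ← hp0, ← hp1] at this
    unfold edgeNum; linarith
  have hminL : CriticalMin v q i → 0 < edgeNum p q 0 := by
    intro hcm
    have := hcm.2.1
    rwa [AngleLT, ← hp0, ← hp1] at this
  have hmaxR : CriticalMax v q e → 0 < edgeNum p q M := by
    intro hcm
    have := hcm.1
    rwa [AngleLT, ← hpM, ← hpM1] at this
  have hminR : CriticalMin v q e → edgeNum p q M < 0 := by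
    intro hcm
    have := hcm.1
    rw [AngleLT, hanti, ← hpM, ← hpM1] at this
    unfold edgeNum; linarith
  have ec : ∀ k : ℕ, edgeCross v q i k = edgeNum p q k := fun k => edgeCross_nat v q i k
  have mem_edge : ∀ (k : ℕ) (t : ℝ), (k : ℝ) ≤ t → t ≤ k + 1 →
      t ∈ Icc (((k : ℕ) : ℤ) : ℝ) (((k : ℕ) : ℤ) + 1) := fun k t h1 h2 => by
    simpa using ⟨h1, h2⟩
  -- If the first edge runs counterclockwise, the angle rises at once and the visible interval
  -- starts at `p`; the clockwise case `hnegL` is the opposite.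
  have hposL : 0 < edgeNum p q 0 → a = 0 := by
    intro h0
    refine haL ⟨1, one_pos, fun t ht => ?_⟩
    exact h.angle_lt (k := (0 : ℕ)) (mem_edge 0 0 (by simp) (by simp))
      (mem_edge 0 t (by simpa using ht.1.le) (by simpa using ht.2.le)) ht.1 (by rw [ec]; exact h0)
  have hposR : 0 < edgeNum p q M → b = R := by
    intro h0
    refine hbR' ⟨1, one_pos, fun t ht => ?_⟩
    exact h.angle_lt (k := M) (mem_edge M t (by linarith [ht.1]) (by linarith [ht.2]))
      (mem_edge M R (by linarith) (by linarith)) ht.2 (by rw [ec]; exact h0)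
  have hnegL : edgeNum p q 0 < 0 → a ≠ 0 := by
    intro h0 ha0
    obtain ⟨t, ht1, ht2⟩ := exists_between (lt_min (show (0 : ℝ) < 1 by norm_num) (ha0 ▸ hab))
    have h1 := (hstrict t ⟨by rw [ha0]; exact ht1, ht2.trans_le (min_le_right _ _)⟩).1
    have h2 := h.angle_gt (k := (0 : ℕ)) (mem_edge 0 0 (by simp) (by simp))
      (mem_edge 0 t (by simpa using ht1.le)
        (by simpa using (ht2.trans_le (min_le_left _ _)).le)) ht1 (by rw [ec]; exact h0)
    linarith
  have hnegR : edgeNum p q M < 0 → b ≠ R := by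
    intro h0 hb
    obtain ⟨t, ht1, ht2⟩ := exists_between (max_lt (show (M : ℝ) < R by linarith) (hb ▸ hab))
    have h1 := (hstrict t ⟨(le_max_right _ _).trans_lt ht1, by rw [hb]; exact ht2⟩).2
    have h2 := h.angle_gt (k := M)
      (mem_edge M t ((le_max_left _ _).trans ht1.le) (by linarith))
      (mem_edge M R (by linarith) (by linarith)) ht2 (by rw [ec]; exact h0)
    linarith
  -- boundary points of the chain in front of the cut points
  have hfront : ∀ (x y t s : ℝ), Visible v q (loop v i x) → (y = 0 ∨ y = R) → θ x = θ y →
      t ∈ Icc 0 R → 0 < s → s ≤ Real.exp (ρ x - ρ y) → loop v i t = q + s * (loop v i y - q) →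
      (t = 0 ∨ t ∈ Icc a b ∨ t = R) ∧ θ t = θ y := by
    intro x y t s hx hy hxy ht hs0 hsle heq
    obtain ⟨hρ, j, hj⟩ := h.exists_int_angle_eq hs0 heq
    have hle : ρ t ≤ ρ x := by
      have := Real.log_le_log hs0 hsle
      rw [Real.log_exp] at this; linarith
    have hvis : Visible v q (loop v i t) :=
      h.visible_of_angle_eq (j := j) hx (by rw [hxy, hj]) hle
    have h1 : θ 0 ≤ θ t := by
      rcases ht.1.eq_or_lt with e | e
      · rw [e]
      · exact h.angle_le_of_visible e hVL hvis
    have h2 : θ t ≤ θ R := by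
      rcases ht.2.eq_or_lt with e | e
      · rw [e]
      · exact h.angle_le_of_visible e hvis hVR
    refine ⟨hsplit t hvis ht, ?_⟩
    -- The angle of `t` lies in `[θ 0, θ R]`, which is shorter than `2π` and has `θ y` as one of its
    -- ends; so the multiple of `2π` is zero.
    have hj1 : (-1 : ℝ) < j := by
      by_contra! hle
      have : (j : ℝ) * (2 * Real.pi) ≤ (-1) * (2 * Real.pi) := by gcongr
      rcases hy with rfl | rfl <;> linarith
    have hj2 : (j : ℝ) < 1 := by
      by_contra! hle
      have : 1 * (2 * Real.pi) ≤ (j : ℝ) * (2 * Real.pi) := by gcongr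
      rcases hy with rfl | rfl <;> linarith
    have hj0 : j = 0 := by
      have j1 : -1 < j := by exact_mod_cast hj1
      have j2 : j < 1 := by exact_mod_cast hj2
      omega
    rw [hj, hj0]; simp
  have hfrontA : ∀ t s : ℝ, t ∈ Icc 0 R → 0 < s → s ≤ Real.exp (ρ a - ρ 0) →
      loop v i t = q + s * (v i - q) → t = 0 ∨ t = a := by
    intro t s ht hs0 hsle heq
    obtain ⟨h1, h2⟩ := hfront a 0 t s (hV ⟨le_rfl, hab.le⟩) (Or.inl rfl) hθa ht hs0 hsle
      (by rw [l0]; exact heq)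
    rcases h1 with h1 | h1 | h1
    · exact Or.inl h1
    · right
      rcases h1.1.eq_or_lt with e | e
      · exact e.symm
      rcases h1.2.eq_or_lt with e' | e'
      · rw [e', hθb] at h2; linarith
      · linarith [(hstrict t ⟨e, e'⟩).1]
    · rw [h1] at h2; linarith
  have hfrontB : ∀ t s : ℝ, t ∈ Icc 0 R → 0 < s → s ≤ Real.exp (ρ b - ρ R) →
      loop v i t = q + s * (v e - q) → t = R ∨ t = b := by
    intro t s ht hs0 hsle heq
    obtain ⟨h1, h2⟩ := hfront b R t s (hV ⟨hab.le, le_rfl⟩) (Or.inr rfl) hθb ht hs0 hsle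
      (by rw [lR]; exact heq)
    rcases h1 with h1 | h1 | h1
    · rw [h1] at h2; linarith
    · right
      rcases h1.2.eq_or_lt with e | e
      · exact e
      rcases h1.1.eq_or_lt with e' | e'
      · rw [← e', hθa] at h2; linarith
      · linarith [(hstrict t ⟨e', e⟩).2]
    · exact Or.inl h1
  have locA : loop v i a = q + (Real.exp (ρ a - ρ 0) : ℝ) * (v i - q) := by
    have := h.loop_eq_of_angle_eq (s := a) (t := 0) (j := 0) (by simp [hθa])
    rwa [l0] at this
  have locB : loop v i b = q + (Real.exp (ρ b - ρ R) : ℝ) * (v e - q) := by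
    have := h.loop_eq_of_angle_eq (s := b) (t := R) (j := 0) (by simp [hθb])
    rwa [lR] at this
  have hinj : ∀ s t : ℝ, s ∈ Icc 0 R → t ∈ Icc 0 R → loop v i s = loop v i t → s = t := by
    intro s t hs ht hst
    obtain ⟨j, hj⟩ := exists_int_of_loop_eq h.simple i hst
    have hn : (0 : ℝ) < n := hR0.trans hRn
    have j1 : (-1 : ℝ) < j := by
      by_contra! hle
      have : (j : ℝ) * n ≤ (-1) * n := by gcongr
      linarith [hs.2, ht.1]
    have j2 : (j : ℝ) < 1 := by
      by_contra! hle
      have : 1 * (n : ℝ) ≤ (j : ℝ) * n := by gcongr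
      linarith [hs.1, ht.2]
    have hj0 : j = 0 := by
      have j1 : -1 < j := by exact_mod_cast j1
      have j2 : j < 1 := by exact_mod_cast j2
      omega
    rw [hj, hj0]; simp
  have nearest : ∀ (x y : ℝ), x ∈ Icc 0 R → y ∈ Icc 0 R → x ≠ y →
      loop v i x = q + (Real.exp (ρ x - ρ y) : ℝ) * (loop v i y - q) →
      (∀ t s : ℝ, t ∈ Icc 0 R → 0 < s → s ≤ Real.exp (ρ x - ρ y) →
        loop v i t = q + s * (loop v i y - q) → t = y ∨ t = x) →
      IsNearestHit v q i (M + 2) (loop v i y) x := by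
    intro x y hx hy hxy hloc hfr
    refine ⟨by rw [hM]; exact hx, ⟨⟨Real.exp (ρ x - ρ y), (Real.exp_pos _).le, ?_⟩, ?_⟩, ?_⟩
    · rw [curve_eq_loop v i hx.1]; exact hloc
    · rw [curve_eq_loop v i hx.1]
      exact fun h0 => hxy (hinj x y hx hy h0)
    · rintro _ ⟨t, ht, rfl⟩ ⟨⟨s, hs0, hts⟩, htne⟩
      rw [hM] at ht
      rw [curve_eq_loop v i ht.1] at hts htne ⊢
      rw [curve_eq_loop v i hx.1]
      have hs1 : 0 < s := lt_of_le_of_ne hs0 fun e0 => by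
        rw [← e0] at hts
        exact h.loop_ne t (by rw [hts]; simp)
      by_contra! hlt
      rw [dist_comm q, dist_comm q, dist_eq_norm, dist_eq_norm] at hlt
      have hle : s ≤ Real.exp (ρ x - ρ y) := by
        by_contra! hgt
        rw [hts, hloc, add_sub_cancel_left, add_sub_cancel_left, norm_mul, norm_mul,
          norm_real, norm_real, Real.norm_of_nonneg hs0,
          Real.norm_of_nonneg (Real.exp_pos _).le] at hlt
        have := mul_le_mul_of_nonneg_right hgt.le (norm_nonneg (loop v i y - q))
        linarith
      rcases hfr t s ht hs1 hle hts with e1 | e1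
      · rw [e1] at htne; exact htne rfl
      · rw [e1] at hlt; exact absurd hlt (lt_irrefl _)
  have haI : a ∈ Icc 0 R := ⟨h0a, hab.le.trans hbR⟩
  have hbI : b ∈ Icc 0 R := ⟨hb0, hbR⟩
  -- the edges of the cut points
  set kA := ⌊a⌋₊ with hkA
  have hkA1 : (kA : ℝ) ≤ a := Nat.floor_le h0a
  have hkA2 : a < kA + 1 := Nat.lt_floor_add_one a
  -- If a cut point is a vertex, `A` is assigned to the edge that starts there and `B` to the edge
  -- that ends there. Hence the floor for `a`, but the ceiling minus one for `b`.
  obtain ⟨kB, hkB1, hkB2⟩ : ∃ kB : ℕ, (kB : ℝ) < b ∧ b ≤ kB + 1 := by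
    have h1 : 0 < ⌈b⌉₊ := Nat.ceil_pos.2 (lt_of_le_of_lt h0a hab)
    refine ⟨⌈b⌉₊ - 1, ?_, ?_⟩
    · rw [← Nat.lt_ceil]; omega
    · have := Nat.le_ceil b
      rw [Nat.cast_sub h1]; push_cast; linarith
  have hkAm : kA + 1 < M + 2 := by
    have : (kA : ℝ) < M + 1 := by linarith
    have : kA < M + 1 := by exact_mod_cast this
    omega
  have hkBm : kB + 1 < M + 2 := by
    have : (kB : ℝ) < M + 1 := by linarith
    have : kB < M + 1 := by exact_mod_cast this
    omega
  -- Just after `a` the angle exceeds `θ 0 = θ a`, so this edge cannot run clockwise.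
  have hwA : 0 < edgeNum p q kA := by
    have hne : edgeNum p q kA ≠ 0 := by rw [← ec]; exact h.edgeCross_ne _
    refine lt_of_le_of_ne ?_ hne.symm
    by_contra! hneg
    obtain ⟨t, ht1, ht2⟩ := exists_between (lt_min hkA2 hab)
    have h1 := (hstrict t ⟨ht1, ht2.trans_le (min_le_right _ _)⟩).1
    have h2 := h.angle_gt (k := kA) (mem_edge kA a hkA1 hkA2.le)
      (mem_edge kA t (hkA1.trans ht1.le) (ht2.trans_le (min_le_left _ _)).le) ht1
      (by rw [ec]; exact hneg)
    linarith
  have hwB : 0 < edgeNum p q kB := by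
    have hne : edgeNum p q kB ≠ 0 := by rw [← ec]; exact h.edgeCross_ne _
    refine lt_of_le_of_ne ?_ hne.symm
    by_contra! hneg
    obtain ⟨t, ht1, ht2⟩ := exists_between (max_lt hkB1 hab)
    have h1 := (hstrict t ⟨(le_max_right _ _).trans_lt ht1, ht2⟩).2
    have h2 := h.angle_gt (k := kB) (mem_edge kB t ((le_max_left _ _).trans ht1.le) (ht2.le.trans hkB2))
      (mem_edge kB b hkB1.le hkB2) ht2 (by rw [ec]; exact hneg)
    linarith
  have sA := mul_cross_edge ⟨hkA1, hkA2.le⟩ locA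
  have sB := mul_cross_edge ⟨hkB1.le, hkB2⟩ locB
  have xA := Real.exp_pos (ρ a - ρ 0)
  have xB := Real.exp_pos (ρ b - ρ R)
  set SA := Real.exp (ρ a - ρ 0) with hSA
  set SB := Real.exp (ρ b - ρ R) with hSB
  have candA : LeavesRay p q (v i - q) kA := by
    refine ⟨hwA, ?_, ?_⟩
    · by_contra! hgt
      nlinarith [mul_pos xA hgt, mul_nonneg (sub_nonneg.2 hkA1) hwA.le, sA.1]
    · by_contra! hle
      nlinarith [mul_nonneg xA.le (neg_nonneg.2 hle), mul_pos (sub_pos.2 hkA2) hwA, sA.2]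
  have candB : ReachesRay p q (v e - q) kB := by
    refine ⟨hwB, ?_, ?_⟩
    · by_contra! hge
      nlinarith [mul_nonneg xB.le hge, mul_pos (sub_pos.2 hkB1) hwB, sB.1]
    · by_contra! hlt
      nlinarith [mul_pos xB (neg_pos.2 hlt), mul_nonneg (sub_nonneg.2 hkB2) hwB.le, sB.2]
  have numA : edgeNum p q kA = SA * edgeDen p q (v i - q) kA := by
    unfold edgeDen; rw [mul_sub]; simp only [hp]; linarith [sA.1, sA.2]
  have numB : edgeNum p q kB = SB * edgeDen p q (v e - q) kB := by
    unfold edgeDen; rw [mul_sub]; simp only [hp]; linarith [sB.1, sB.2]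
  have denA : 0 < edgeDen p q (v i - q) kA := by
    have h1 := candA.2.1; have h2 := candA.2.2
    unfold edgeDen; linarith
  have denB : 0 < edgeDen p q (v e - q) kB := by
    have h1 := candB.2.1; have h2 := candB.2.2
    unfold edgeDen; linarith
  have quotA : edgeNum p q kA / edgeDen p q (v i - q) kA = SA := by
    rw [numA, mul_div_cancel_right₀ _ denA.ne']
  have quotB : edgeNum p q kB / edgeDen p q (v e - q) kB = SB := by
    rw [numB, mul_div_cancel_right₀ _ denB.ne']
  refine ⟨a, b, kA, kB, hab, ⟨?_, ?_⟩, ⟨?_, ?_⟩, ?_, ⟨hkA1, hkA2⟩, ⟨hkB1, hkB2⟩,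
    ⟨hkAm, candA, ?_⟩, ⟨hkBm, candB, ?_⟩, ?_, ?_⟩
  · intro hmax
    have := nearest a 0 haI ⟨le_rfl, hR0.le⟩ (hnegL (hmaxL hmax)) (by rw [l0]; exact locA)
      (by rw [l0]; exact hfrontA)
    rwa [l0] at this
  · intro hmax
    exact hposL (hminL (hcL.1.resolve_left hmax))
  · intro hmin
    have := nearest b R hbI ⟨hR0.le, le_rfl⟩ (hnegR (hminR hmin)) (by rw [lR]; exact locB)
      (by rw [lR]; exact hfrontB)
    rwa [lR] at this
  · intro hmin
    rw [hM]
    exact hposR (hmaxR (hcR.1.resolve_right hmin))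
  · ext x
    constructor
    · rintro ⟨⟨t, ht, rfl⟩, hvis⟩
      rw [hM] at ht
      rw [curve_eq_loop v i ht.1] at hvis
      rcases hsplit t hvis ht with e1 | e1 | e1
      · left; left; rw [curve_eq_loop v i ht.1, e1, l0]; rfl
      · left; right; exact ⟨t, e1, rfl⟩
      · right; rw [curve_eq_loop v i ht.1, e1, lR]; rfl
    · rintro ((rfl | ⟨t, ht, rfl⟩) | rfl)
      · exact ⟨⟨0, by rw [hM]; exact ⟨le_rfl, hR0.le⟩, by rw [curve_eq_loop v i le_rfl, l0]⟩, hcL.2⟩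
      · have ht0 := h0a.trans ht.1
        exact ⟨⟨t, by rw [hM]; exact ⟨ht0, ht.2.trans hbR⟩, rfl⟩,
          by rw [curve_eq_loop v i ht0]; exact hV ht⟩
      · exact ⟨⟨R, by rw [hM]; exact ⟨hR0.le, le_rfl⟩, by rw [curve_eq_loop v i hR0.le, lR]⟩, hcR.2⟩
  -- A candidate that meets the ray no farther away than `A` meets it at `p` or at `A`. If it meets
  -- it at `p`, it is the first edge and counterclockwise, so that `A = p`. In either case the
  -- half-open condition identifies it with edge `kA`.
  · intro j hj hcand hne
    have hD : 0 < edgeDen p q (v i - q) j := by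
      have h1 := hcand.2.1; have h2 := hcand.2.2
      unfold edgeDen; linarith
    obtain ⟨x, hx, hxl, hx2, -⟩ := loop_of_edge_meets hcand.2.1 hcand.2.2.le hD
    have hx2 := hx2 hcand.2.2
    by_contra! hle
    have hjM : (j : ℝ) + 1 ≤ R := by
      have : j + 1 ≤ M + 1 := by omega
      rw [hR]; exact_mod_cast this
    have hxI : x ∈ Icc 0 R := ⟨(Nat.cast_nonneg j).trans hx.1, hx.2.trans hjM⟩
    have hsle : edgeNum p q j / edgeDen p q (v i - q) j ≤ SA := by
      rw [div_le_iff₀ hD, ← quotA, div_mul_eq_mul_div, le_div_iff₀ denA]; exact hle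
    have hxa : x = a := by
      rcases hfrontA x _ hxI (div_pos hcand.1 hD) hsle hxl with e1 | e1
      · have hj0 : j = 0 := by
          rw [e1] at hx
          have := hx.1
          have : j ≤ 0 := by exact_mod_cast this
          omega
        rw [e1, hposL (hj0 ▸ hcand.1)]
      · exact e1
    apply hne
    rw [hkA, ← hxa]
    exact ((Nat.floor_eq_iff hxI.1).2 ⟨hx.1, hx2⟩).symm
  · intro j hj hcand hne
    have hD : 0 < edgeDen p q (v e - q) j := by
      have h1 := hcand.2.1; have h2 := hcand.2.2
      unfold edgeDen; linarith
    obtain ⟨x, hx, hxl, -, hx2⟩ := loop_of_edge_meets hcand.2.1.le hcand.2.2 hD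
    have hx2 := hx2 hcand.2.1
    by_contra! hle
    have hjM : (j : ℝ) + 1 ≤ R := by
      have : j + 1 ≤ M + 1 := by omega
      rw [hR]; exact_mod_cast this
    have hxI : x ∈ Icc 0 R := ⟨(Nat.cast_nonneg j).trans hx.1, hx.2.trans hjM⟩
    have hsle : edgeNum p q j / edgeDen p q (v e - q) j ≤ SB := by
      rw [div_le_iff₀ hD, ← quotB, div_mul_eq_mul_div, le_div_iff₀ denB]; exact hle
    have hxb : x = b := by
      rcases hfrontB x _ hxI (div_pos hcand.1 hD) hsle hxl with e1 | e1
      · have hj0 : j = M := by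
          rw [e1, hR] at hx
          have h1 : M + 1 ≤ j + 1 := by exact_mod_cast hx.2
          omega
        rw [e1, hposR (hj0 ▸ hcand.1)]
      · exact e1
    apply hne
    have h1 : (j : ℝ) < kB + 1 := by linarith
    have h2 : (kB : ℝ) < j + 1 := by linarith [hx.2]
    have h1 : j < kB + 1 := by exact_mod_cast h1
    have h2 : kB < j + 1 := by exact_mod_cast h2
    omega
  · rw [curve_eq_loop v i h0a, quotA]; exact locA
  · rw [curve_eq_loop v i hb0, quotB]; exact locB

end ChainVisibility

namespace ChainVisibility

/-! ### Executing code -/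

section Execution

variable {α β : ℕ} {prog : List (Instr α β)} {I : Input}

/-- The code `l` is found in the program from line `b` on. -/
def CodeAt (prog : List (Instr α β)) (b : ℕ) (l : List (Instr α β)) : Prop :=
  ∀ j ins, l[j]? = some ins → prog[b + j]? = some ins

theorem CodeAt.append {b : ℕ} {l₁ l₂ : List (Instr α β)} (h : CodeAt prog b (l₁ ++ l₂)) :
    CodeAt prog b l₁ ∧ CodeAt prog (b + l₁.length) l₂ := by
  refine ⟨fun j ins hj => h j ins ?_, fun j ins hj => ?_⟩
  · rw [List.getElem?_append_left (List.getElem?_eq_some_iff.1 hj).1, hj]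
  · rw [add_assoc]
    refine h _ ins ?_
    rw [List.getElem?_append_right (by omega), Nat.add_sub_cancel_left, hj]

/-- An instruction that is not a jump. -/
def Instr.isStraight : Instr α β → Bool
  | .jump _ => false
  | .jumpIdxLT _ _ _ => false
  | .jumpNumLT _ _ _ => false
  | _ => true

theorem Instr.exec_pc {ins : Instr α β} (h : ins.isStraight = true) (c : Config α β) :
    (ins.exec I c).pc = c.pc + 1 := by
  cases ins <;> simp_all [Instr.isStraight, Instr.exec]

/-- The effect of jump-free code. -/
noncomputable def execList (I : Input) (c : Config α β) (l : List (Instr α β)) : Config α β :=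
  l.foldl (fun c ins => ins.exec I c) c

theorem step_eq_exec {c : Config α β} {ins : Instr α β} (h : prog[c.pc]? = some ins) :
    step prog I c = ins.exec I c := by
  unfold step; rw [h]

theorem iterate_step_eq_execList {l : List (Instr α β)} (hl : l.all Instr.isStraight = true)
    (c : Config α β) (h : CodeAt prog c.pc l) :
    (step prog I)^[l.length] c = execList I c l := by
  induction l generalizing c with
  | nil => rfl
  | cons ins l ih =>
    simp only [List.all_cons, Bool.and_eq_true] at hl
    have h0 : prog[c.pc]? = some ins := h 0 ins rfl
    rw [List.length_cons, Function.iterate_succ_apply, step_eq_exec h0]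
    refine ih hl.2 _ ?_
    rw [Instr.exec_pc hl.1]
    intro j ins' hj
    rw [add_assoc, add_comm 1 j]
    exact h (j + 1) ins' (by simpa using hj)

/-- `c'` is reached from `c` in at most `t` steps. -/
def Reaches (prog : List (Instr α β)) (I : Input) (c : Config α β) (t : ℕ) (c' : Config α β) :
    Prop := ∃ s ≤ t, (step prog I)^[s] c = c'

theorem Reaches.refl (c : Config α β) : Reaches prog I c 0 c := ⟨0, le_rfl, rfl⟩

theorem Reaches.trans {c c' c'' : Config α β} {s t : ℕ} (h : Reaches prog I c s c')
    (h' : Reaches prog I c' t c'') : Reaches prog I c (s + t) c'' := by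
  obtain ⟨s', hs, rfl⟩ := h
  obtain ⟨t', ht, rfl⟩ := h'
  exact ⟨t' + s', by omega, Function.iterate_add_apply _ _ _ _⟩

theorem Reaches.mono {c c' : Config α β} {s t : ℕ} (h : Reaches prog I c s c') (hst : s ≤ t) :
    Reaches prog I c t c' := by
  obtain ⟨s', hs, h⟩ := h
  exact ⟨s', hs.trans hst, h⟩

theorem reaches_execList {l : List (Instr α β)} {c : Config α β} {b : ℕ} (h : CodeAt prog b l)
    (hb : c.pc = b) (hl : l.all Instr.isStraight = true) :
    Reaches prog I c l.length (execList I c l) :=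
  ⟨l.length, le_rfl, iterate_step_eq_execList hl c (hb ▸ h)⟩

theorem reaches_one {c : Config α β} {ins : Instr α β} (h : prog[c.pc]? = some ins) :
    Reaches prog I c 1 (ins.exec I c) := ⟨1, le_rfl, step_eq_exec h⟩

end Execution

/-! ### The scan for the nearest edge

Index registers: `0`, `1` the ends of the current edge, `2` the length, `3`, `4` the results of the
two scans, `5` the vertex that gives the direction.  Number registers: `0` holds `0`, `1`, `2` the
viewpoint, `3`, `4` the direction, `5`–`8` the ends of the current edge, seen from the viewpoint,
`9`, `10`, `17`, `18` products, `11`–`14` the cross products and the denominator of the current edge,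
`15`, `16` the best fraction, `19`–`22` points, and `23` holds `1`. -/

/-- Read the direction, and initialize the best fraction by `1 / 0` and the edge by the first one. -/
def scanSetup : List (Instr 6 24) :=
  [.readX 19 5, .readY 20 5, .sub 3 19 1, .sub 4 20 2, .numConst 15 1, .numConst 16 0,
    .idxConst 0 0, .idxConst 1 1]

/-- Compute the cross products for the current edge, and compare its fraction with the best one. -/
def scanBody : List (Instr 6 24) :=
  [.readX 19 0, .readY 20 0, .sub 5 19 1, .sub 6 20 2, .readX 19 1, .readY 20 1, .sub 7 19 1,
    .sub 8 20 2, .mul 9 3 6, .mul 10 4 5, .sub 11 9 10, .mul 9 3 8, .mul 10 4 7, .sub 12 9 10,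
    .mul 9 5 8, .mul 10 6 7, .sub 13 9 10, .sub 14 12 11, .mul 17 13 16, .mul 18 15 14]

/-- Skip the current edge unless it is a candidate that beats the best one. -/
def scanTest (b : ℕ) (r₁ s₁ r₂ s₂ : Fin 24) : List (Instr 6 24) :=
  [.jumpNumLT r₁ s₁ (b + 40), .jumpNumLT r₂ s₂ (b + 33), .jump (b + 40), .jumpNumLT 0 13 (b + 35),
    .jump (b + 40), .jumpNumLT 17 18 (b + 37), .jump (b + 40)]

def scanUpdate (res : Fin 6) : List (Instr 6 24) := [.add 15 13 0, .add 16 14 0, .idxCopy res 0]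

def scanNext : List (Instr 6 24) := [.idxSucc 0, .idxSucc 1]

/-- The scan, to be placed at line `b`: it leaves in the index register `res` the number of the
nearest candidate, and in the number registers `15`, `16` its fraction. -/
def scan (b : ℕ) (res : Fin 6) (r₁ s₁ r₂ s₂ : Fin 24) : List (Instr 6 24) :=
  scanSetup ++ ([.jumpIdxLT 1 2 (b + 10), .jump (b + 43)] ++ (scanBody ++
    (scanTest b r₁ s₁ r₂ s₂ ++ (scanUpdate res ++ (scanNext ++ [.jump (b + 8)])))))

theorem execList_scanSetup (I : Input) (c : Config 6 24) :
    let c' := execList I c scanSetup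
    c'.pc = c.pc + 8 ∧ c'.out = c.out ∧ c'.idx 0 = 0 ∧ c'.idx 1 = 1 ∧
      (∀ x, x ≠ 0 → x ≠ 1 → c'.idx x = c.idx x) ∧ c'.num 0 = c.num 0 ∧ c'.num 1 = c.num 1 ∧
      c'.num 2 = c.num 2 ∧ c'.num 23 = c.num 23 ∧
      c'.num 3 = (I.read (c.idx 5)).re - c.num 1 ∧ c'.num 4 = (I.read (c.idx 5)).im - c.num 2 ∧
      c'.num 15 = 1 ∧ c'.num 16 = 0 := by
  refine ⟨rfl, rfl, rfl, rfl, ?_, rfl, rfl, rfl, rfl, rfl, rfl, ?_, ?_⟩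
  · intro x h0 h1
    simp [execList, scanSetup, Instr.exec, h0, h1]
  · simp [execList, scanSetup, Instr.exec]
  · simp [execList, scanSetup, Instr.exec]

/-- Registers `17` and `18` are the two sides of the cross-multiplied comparison with the best
fraction so far. Against the initial `1 / 0` it says that the denominator is positive, which holds
for every candidate. -/
theorem execList_scanBody (I : Input) (c : Config 6 24) {d : ℂ} (h3 : c.num 3 = d.re)
    (h4 : c.num 4 = d.im) (h1 : c.num 1 = I.query.re) (h2 : c.num 2 = I.query.im) {k : ℕ}
    (hk : c.idx 0 = k) (hk1 : c.idx 1 = k + 1) :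
    let c' := execList I c scanBody
    c'.pc = c.pc + 20 ∧ c'.out = c.out ∧ c'.idx = c.idx ∧ c'.num 0 = c.num 0 ∧
      c'.num 1 = c.num 1 ∧ c'.num 2 = c.num 2 ∧ c'.num 23 = c.num 23 ∧ c'.num 3 = c.num 3 ∧
      c'.num 4 = c.num 4 ∧ c'.num 15 = c.num 15 ∧ c'.num 16 = c.num 16 ∧
      c'.num 11 = cross d (I.read k - I.query) ∧ c'.num 12 = cross d (I.read (k + 1) - I.query) ∧
      c'.num 13 = edgeNum I.read I.query k ∧ c'.num 14 = edgeDen I.read I.query d k ∧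
      c'.num 17 = edgeNum I.read I.query k * c.num 16 ∧
      c'.num 18 = c.num 15 * edgeDen I.read I.query d k := by
  simp only [execList, scanBody, Instr.exec, List.foldl_cons, List.foldl_nil]
  refine ⟨trivial, trivial, trivial, ?_, ?_, ?_, ?_, ?_, ?_, ?_, ?_, ?_, ?_, ?_, ?_, ?_, ?_⟩ <;>
    simp [edgeNum, edgeDen, cross, h1, h2, h3, h4, hk, hk1]

/-- Numbers are copied by adding register `0`, which holds zero throughout the scan. -/
theorem execList_scanUpdate (I : Input) (c : Config 6 24) (res : Fin 6) :
    let c' := execList I c (scanUpdate res)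
    c'.pc = c.pc + 3 ∧ c'.out = c.out ∧ c'.idx = Function.update c.idx res (c.idx 0) ∧
      (∀ r, r ≠ 15 → r ≠ 16 → c'.num r = c.num r) ∧ c'.num 15 = c.num 13 + c.num 0 ∧
      c'.num 16 = c.num 14 + c.num 0 := by
  refine ⟨rfl, rfl, rfl, ?_, rfl, rfl⟩
  intro r h1 h2
  simp [execList, scanUpdate, Instr.exec, h1, h2]

theorem execList_scanNext (I : Input) (c : Config 6 24) :
    let c' := execList I c scanNext
    c'.pc = c.pc + 2 ∧ c'.out = c.out ∧ c'.num = c.num ∧ c'.idx 0 = c.idx 0 + 1 ∧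
      c'.idx 1 = c.idx 1 + 1 ∧ ∀ x, x ≠ 0 → x ≠ 1 → c'.idx x = c.idx x := by
  refine ⟨rfl, rfl, rfl, rfl, rfl, ?_⟩
  intro x h0 h1
  simp [execList, scanNext, Instr.exec, h0, h1]

end ChainVisibility

/-! ### The running minimum and the loop invariant of a scan. -/

namespace ChainVisibility

/-- `r` is, if there is any, a nearest candidate among the first `k` edges, and `N / D` its fraction;
otherwise the fraction is `1 / 0`. -/
def IsBest (p : ℕ → ℂ) (q d : ℂ) (cand : ℕ → Prop) (k : ℕ) (r : ℕ) (N D : ℝ) : Prop :=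
  (N = 1 ∧ D = 0 ∧ ∀ j < k, ¬ cand j) ∨
  (r < k ∧ cand r ∧ N = edgeNum p q r ∧ D = edgeDen p q d r ∧
    ∀ j < k, cand j → edgeNum p q r * edgeDen p q d j ≤ edgeNum p q j * edgeDen p q d r)

section Best

variable {p : ℕ → ℂ} {q d : ℂ} {cand : ℕ → Prop} {k r : ℕ} {N D : ℝ}

/-- A candidate always beats `1 / 0`, so an edge that is skipped while no best one is known is not a
candidate. -/
theorem IsBest.skip (h : IsBest p q d cand k r N D)
    (hk : ¬ (cand k ∧ edgeNum p q k * D < N * edgeDen p q d k))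
    (hpos : ∀ j, cand j → 0 < edgeDen p q d j) : IsBest p q d cand (k + 1) r N D := by
  rcases h with ⟨rfl, rfl, h⟩ | ⟨hr, hcr, rfl, rfl, h⟩
  · refine Or.inl ⟨rfl, rfl, fun j hj hcj => ?_⟩
    rcases Nat.lt_succ_iff_lt_or_eq.1 hj with h1 | rfl
    · exact h j h1 hcj
    · exact hk ⟨hcj, by simpa using hpos j hcj⟩
  · refine Or.inr ⟨by omega, hcr, rfl, rfl, fun j hj hcj => ?_⟩
    rcases Nat.lt_succ_iff_lt_or_eq.1 hj with h1 | rfl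
    · exact h j h1 hcj
    · by_contra! hlt
      exact hk ⟨hcj, hlt⟩

theorem IsBest.update (h : IsBest p q d cand k r N D) (hck : cand k)
    (hk : edgeNum p q k * D < N * edgeDen p q d k)
    (hpos : ∀ j, cand j → 0 < edgeDen p q d j) :
    IsBest p q d cand (k + 1) k (edgeNum p q k) (edgeDen p q d k) := by
  refine Or.inr ⟨by omega, hck, rfl, rfl, fun j hj hcj => ?_⟩
  rcases Nat.lt_succ_iff_lt_or_eq.1 hj with h1 | rfl
  · rcases h with ⟨rfl, rfl, h⟩ | ⟨hr, hcr, rfl, rfl, h⟩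
    · exact absurd hcj (h j h1)
    · have h2 := h j h1 hcj
      have pk := hpos k hck
      have pr := hpos r hcr
      have pj := hpos j hcj
      rw [← div_le_div_iff₀ pr pj] at h2
      rw [← div_lt_div_iff₀ pk pr] at hk
      rw [← div_le_div_iff₀ pk pj]
      exact hk.le.trans h2
  · exact le_rfl

/-- The scan keeps a weak minimum; since the geometric one is strict, the two coincide. -/
theorem IsBest.eq_of_isNearestEdge {m : ℕ} (h : IsBest p q d cand k r N D) (hm : m = k + 1)
    {k₀ : ℕ} (hk₀ : IsNearestEdge p q d m cand k₀) :
    r = k₀ ∧ N = edgeNum p q k₀ ∧ D = edgeDen p q d k₀ := by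
  obtain ⟨h1, h2, h3⟩ := hk₀
  rcases h with ⟨-, -, h⟩ | ⟨hr, hcr, hN, hD, h⟩
  · exact absurd h2 (h k₀ (by omega))
  · have : r = k₀ := by
      by_contra hne
      have e1 := h3 r (by omega) hcr hne
      have e2 := h k₀ (by omega) h2
      linarith
    subst this
    exact ⟨rfl, hN, hD⟩

end Best

/-- The state at the head of the loop of a scan. -/
structure ScanInv (I : Input) (d : ℂ) (cand : ℕ → Prop) (b : ℕ) (res : Fin 6)
    (out₀ : List (ℝ × ℝ × ℝ)) (idx₀ : Fin 6 → ℕ) (k : ℕ) (c : Config 6 24) : Prop where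
  pc : c.pc = b + 8
  out : c.out = out₀
  idx_fst : c.idx 0 = k
  idx_snd : c.idx 1 = k + 1
  idx_other : ∀ x, x ≠ 0 → x ≠ 1 → x ≠ res → c.idx x = idx₀ x
  num_zero : c.num 0 = 0
  num_one : c.num 23 = 1
  query_re : c.num 1 = I.query.re
  query_im : c.num 2 = I.query.im
  dir_re : c.num 3 = d.re
  dir_im : c.num 4 = d.im
  best : IsBest I.read I.query d cand k (c.idx res) (c.num 15) (c.num 16)

section Scan

variable {prog : List (Instr 6 24)} {I : Input} {d : ℂ} {cand : ℕ → Prop} {b : ℕ} {res : Fin 6}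
  {r₁ s₁ r₂ s₂ : Fin 24} {out₀ : List (ℝ × ℝ × ℝ)} {idx₀ : Fin 6 → ℕ}

/-- This is the common tail of a round; it expects the minimum to include edge `k` already, whether
that edge was taken or skipped. -/
theorem scan_next (hcode : CodeAt prog (b + 40) (scanNext ++ [.jump (b + 8)]))
    (h0 : res ≠ 0) (h1 : res ≠ 1) {k : ℕ} {c : Config 6 24} (pc : c.pc = b + 40)
    (out : c.out = out₀) (idx_fst : c.idx 0 = k) (idx_snd : c.idx 1 = k + 1)
    (idx_other : ∀ x, x ≠ 0 → x ≠ 1 → x ≠ res → c.idx x = idx₀ x) (num_zero : c.num 0 = 0)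
    (num_one : c.num 23 = 1) (query_re : c.num 1 = I.query.re) (query_im : c.num 2 = I.query.im)
    (dir_re : c.num 3 = d.re) (dir_im : c.num 4 = d.im)
    (best : IsBest I.read I.query d cand (k + 1) (c.idx res) (c.num 15) (c.num 16)) :
    ∃ c', Reaches prog I c 3 c' ∧ ScanInv I d cand b res out₀ idx₀ (k + 1) c' := by
  obtain ⟨hc1, hc2⟩ := hcode.append
  obtain ⟨e1, e2, e3, e4, e5, e6⟩ := execList_scanNext I c
  have r1 := reaches_execList (I := I) hc1 pc rfl
  generalize execList I c scanNext = c1 at *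
  have hj : prog[c1.pc]? = some (.jump (b + 8)) := by
    rw [e1, pc]; exact hc2 0 _ rfl
  refine ⟨_, r1.trans (reaches_one hj), ?_⟩
  constructor
  · rfl
  · exact e2.trans out
  · exact e4.trans (by rw [idx_fst])
  · exact e5.trans (by rw [idx_snd])
  · intro x hx0 hx1 hx2
    exact (e6 x hx0 hx1).trans (idx_other x hx0 hx1 hx2)
  · exact (congrFun e3 0).trans num_zero
  · exact (congrFun e3 23).trans num_one
  · exact (congrFun e3 1).trans query_re
  · exact (congrFun e3 2).trans query_im
  · exact (congrFun e3 3).trans dir_re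
  · exact (congrFun e3 4).trans dir_im
  · show IsBest I.read I.query d cand (k + 1) (c1.idx res) (c1.num 15) (c1.num 16)
    rw [e6 res h0 h1, e3]
    exact best

/-- The test either enters the update or skips it. -/
theorem scan_test (hcode : CodeAt prog (b + 30) (scanTest b r₁ s₁ r₂ s₂)) {c : Config 6 24}
    (pc : c.pc = b + 30) :
    ∃ l, Reaches prog I c 5 { c with pc := l } ∧
      ((l = b + 37 ∧ ¬ c.num r₁ < c.num s₁ ∧ c.num r₂ < c.num s₂ ∧ c.num 0 < c.num 13 ∧
        c.num 17 < c.num 18) ∨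
      (l = b + 40 ∧ ¬ (¬ c.num r₁ < c.num s₁ ∧ c.num r₂ < c.num s₂ ∧ c.num 0 < c.num 13 ∧
        c.num 17 < c.num 18))) := by
  have get : ∀ (l : ℕ) (ins : Instr 6 24), (scanTest b r₁ s₁ r₂ s₂)[l]? = some ins →
      step prog I { c with pc := b + 30 + l } = ins.exec I { c with pc := b + 30 + l } := by
    intro l ins hl
    exact step_eq_exec (hcode l ins hl)
  have hc : c = { c with pc := b + 30 + 0 } := by
    cases c; simp_all
  have g0 := get 0 _ rfl
  have g1 := get 1 _ rfl
  have g2 := get 2 _ rfl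
  have g3 := get 3 _ rfl
  have g4 := get 4 _ rfl
  have g5 := get 5 _ rfl
  have g6 := get 6 _ rfl
  rw [← hc] at g0
  simp only [Instr.exec, pc, add_assoc, Nat.reduceAdd] at g0 g1 g2 g3 g4 g5 g6
  by_cases t1 : c.num r₁ < c.num s₁
  · rw [if_pos t1] at g0
    exact ⟨b + 40, ⟨1, by omega, g0⟩, Or.inr ⟨rfl, fun h => h.1 t1⟩⟩
  rw [if_neg t1] at g0
  by_cases t2 : c.num r₂ < c.num s₂
  swap
  · rw [if_neg t2] at g1
    refine ⟨b + 40, ⟨3, by omega, ?_⟩, Or.inr ⟨rfl, fun h => t2 h.2.1⟩⟩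
    simp only [Function.iterate_succ_apply, Function.iterate_zero, id]
    rw [g0, g1, g2]
  rw [if_pos t2] at g1
  by_cases t3 : c.num 0 < c.num 13
  swap
  · rw [if_neg t3] at g3
    refine ⟨b + 40, ⟨4, by omega, ?_⟩, Or.inr ⟨rfl, fun h => t3 h.2.2.1⟩⟩
    simp only [Function.iterate_succ_apply, Function.iterate_zero, id]
    rw [g0, g1, g3, g4]
  rw [if_pos t3] at g3
  by_cases t4 : c.num 17 < c.num 18
  · rw [if_pos t4] at g5
    refine ⟨b + 37, ⟨4, by omega, ?_⟩, Or.inl ⟨rfl, t1, t2, t3, t4⟩⟩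
    simp only [Function.iterate_succ_apply, Function.iterate_zero, id]
    rw [g0, g1, g3, g5]
  · rw [if_neg t4] at g5
    refine ⟨b + 40, ⟨5, by omega, ?_⟩, Or.inr ⟨rfl, fun h => t4 h.2.2.2⟩⟩
    simp only [Function.iterate_succ_apply, Function.iterate_zero, id]
    rw [g0, g1, g3, g5, g6]

/-- One round of the loop. -/
theorem scan_round (hcode : CodeAt prog b (scan b res r₁ s₁ r₂ s₂)) (h0 : res ≠ 0) (h1 : res ≠ 1)
    (h2 : res ≠ 2) (hlen : idx₀ 2 = I.len)
    (hcand : ∀ (num : Fin 24 → ℝ) (k : ℕ), num 0 = 0 →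
      num 11 = cross d (I.read k - I.query) → num 12 = cross d (I.read (k + 1) - I.query) →
      (cand k ↔ 0 < edgeNum I.read I.query k ∧ ¬ num r₁ < num s₁ ∧ num r₂ < num s₂))
    (hpos : ∀ j, cand j → 0 < edgeDen I.read I.query d j) {k : ℕ} (hk : k + 1 < I.len)
    {c : Config 6 24} (h : ScanInv I d cand b res out₀ idx₀ k c) :
    ∃ c', Reaches prog I c 40 c' ∧ ScanInv I d cand b res out₀ idx₀ (k + 1) c' := by
  obtain ⟨-, hcode⟩ := hcode.append
  obtain ⟨hhead, hcode⟩ := hcode.append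
  obtain ⟨hbody, hcode⟩ := hcode.append
  obtain ⟨htest, hcode⟩ := hcode.append
  obtain ⟨hupd, hnext⟩ := hcode.append
  simp only [scanSetup, scanBody, scanTest, scanUpdate, List.length_cons, List.length_nil,
    add_assoc, Nat.reduceAdd] at hhead htest hupd hnext
  have hbody' : CodeAt prog (b + 10) scanBody := by
    simpa [scanSetup, add_assoc] using hbody
  -- enter the body
  have hlt : c.idx 1 < c.idx 2 := by
    rw [h.idx_snd, h.idx_other 2 (by decide) (by decide) (Ne.symm h2), hlen]; exact hk
  have hj : prog[c.pc]? = some (.jumpIdxLT 1 2 (b + 10)) := by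
    rw [h.pc]; exact hhead 0 _ rfl
  have rA := reaches_one (I := I) hj
  set cA : Config 6 24 := { c with pc := b + 10 } with hcA
  have eA : (Instr.jumpIdxLT 1 2 (b + 10) : Instr 6 24).exec I c = cA := by
    simp [Instr.exec, hlt, hcA]
  rw [eA] at rA
  -- the body
  have rB := reaches_execList (I := I) (c := cA) hbody' rfl rfl
  obtain ⟨f1, f2, f3, f4, f5, f6, f7, f8, f9, f10, f11, f12, f13, f14, f15, f16, f17⟩ :=
    execList_scanBody I cA (d := d) h.dir_re h.dir_im h.query_re h.query_im h.idx_fst h.idx_snd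
  generalize execList I cA scanBody = cB at *
  have pcB : cB.pc = b + 30 := f1
  -- the test
  obtain ⟨l, rC, hl⟩ := scan_test (I := I) htest pcB
  have hc := hcand cB.num k (f4.trans h.num_zero) f12 f13
  have hZ : cB.num 0 = 0 := f4.trans h.num_zero
  have f16' : cB.num 17 = edgeNum I.read I.query k * c.num 16 := f16
  have f17' : cB.num 18 = c.num 15 * edgeDen I.read I.query d k := f17
  have hidx : ∀ x, cB.idx x = c.idx x := fun x => congrFun f3 x
  have reach := (rA.trans rB).trans rC
  rcases hl with ⟨rfl, t1, t2, t3, t4⟩ | ⟨rfl, t⟩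
  · rw [hZ, f14] at t3
    rw [f16', f17'] at t4
    have hupd' : CodeAt prog (b + 37) (scanUpdate res) := hupd
    have rD := reaches_execList (I := I) (c := { cB with pc := b + 37 }) hupd' rfl rfl
    obtain ⟨g1, g2, g3, g4, g5, g6⟩ := execList_scanUpdate I { cB with pc := b + 37 } res
    generalize execList I { cB with pc := b + 37 } (scanUpdate res) = cD at *
    have hb := h.best.update (hc.2 ⟨t3, t1, t2⟩) t4 hpos
    have i0 : cD.idx 0 = k := by
      rw [g3, Function.update_of_ne (Ne.symm h0)]; exact (hidx 0).trans h.idx_fst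
    have ir : cD.idx res = k := by
      rw [g3, Function.update_self]; exact (hidx 0).trans h.idx_fst
    obtain ⟨c', rE, hinv⟩ := scan_next (I := I) (d := d) (cand := cand) (out₀ := out₀)
      (idx₀ := idx₀) (k := k) hnext h0 h1 (c := cD) g1
      (g2.trans (f2.trans h.out)) i0
      (by rw [g3, Function.update_of_ne (Ne.symm h1)]; exact (hidx 1).trans h.idx_snd)
      (fun x hx0 hx1 hx2 => by
        rw [g3, Function.update_of_ne hx2]; exact (hidx x).trans (h.idx_other x hx0 hx1 hx2))
      ((g4 0 (by decide) (by decide)).trans hZ)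
      ((g4 23 (by decide) (by decide)).trans (f7.trans h.num_one))
      ((g4 1 (by decide) (by decide)).trans (f5.trans h.query_re))
      ((g4 2 (by decide) (by decide)).trans (f6.trans h.query_im))
      ((g4 3 (by decide) (by decide)).trans (f8.trans h.dir_re))
      ((g4 4 (by decide) (by decide)).trans (f9.trans h.dir_im))
      (by
        have n15 : cD.num 15 = edgeNum I.read I.query k := by
          rw [g5]; show cB.num 13 + cB.num 0 = _; rw [hZ, f14, add_zero]
        have n16 : cD.num 16 = edgeDen I.read I.query d k := by
          rw [g6]; show cB.num 14 + cB.num 0 = _; rw [hZ, f15, add_zero]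
        rw [ir, n15, n16]; exact hb)
    -- Head, body, test, update and tail take at most `1 + 20 + 5 + 3 + 3 = 32` steps.
    refine ⟨c', ((reach.trans rD).trans rE).mono ?_, hinv⟩
    simp [scanBody, scanUpdate]
  · obtain ⟨c', rE, hinv⟩ := scan_next (I := I) (d := d) (cand := cand) (out₀ := out₀)
      (idx₀ := idx₀) (k := k) hnext h0 h1 (c := { cB with pc := b + 40 }) rfl
      (f2.trans h.out) ((hidx 0).trans h.idx_fst) ((hidx 1).trans h.idx_snd)
      (fun x hx0 hx1 hx2 => (hidx x).trans (h.idx_other x hx0 hx1 hx2)) hZ (f7.trans h.num_one)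
      (f5.trans h.query_re) (f6.trans h.query_im) (f8.trans h.dir_re) (f9.trans h.dir_im)
      (by
        have n15 : cB.num 15 = c.num 15 := f10
        have n16 : cB.num 16 = c.num 16 := f11
        show IsBest I.read I.query d cand (k + 1) (cB.idx res) (cB.num 15) (cB.num 16)
        rw [hidx res, n15, n16]
        refine h.best.skip ?_ hpos
        rintro ⟨u1, u2⟩
        rw [hZ, f14, f16', f17'] at t
        have := hc.1 u1
        exact t ⟨this.2.1, this.2.2, this.1, u2⟩)
    refine ⟨c', (reach.trans rE).mono ?_, hinv⟩
    simp [scanBody]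

/-- The scan finds the nearest candidate. -/
theorem scan_correct (hcode : CodeAt prog b (scan b res r₁ s₁ r₂ s₂)) (h0 : res ≠ 0)
    (h1 : res ≠ 1) (h2 : res ≠ 2)
    (hcand : ∀ (num : Fin 24 → ℝ) (k : ℕ), num 0 = 0 →
      num 11 = cross d (I.read k - I.query) → num 12 = cross d (I.read (k + 1) - I.query) →
      (cand k ↔ 0 < edgeNum I.read I.query k ∧ ¬ num r₁ < num s₁ ∧ num r₂ < num s₂))
    (hpos : ∀ j, cand j → 0 < edgeDen I.read I.query d j) (hlen : 2 ≤ I.len)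
    {k₀ : ℕ} (hk₀ : IsNearestEdge I.read I.query d I.len cand k₀)
    {c : Config 6 24} (pc : c.pc = b) (len : c.idx 2 = I.len) (hd : d = I.read (c.idx 5) - I.query)
    (z : c.num 0 = 0) (one : c.num 23 = 1) (qx : c.num 1 = I.query.re) (qy : c.num 2 = I.query.im) :
    ∃ c', Reaches prog I c (40 * I.len + 10) c' ∧ c'.pc = b + 43 ∧ c'.out = c.out ∧
      (∀ x, x ≠ 0 → x ≠ 1 → x ≠ res → c'.idx x = c.idx x) ∧ c'.idx res = k₀ ∧ c'.num 0 = 0 ∧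
      c'.num 23 = 1 ∧ c'.num 1 = I.query.re ∧ c'.num 2 = I.query.im ∧ c'.num 3 = d.re ∧
      c'.num 4 = d.im ∧ c'.num 15 = edgeNum I.read I.query k₀ ∧
      c'.num 16 = edgeDen I.read I.query d k₀ := by
  have hcode' := hcode
  obtain ⟨hsetup, hcode'⟩ := hcode'.append
  obtain ⟨hhead, -⟩ := hcode'.append
  simp only [scanSetup, List.length_cons, List.length_nil, Nat.reduceAdd] at hhead
  have rA := reaches_execList (I := I) hsetup pc rfl
  obtain ⟨e1, e2, e3, e4, e5, e6, e7, e8, e9, e10, e11, e12, e13⟩ := execList_scanSetup I c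
  generalize execList I c scanSetup = cA at *
  have inv0 : ScanInv I d cand b res c.out c.idx 0 cA := by
    refine ⟨by rw [e1, pc], e2, e3, e4, fun x hx0 hx1 _ => e5 x hx0 hx1, e6.trans z, e9.trans one,
      e7.trans qx, e8.trans qy, ?_, ?_, Or.inl ⟨e12, e13, fun j hj => by omega⟩⟩
    · rw [e10, hd, qx, Complex.sub_re]
    · rw [e11, hd, qy, Complex.sub_im]
  have loop : ∀ k, k + 1 ≤ I.len → ∃ c', Reaches prog I cA (40 * k) c' ∧
      ScanInv I d cand b res c.out c.idx k c' := by
    intro k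
    induction k with
    | zero => intro _; exact ⟨cA, Reaches.refl _, inv0⟩
    | succ k ih =>
      intro hk
      obtain ⟨c1, r1, inv1⟩ := ih (by omega)
      obtain ⟨c2, r2, inv2⟩ := scan_round hcode h0 h1 h2 len hcand hpos (by omega) inv1
      exact ⟨c2, (r1.trans r2).mono (by omega), inv2⟩
  -- There is one edge fewer than there are vertices.
  obtain ⟨c1, r1, inv⟩ := loop (I.len - 1) (by omega)
  have hnlt : ¬ c1.idx 1 < c1.idx 2 := by
    rw [inv.idx_snd, inv.idx_other 2 (by decide) (by decide) (Ne.symm h2), len]; omega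
  have hj : prog[c1.pc]? = some (.jumpIdxLT 1 2 (b + 10)) := by
    rw [inv.pc]; exact hhead 0 _ rfl
  have r2 := reaches_one (I := I) hj
  have e : (Instr.jumpIdxLT 1 2 (b + 10) : Instr 6 24).exec I c1 = { c1 with pc := b + 9 } := by
    simp [Instr.exec, hnlt, inv.pc]
  rw [e] at r2
  have hj2 : prog[({ c1 with pc := b + 9 } : Config 6 24).pc]? = some (.jump (b + 43)) :=
    hhead 1 _ rfl
  have r3 := reaches_one (I := I) hj2
  obtain ⟨hr, hN, hD⟩ := inv.best.eq_of_isNearestEdge (m := I.len) (by omega) hk₀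
  refine ⟨_, (((rA.trans r1).trans r2).trans r3).mono ?_, rfl, inv.out, inv.idx_other, hr,
    inv.num_zero, inv.num_one, inv.query_re, inv.query_im, inv.dir_re, inv.dir_im, hN, hD⟩
  simp only [scanSetup, List.length_cons, List.length_nil]
  omega

end Scan

end ChainVisibility

namespace ChainVisibility

/-! ### The program -/

def preamble : List (Instr 6 24) :=
  [.queryX 1, .queryY 2, .numConst 23 1, .idxLen 2, .idxConst 5 0]

/-- Write the vertex whose index is in register `5`. -/
def writeVertex : List (Instr 6 24) := [.readX 19 5, .readY 20 5, .write 19 20 23]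

/-- Write the point of the ray that is given by the best fraction. -/
def writeHit : List (Instr 6 24) :=
  [.mul 17 1 16, .mul 18 15 3, .add 21 17 18, .mul 17 2 16, .mul 18 15 4, .add 22 17 18,
    .write 21 22 16]

def moveToLast : List (Instr 6 24) := [.idxLen 5, .idxPred 5]

/-- Write the next vertex after the one whose index is in register `3`. -/
def writeNext : List (Instr 6 24) := [.idxSucc 3, .readX 19 3, .readY 20 3, .write 19 20 23]

/-- Write the vertices after the first result up to the second one. -/
def vertexLoop : List (Instr 6 24) :=
  [.jumpIdxLT 3 4 105, .jump 110] ++ (writeNext ++ [.jump 103])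

/-- Jump targets are absolute. A scan has `43` lines, so the scans start at lines `5` and `60`, the
vertex loop at `103`, the second `writeHit` at `110`, and the code ends at `120`. The register
arguments of the scans encode the sign conditions of `LeavesRay` and `ReachesRay`, each as one
negated and one plain comparison with zero. -/
def program : List (Instr 6 24) :=
  preamble ++ (scan 5 3 0 11 0 12 ++ ((writeVertex ++ writeHit ++ moveToLast) ++
    (scan 60 4 12 0 11 0 ++ (vertexLoop ++ (writeHit ++ writeVertex)))))

/-- The words written for a point of the input. -/
noncomputable def affineWords (z : ℂ) : ℝ × ℝ × ℝ := (z.re, z.im, 1)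

/-- The words written for the point `q + (N / D) d`. -/
noncomputable def hitWords (q d : ℂ) (N D : ℝ) : ℝ × ℝ × ℝ :=
  (q.re * D + N * d.re, q.im * D + N * d.im, D)

theorem execList_preamble (I : Input) (c : Config 6 24) :
    let c' := execList I c preamble
    c'.pc = c.pc + 5 ∧ c'.out = c.out ∧ c'.idx 2 = I.len ∧ c'.idx 5 = 0 ∧ c'.num 0 = c.num 0 ∧
      c'.num 23 = 1 ∧ c'.num 1 = I.query.re ∧ c'.num 2 = I.query.im := by
  simp [execList, preamble, Instr.exec]

theorem execList_writeVertex (I : Input) (c : Config 6 24) (h : c.num 23 = 1) :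
    let c' := execList I c writeVertex
    c'.pc = c.pc + 3 ∧ c'.out = c.out ++ [affineWords (I.read (c.idx 5))] ∧ c'.idx = c.idx ∧
      (∀ r, r ≠ 19 → r ≠ 20 → c'.num r = c.num r) := by
  simp +contextual [execList, writeVertex, Instr.exec, affineWords, h]

theorem execList_writeHit (I : Input) (c : Config 6 24) {q d : ℂ} {N D : ℝ} (h1 : c.num 1 = q.re)
    (h2 : c.num 2 = q.im) (h3 : c.num 3 = d.re) (h4 : c.num 4 = d.im) (h5 : c.num 15 = N)
    (h6 : c.num 16 = D) :
    let c' := execList I c writeHit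
    c'.pc = c.pc + 7 ∧ c'.out = c.out ++ [hitWords q d N D] ∧ c'.idx = c.idx ∧
      (∀ r, r ≠ 17 → r ≠ 18 → r ≠ 21 → r ≠ 22 → c'.num r = c.num r) := by
  simp +contextual [execList, writeHit, Instr.exec, hitWords, h1, h2, h3, h4, h5, h6]

theorem execList_moveToLast (I : Input) (c : Config 6 24) :
    let c' := execList I c moveToLast
    c'.pc = c.pc + 2 ∧ c'.out = c.out ∧ c'.idx 5 = I.len - 1 ∧
      (∀ x, x ≠ 5 → c'.idx x = c.idx x) ∧ c'.num = c.num := by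
  simp +contextual [execList, moveToLast, Instr.exec]

theorem execList_writeNext (I : Input) (c : Config 6 24) (h : c.num 23 = 1) :
    let c' := execList I c writeNext
    c'.pc = c.pc + 4 ∧ c'.idx 3 = c.idx 3 + 1 ∧ c'.idx 4 = c.idx 4 ∧ c'.idx 5 = c.idx 5 ∧
      (∀ r, r ≠ 19 → r ≠ 20 → c'.num r = c.num r) ∧
      c'.out = c.out ++ [affineWords (I.read (c.idx 3 + 1))] := by
  simp +contextual [execList, writeNext, Instr.exec, affineWords, h]

/-- Induction on the number `l` of vertices still to be written; a round takes `1 + 4 + 1` steps,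
the exit two jumps. -/
theorem vertexLoop_correct {prog : List (Instr 6 24)} {I : Input}
    (hcode : CodeAt prog 103 vertexLoop) (l : ℕ) :
    ∀ c : Config 6 24, c.pc = 103 → c.idx 4 = c.idx 3 + l → c.num 23 = 1 →
    ∃ c', Reaches prog I c (6 * l + 2) c' ∧ c'.pc = 110 ∧ c'.idx 5 = c.idx 5 ∧
      (∀ r, r ≠ 19 → r ≠ 20 → c'.num r = c.num r) ∧
      c'.out = c.out ++ (List.range' (c.idx 3 + 1) l).map fun k => affineWords (I.read k) := by
  induction l with
  | zero =>
    intro c pc hidx _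
    have hj : prog[c.pc]? = some (.jumpIdxLT 3 4 105) := by rw [pc]; exact hcode 0 _ rfl
    have r1 := reaches_one (I := I) hj
    have e : (Instr.jumpIdxLT 3 4 105 : Instr 6 24).exec I c = { c with pc := 104 } := by
      simp [Instr.exec, hidx, pc]
    rw [e] at r1
    have hj2 : prog[({ c with pc := 104 } : Config 6 24).pc]? = some (.jump 110) :=
      hcode 1 _ rfl
    exact ⟨_, r1.trans (reaches_one hj2), rfl, rfl, fun _ _ _ => rfl, by simp [Instr.exec]⟩
  | succ l ih =>
    intro c pc hidx hone
    have hj : prog[c.pc]? = some (.jumpIdxLT 3 4 105) := by rw [pc]; exact hcode 0 _ rfl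
    have r1 := reaches_one (I := I) hj
    have e : (Instr.jumpIdxLT 3 4 105 : Instr 6 24).exec I c = { c with pc := 105 } := by
      simp [Instr.exec, hidx]
    rw [e] at r1
    obtain ⟨-, hcode'⟩ := hcode.append
    obtain ⟨hbody, hjump⟩ := hcode'.append
    have r2 := reaches_execList (I := I) (c := { c with pc := 105 }) hbody rfl rfl
    obtain ⟨f1, f2, f3, f4, f5, f6⟩ := execList_writeNext I { c with pc := 105 } hone
    generalize execList I { c with pc := 105 } writeNext = c₁ at *
    have hj3 : prog[c₁.pc]? = some (.jump 103) := by rw [f1]; exact hjump 0 _ rfl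
    have r3 := reaches_one (I := I) hj3
    obtain ⟨c', r4, g1, g2, g3, g4⟩ := ih { c₁ with pc := 103 } rfl
      (by show c₁.idx 4 = c₁.idx 3 + l
          rw [f2, f3]; show c.idx 4 = _; rw [hidx]; show _ = c.idx 3 + 1 + l; omega)
      ((f5 23 (by decide) (by decide)).trans hone)
    refine ⟨c', (((r1.trans r2).trans r3).trans r4).mono ?_, g1, g2.trans f4,
      fun r hr1 hr2 => (g3 r hr1 hr2).trans (f5 r hr1 hr2), ?_⟩
    · simp only [writeNext, List.length_cons, List.length_nil]; omega
    · rw [g4]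
      show c₁.out ++ _ = _
      rw [f6, List.range'_succ, List.map_cons, List.append_assoc]
      show c.out ++ ([_] ++ List.map _ (List.range' (c₁.idx 3 + 1) l)) = _
      rw [f2]
      rfl

theorem LeavesRay.edgeDen_pos {p : ℕ → ℂ} {q d : ℂ} {k : ℕ} (h : LeavesRay p q d k) :
    0 < edgeDen p q d k := by
  have h1 := h.2.1
  have h2 := h.2.2
  unfold edgeDen
  linarith

theorem ReachesRay.edgeDen_pos {p : ℕ → ℂ} {q d : ℂ} {k : ℕ} (h : ReachesRay p q d k) :
    0 < edgeDen p q d k := by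
  have h1 := h.2.1
  have h2 := h.2.2
  unfold edgeDen
  linarith

/-- The program halts in linear time with the endpoints, the two cut points and the vertices between
them in its output. -/
theorem program_correct {I : Input} (hlen : 2 ≤ I.len) {kA kB : ℕ} {dA dB : ℂ}
    (hdA : dA = I.read 0 - I.query) (hdB : dB = I.read (I.len - 1) - I.query)
    (hA : IsNearestEdge I.read I.query dA I.len (LeavesRay I.read I.query dA) kA)
    (hB : IsNearestEdge I.read I.query dB I.len (ReachesRay I.read I.query dB) kB)
    (hAB : kA ≤ kB) :
    ∃ T ≤ 150 * I.len, (run program I T).pc = 120 ∧ (run program I T).out =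
      [affineWords (I.read 0),
        hitWords I.query dA (edgeNum I.read I.query kA) (edgeDen I.read I.query dA kA)] ++
      (List.range' (kA + 1) (kB - kA)).map (fun k => affineWords (I.read k)) ++
      [hitWords I.query dB (edgeNum I.read I.query kB) (edgeDen I.read I.query dB kB),
        affineWords (I.read (I.len - 1))] := by
  have hcode : CodeAt program 0 program := fun j ins hj => by rwa [zero_add]
  obtain ⟨hpre, hcode⟩ := CodeAt.append (l₁ := preamble) hcode
  obtain ⟨hscanA, hcode⟩ := hcode.append
  obtain ⟨hmid, hcode⟩ := hcode.append
  obtain ⟨hscanB, hcode⟩ := hcode.append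
  obtain ⟨hloop, hcode⟩ := hcode.append
  obtain ⟨hhitB, hlast⟩ := hcode.append
  obtain ⟨hmid, hmove⟩ := hmid.append
  obtain ⟨hfirst, hhitA⟩ := hmid.append
  change CodeAt program 5 _ at hscanA
  change CodeAt program 48 _ at hfirst
  change CodeAt program 51 _ at hhitA
  change CodeAt program 58 _ at hmove
  change CodeAt program 60 _ at hscanB
  change CodeAt program 103 _ at hloop
  change CodeAt program 110 _ at hhitB
  change CodeAt program 117 _ at hlast
  -- preamble
  have r0 := reaches_execList (I := I) (c := Config.init 6 24) hpre rfl rfl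
  obtain ⟨a1, a2, a3, a4, a5, a6, a7, a8⟩ := execList_preamble I (Config.init 6 24)
  generalize execList I (Config.init 6 24) preamble = c₀ at *
  -- first scan
  obtain ⟨c₁, r1, b1, b2, b3, b4, b5, b6, b7, b8, b9, b10, b11, b12⟩ :=
    scan_correct hscanA (by decide) (by decide) (by decide)
      (cand := LeavesRay I.read I.query dA) (d := dA) (fun num k h0 h11 h12 => by
        rw [h0, h11, h12, LeavesRay, not_lt])
      (fun j hj => hj.edgeDen_pos) hlen hA (c := c₀) a1 a3 (by rw [a4, hdA]) a5 a6 a7 a8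
  have hidx5 : c₁.idx 5 = 0 := (b3 5 (by decide) (by decide) (by decide)).trans a4
  have hidx2 : c₁.idx 2 = I.len := (b3 2 (by decide) (by decide) (by decide)).trans a3
  -- first endpoint
  have r2 := reaches_execList (I := I) hfirst b1 rfl
  obtain ⟨d1, d2, d3, d4⟩ := execList_writeVertex I c₁ b6
  generalize execList I c₁ writeVertex = c₂ at *
  -- first cut point
  have r3 := reaches_execList (I := I) (c := c₂) hhitA (by rw [d1, b1]) rfl
  obtain ⟨e1, e2, e3, e4⟩ := execList_writeHit I c₂ (q := I.query) (d := dA)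
    ((d4 1 (by decide) (by decide)).trans b7) ((d4 2 (by decide) (by decide)).trans b8)
    ((d4 3 (by decide) (by decide)).trans b9) ((d4 4 (by decide) (by decide)).trans b10)
    ((d4 15 (by decide) (by decide)).trans b11) ((d4 16 (by decide) (by decide)).trans b12)
  generalize execList I c₂ writeHit = c₃ at *
  have n3 : ∀ r, r ≠ 17 → r ≠ 18 → r ≠ 21 → r ≠ 22 → r ≠ 19 → r ≠ 20 → c₃.num r = c₁.num r :=
    fun r h1 h2 h3 h4 h5 h6 => (e4 r h1 h2 h3 h4).trans (d4 r h5 h6)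
  -- second scan
  have r4 := reaches_execList (I := I) (c := c₃) hmove (by rw [e1, d1, b1]) rfl
  obtain ⟨f1, f2, f3, f4, f5⟩ := execList_moveToLast I c₃
  generalize execList I c₃ moveToLast = c₄ at *
  have i4 : ∀ x, x ≠ 5 → c₄.idx x = c₁.idx x := fun x hx => by rw [f4 x hx, e3, d3]
  have n4 : ∀ r, r ≠ 17 → r ≠ 18 → r ≠ 21 → r ≠ 22 → r ≠ 19 → r ≠ 20 → c₄.num r = c₁.num r :=
    fun r h1 h2 h3 h4 h5 h6 => by rw [f5]; exact n3 r h1 h2 h3 h4 h5 h6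
  obtain ⟨c₅, r5, g1, g2, g3, g4, g5, g6, g7, g8, g9, g10, g11, g12⟩ :=
    scan_correct hscanB (by decide) (by decide) (by decide)
      (cand := ReachesRay I.read I.query dB) (d := dB) (fun num k h0 h11 h12 => by
        rw [h0, h11, h12, ReachesRay, not_lt, and_comm (a := cross dB (I.read k - I.query) < 0)])
      (fun j hj => hj.edgeDen_pos) hlen hB (c := c₄) (by rw [f1, e1, d1, b1])
      (by rw [i4 2 (by decide), hidx2]) (by rw [f3, hdB])
      (by rw [n4 0 (by decide) (by decide) (by decide) (by decide) (by decide) (by decide), b5])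
      (by rw [n4 23 (by decide) (by decide) (by decide) (by decide) (by decide) (by decide), b6])
      (by rw [n4 1 (by decide) (by decide) (by decide) (by decide) (by decide) (by decide), b7])
      (by rw [n4 2 (by decide) (by decide) (by decide) (by decide) (by decide) (by decide), b8])
  have i53 : c₅.idx 3 = kA := by
    rw [g3 3 (by decide) (by decide) (by decide), i4 3 (by decide), b4]
  have i55 : c₅.idx 5 = I.len - 1 := by
    rw [g3 5 (by decide) (by decide) (by decide), f3]
  -- vertices between the cut points
  obtain ⟨c₆, r6, h1, h2, h3, h4⟩ := vertexLoop_correct (I := I) hloop (kB - kA) c₅ g1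
    (by rw [g4, i53]; omega) g6
  -- second cut point
  have r7 := reaches_execList (I := I) (c := c₆) hhitB h1 rfl
  obtain ⟨k1, k2, k3, k4⟩ := execList_writeHit I c₆ (q := I.query) (d := dB)
    ((h3 1 (by decide) (by decide)).trans g7) ((h3 2 (by decide) (by decide)).trans g8)
    ((h3 3 (by decide) (by decide)).trans g9) ((h3 4 (by decide) (by decide)).trans g10)
    ((h3 15 (by decide) (by decide)).trans g11) ((h3 16 (by decide) (by decide)).trans g12)
  generalize execList I c₆ writeHit = c₇ at *
  -- last endpoint
  have r8 := reaches_execList (I := I) (c := c₇) hlast (by rw [k1, h1]) rfl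
  obtain ⟨l1, l2, l3, l4⟩ := execList_writeVertex I c₇
    ((k4 23 (by decide) (by decide) (by decide) (by decide)).trans
      ((h3 23 (by decide) (by decide)).trans g6))
  generalize execList I c₇ writeVertex = c₈ at *
  have i7 : c₇.idx 5 = I.len - 1 := by rw [k3, h2, i55]
  have hkB := hB.1
  obtain ⟨T, hT, hrun⟩ :=
    (((((((r0.trans r1).trans r2).trans r3).trans r4).trans r5).trans r6).trans r7).trans r8
  refine ⟨T, hT.trans ?_, ?_⟩
  -- The two scans take `40 * I.len + 10` steps each, the vertex loop fewer than `6 * I.len + 2`,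
  -- and the straight code `27`.
  · simp only [preamble, writeVertex, writeHit, moveToLast, List.length_cons, List.length_nil]
    omega
  · have hrun : run program I T = c₈ := hrun
    rw [hrun]
    refine ⟨by rw [l1, k1, h1], ?_⟩
    rw [l2, k2, h4, g2, f2, e2, d2, b2, a2, hidx5, i53, i7]
    simp [Config.init]

end ChainVisibility

namespace ChainVisibility

/-! ### The size of the registers -/

theorem IsIntBounded.mono {U V : ℕ} {x : ℝ} (h : IsIntBounded U x) (hUV : U ≤ V) :
    IsIntBounded V x := by
  obtain ⟨z, hz, hzU⟩ := h
  exact ⟨z, hz, hzU.trans (by exact_mod_cast hUV)⟩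

theorem isIntBounded_zero (U : ℕ) : IsIntBounded U 0 := ⟨0, by simp, by simp⟩

theorem IsIntBounded.add {U V : ℕ} {x y : ℝ} (hx : IsIntBounded U x) (hy : IsIntBounded V y) :
    IsIntBounded (U + V) (x + y) := by
  obtain ⟨z, rfl, hz⟩ := hx
  obtain ⟨w, rfl, hw⟩ := hy
  exact ⟨z + w, by push_cast; rfl, (abs_add_le z w).trans (by push_cast; exact add_le_add hz hw)⟩

theorem IsIntBounded.sub {U V : ℕ} {x y : ℝ} (hx : IsIntBounded U x) (hy : IsIntBounded V y) :
    IsIntBounded (U + V) (x - y) := by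
  obtain ⟨z, rfl, hz⟩ := hx
  obtain ⟨w, rfl, hw⟩ := hy
  exact ⟨z - w, by push_cast; rfl, (abs_sub z w).trans (by push_cast; exact add_le_add hz hw)⟩

theorem IsIntBounded.mul {U V : ℕ} {x y : ℝ} (hx : IsIntBounded U x) (hy : IsIntBounded V y) :
    IsIntBounded (U * V) (x * y) := by
  obtain ⟨z, rfl, hz⟩ := hx
  obtain ⟨w, rfl, hw⟩ := hy
  refine ⟨z * w, by push_cast; rfl, ?_⟩
  rw [abs_mul]
  push_cast
  exact mul_le_mul hz hw (abs_nonneg _) (Nat.cast_nonneg _)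

theorem Input.IntBounded.read {I : Input} {U : ℕ} (h : I.IntBounded U) (k : ℕ) :
    IsIntBounded U (I.read k).re ∧ IsIntBounded U (I.read k).im := by
  unfold Input.read
  split_ifs with hk
  · exact h.1 _
  · exact ⟨isIntBounded_zero U, isIntBounded_zero U⟩

section Registers

variable {α β : ℕ} {prog : List (Instr α β)} {I : Input}

/-- An instruction keeps every number register `r` an integer of absolute value at most
`a r * (U + 1) ^ e r`, whatever the bound `U` of the input is. -/
def Instr.KeepsBound (a e : Fin β → ℕ) : Instr α β → Prop
  | .numConst r z => |z| ≤ a r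
  | .readX r _ => 1 ≤ a r ∧ 1 ≤ e r
  | .readY r _ => 1 ≤ a r ∧ 1 ≤ e r
  | .queryX r => 1 ≤ a r ∧ 1 ≤ e r
  | .queryY r => 1 ≤ a r ∧ 1 ≤ e r
  | .add r s t => a s + a t ≤ a r ∧ e s ≤ e r ∧ e t ≤ e r
  | .sub r s t => a s + a t ≤ a r ∧ e s ≤ e r ∧ e t ≤ e r
  | .mul r s t => a s * a t ≤ a r ∧ e s + e t ≤ e r
  | _ => True

/-- With decidability, the bounds for a concrete program are verified by evaluating finitely many
inequalities. -/
instance (a e : Fin β → ℕ) : DecidablePred (Instr.KeepsBound (α := α) a e) := fun ins => by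
  cases ins <;> unfold Instr.KeepsBound <;> infer_instance

theorem Instr.KeepsBound.exec {a e : Fin β → ℕ} {ins : Instr α β} (h : ins.KeepsBound a e) {U : ℕ}
    (hI : I.IntBounded U) {c : Config α β}
    (hc : ∀ r, IsIntBounded (a r * (U + 1) ^ e r) (c.num r)) (r : Fin β) :
    IsIntBounded (a r * (U + 1) ^ e r) ((ins.exec I c).num r) := by
  have upd : ∀ (s : Fin β) (x : ℝ), IsIntBounded (a s * (U + 1) ^ e s) x →
      IsIntBounded (a r * (U + 1) ^ e r) (Function.update c.num s x r) := by
    intro s x hx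
    rcases eq_or_ne r s with rfl | hrs
    · rwa [Function.update_self]
    · rw [Function.update_of_ne hrs]; exact hc r
  have inp : ∀ s : Fin β, 1 ≤ a s ∧ 1 ≤ e s → U ≤ a s * (U + 1) ^ e s := by
    intro s hs
    calc U ≤ 1 * (U + 1) ^ 1 := by rw [pow_one]; omega
      _ ≤ _ := Nat.mul_le_mul hs.1 (Nat.pow_le_pow_right (by omega) hs.2)
  have sum : ∀ r s t : Fin β, a s + a t ≤ a r ∧ e s ≤ e r ∧ e t ≤ e r →
      a s * (U + 1) ^ e s + a t * (U + 1) ^ e t ≤ a r * (U + 1) ^ e r := by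
    intro r s t h
    calc _ ≤ a s * (U + 1) ^ e r + a t * (U + 1) ^ e r :=
          add_le_add (Nat.mul_le_mul_left _ (Nat.pow_le_pow_right (by omega) h.2.1))
            (Nat.mul_le_mul_left _ (Nat.pow_le_pow_right (by omega) h.2.2))
      _ = (a s + a t) * (U + 1) ^ e r := by ring
      _ ≤ _ := Nat.mul_le_mul_right _ h.1
  cases ins with
  | numConst s z =>
    refine upd s z ⟨z, rfl, le_trans h ?_⟩
    exact_mod_cast Nat.le_mul_of_pos_right _ (by positivity)
  | readX s x => exact upd s _ ((hI.read _).1.mono (inp s h))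
  | readY s x => exact upd s _ ((hI.read _).2.mono (inp s h))
  | queryX s => exact upd s _ (hI.2.1.mono (inp s h))
  | queryY s => exact upd s _ (hI.2.2.mono (inp s h))
  | add s t u => exact upd s _ (((hc t).add (hc u)).mono (sum s t u h))
  | sub s t u => exact upd s _ (((hc t).sub (hc u)).mono (sum s t u h))
  | mul s t u =>
    refine upd s _ (((hc t).mul (hc u)).mono ?_)
    calc _ = (a t * a u) * (U + 1) ^ (e t + e u) := by rw [pow_add]; ring
      _ ≤ _ := Nat.mul_le_mul h.1 (Nat.pow_le_pow_right (by omega) h.2)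
  | _ => exact hc r

/-- The bounds do not grow with `T`: each register has its own degree, no instruction exceeds that
of its target, and initially all registers are zero. -/
theorem isIntBounded_run {a e : Fin β → ℕ} (h : ∀ ins ∈ prog, ins.KeepsBound a e) {U : ℕ}
    (hI : I.IntBounded U) (T : ℕ) :
    ∀ r, IsIntBounded (a r * (U + 1) ^ e r) ((run prog I T).num r) := by
  induction T with
  | zero => exact fun r => isIntBounded_zero _
  | succ T ih =>
    unfold run at ih ⊢
    rw [Function.iterate_succ_apply']
    unfold step
    split
    · next ins hins => exact (h ins (List.mem_of_getElem? hins)).exec hI ih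
    · exact ih

/-- An instruction sets an index register to at most `1` if it sets it to a constant. -/
def Instr.SmallConst : Instr α β → Prop
  | .idxConst _ k => k ≤ 1
  | _ => True

instance : DecidablePred (Instr.SmallConst (α := α) (β := β)) := fun ins => by
  cases ins <;> unfold Instr.SmallConst <;> infer_instance

/-- One step raises the largest index by at most one, which gives the crude bound `I.len + T` after
`T` steps. -/
theorem Instr.SmallConst.exec {ins : Instr α β} (h : ins.SmallConst) {c : Config α β} {K : ℕ}
    (hK : I.len ≤ K) (hc : ∀ x, c.idx x ≤ K) (x : Fin α) : (ins.exec I c).idx x ≤ K + 1 := by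
  have upd : ∀ (y : Fin α) (k : ℕ), k ≤ K + 1 → Function.update c.idx y k x ≤ K + 1 := by
    intro y k hk
    rcases eq_or_ne x y with rfl | hxy
    · rwa [Function.update_self]
    · rw [Function.update_of_ne hxy]; exact (hc x).trans (by omega)
  cases ins with
  | idxConst y k => exact upd y k (le_trans h (by omega))
  | idxLen y => exact upd y _ (by omega)
  | idxCopy y z => exact upd y _ ((hc z).trans (by omega))
  | idxSucc y => exact upd y _ (Nat.succ_le_succ (hc y))
  | idxPred y => exact upd y _ (by have := hc y; omega)
  | _ => exact (hc x).trans (by omega)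

theorem idx_run_le (h : ∀ ins ∈ prog, ins.SmallConst) (T : ℕ) :
    ∀ x, (run prog I T).idx x ≤ I.len + T := by
  induction T with
  | zero => exact fun x => Nat.zero_le _
  | succ T ih =>
    unfold run at ih ⊢
    rw [Function.iterate_succ_apply']
    unfold step
    split
    · next ins hins =>
      exact (h ins (List.mem_of_getElem? hins)).exec (Nat.le_add_right _ _) ih
    · exact fun x => (ih x).trans (by omega)

theorem run_eq_of_halted {T : ℕ} (h : Halted prog (run prog I T)) {T' : ℕ} (hT : T ≤ T') :
    run prog I T' = run prog I T := by
  have hfix : step prog I (run prog I T) = run prog I T := by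
    unfold step
    rw [List.getElem?_eq_none h]
  obtain ⟨s, rfl⟩ := Nat.exists_eq_add_of_le' hT
  unfold run at hfix ⊢
  rw [Function.iterate_add_apply, Function.iterate_fixed hfix]

end Registers

/-- The coefficients of the bounds for the number registers of the program. -/
def numCoeff : Fin 24 → ℕ :=
  ![0, 1, 1, 2, 2, 2, 2, 2, 2, 4, 4, 8, 8, 8, 16, 8, 16, 128, 128, 1, 1, 256, 256, 1]

/-- The degrees of the bounds for the number registers of the program. -/
def numDegree : Fin 24 → ℕ :=
  ![0, 1, 1, 1, 1, 1, 1, 1, 1, 2, 2, 2, 2, 2, 2, 2, 2, 4, 4, 1, 1, 4, 4, 0]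

theorem keepsBound_program : ∀ ins ∈ program, ins.KeepsBound numCoeff numDegree := by
  decide

theorem smallConst_program : ∀ ins ∈ program, ins.SmallConst := by
  decide

theorem length_program : program.length = 120 := rfl

theorem isIntBounded_program {I : Input} {U : ℕ} (hI : I.IntBounded U) (T : ℕ) (r : Fin 24) :
    IsIntBounded (256 * (U + 1) ^ 4) ((run program I T).num r) := by
  refine (isIntBounded_run keepsBound_program hI T r).mono (Nat.mul_le_mul ?_
    (Nat.pow_le_pow_right (by omega) ?_))
  · revert r; decide
  · revert r; decide

/-- The crude bound is linear up to the halting time, and afterwards nothing changes. -/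
theorem idx_program_le {I : Input} {T : ℕ} (hT : T ≤ 150 * I.len)
    (h : (run program I T).pc = 120) (T' : ℕ) (x : Fin 6) :
    (run program I T').idx x ≤ 151 * I.len := by
  rcases le_total T' T with hle | hle
  · exact (idx_run_le smallConst_program T' x).trans (by omega)
  · rw [run_eq_of_halted (by rw [Halted, length_program, h]) hle]
    exact (idx_run_le smallConst_program T x).trans (by omega)

/-! ### The output for a chain -/

theorem edgeNum_congr {p p' : ℕ → ℂ} {q : ℂ} {k : ℕ} (h : p k = p' k)
    (h' : p (k + 1) = p' (k + 1)) : edgeNum p q k = edgeNum p' q k := by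
  unfold edgeNum; rw [h, h']

theorem edgeDen_congr {p p' : ℕ → ℂ} {q d : ℂ} {k : ℕ} (h : p k = p' k)
    (h' : p (k + 1) = p' (k + 1)) : edgeDen p q d k = edgeDen p' q d k := by
  unfold edgeDen; rw [h, h']

/-- The input array agrees with the chain only below the length and reads as `0` beyond it, so only
edges with both ends in range are compared. -/
theorem IsNearestEdge.congr {p p' : ℕ → ℂ} {q d : ℂ} {m : ℕ} {cand cand' : ℕ → Prop} {k : ℕ}
    (h : ∀ j < m, p j = p' j) (hcand : ∀ j, j + 1 < m → (cand j ↔ cand' j))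
    (hk : IsNearestEdge p q d m cand k) : IsNearestEdge p' q d m cand' k := by
  obtain ⟨h1, h2, h3⟩ := hk
  refine ⟨h1, (hcand k h1).1 h2, fun j hj hcj hne => ?_⟩
  have e := h3 j hj ((hcand j hj).2 hcj) hne
  rwa [edgeNum_congr (h k (by omega)) (h _ h1), edgeNum_congr (h j (by omega)) (h _ hj),
    edgeDen_congr (h k (by omega)) (h _ h1), edgeDen_congr (h j (by omega)) (h _ hj)] at e

theorem leavesRay_congr {p p' : ℕ → ℂ} {q d : ℂ} {k : ℕ} (h : p k = p' k)
    (h' : p (k + 1) = p' (k + 1)) : LeavesRay p q d k ↔ LeavesRay p' q d k := by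
  unfold LeavesRay; rw [edgeNum_congr h h', h, h']

theorem reachesRay_congr {p p' : ℕ → ℂ} {q d : ℂ} {k : ℕ} (h : p k = p' k)
    (h' : p (k + 1) = p' (k + 1)) : ReachesRay p q d k ↔ ReachesRay p' q d k := by
  unfold ReachesRay; rw [edgeNum_congr h h', h, h']

theorem hitWords_represents {q d z : ℂ} {N D : ℝ} (hD : 0 < D) (hz : z = q + (N / D : ℝ) * d) :
    (hitWords q d N D).2.2 ≠ 0 ∧ z.re = (hitWords q d N D).1 / (hitWords q d N D).2.2 ∧
      z.im = (hitWords q d N D).2.1 / (hitWords q d N D).2.2 := by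
  have hD' := hD.ne'
  refine ⟨hD', ?_, ?_⟩
  · rw [hz, Complex.add_re, Complex.re_ofReal_mul]
    simp only [hitWords]
    field_simp
  · rw [hz, Complex.add_im, Complex.im_ofReal_mul]
    simp only [hitWords]
    field_simp

theorem affineWords_represents (z : ℂ) :
    (affineWords z).2.2 ≠ 0 ∧ z.re = (affineWords z).1 / (affineWords z).2.2 ∧
      z.im = (affineWords z).2.1 / (affineWords z).2.2 := by
  simp [affineWords]

theorem filter_range_eq_range' {m x y : ℕ} {P : ℕ → Bool} (hy : x + y ≤ m)
    (hP : ∀ k, P k = true ↔ x ≤ k ∧ k < x + y) : (List.range m).filter P = List.range' x y := by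
  have e : List.range m = List.range' 0 x ++ (List.range' x y ++ List.range' (x + y) (m - x - y)) := by
    rw [List.range_eq_range']
    have h1 := List.range'_append_1 (s := x) (m := y) (n := m - x - y)
    have h2 := List.range'_append_1 (s := 0) (m := x) (n := y + (m - x - y))
    rw [zero_add] at h2
    rw [h1, h2]
    congr 1; omega
  rw [e, List.filter_append, List.filter_append, List.filter_eq_nil_iff.2, List.filter_eq_self.2,
    List.filter_eq_nil_iff.2, List.nil_append, List.append_nil]
  · intro k hk
    rw [List.mem_range'_1] at hk
    rw [hP]; omega
  · intro k hk
    rw [List.mem_range'_1] at hk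
    rw [hP]; omega
  · intro k hk
    rw [List.mem_range'_1] at hk
    rw [hP]; omega

theorem read_chainInput {n : ℕ} (v : ZMod n → ℂ) (q : ℂ) (i : ZMod n) {m k : ℕ} (hk : k < m) :
    (chainInput v q i m).read k = v (i + k) := by
  unfold Input.read
  rw [dif_pos (show k < (chainInput v q i m).len from hk)]
  rfl

/-- With `a` in `[kA, kA + 1)` and `b` in `(kB, kB + 1]`, the integers strictly between `a` and `b`
are `kA + 1, …, kB`, also when a cut point is a vertex. -/
theorem outputPoints_eq {n : ℕ} (v : ZMod n → ℂ) (i : ZMod n) {m kA kB : ℕ} {a b : ℝ}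
    (hA : (kA : ℝ) ≤ a ∧ a < kA + 1) (hB : (kB : ℝ) < b ∧ b ≤ kB + 1) (hAB : kA ≤ kB)
    (hm : kB + 1 < m) : outputPoints v i m a b = [v i, curve v i a] ++
      (List.range' (kA + 1) (kB - kA)).map (fun k : ℕ => v (i + (k : ZMod n))) ++
      [curve v i b, v (chainEnd i m)] := by
  unfold outputPoints
  rw [filter_range_eq_range' (x := kA + 1) (y := kB - kA) (by omega)]
  intro k
  rw [decide_eq_true_iff]
  constructor
  · rintro ⟨h1, h2⟩
    have h3 : (kA : ℝ) < k := hA.1.trans_lt h1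
    have h4 : (k : ℝ) < kB + 1 := h2.trans_le hB.2
    have h3' : kA < k := by exact_mod_cast h3
    have h4' : k < kB + 1 := by exact_mod_cast h4
    omega
  · rintro ⟨h1, h2⟩
    have h3 : ((kA + 1 : ℕ) : ℝ) ≤ k := by exact_mod_cast h1
    have h4 : (k : ℝ) ≤ kB := by exact_mod_cast (by omega : k ≤ kB)
    push_cast at h3
    exact ⟨hA.2.trans_le h3, h4.trans_lt hB.1⟩

end ChainVisibility

/-! ### The theorem, assembled from the geometry and the program. -/

theorem theorem2 :
    ∃ (α β : ℕ) (prog : List (Instr α β)) (C d : ℕ),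
      ∀ (n : ℕ) [NeZero n] (v : ZMod n → ℂ) (q : ℂ) (i : ZMod n) (m : ℕ),
        IsSimplePolygon v → q ∈ inside v →
        (∀ k : ZMod n, cross (v k - q) (v (k + 1) - q) ≠ 0) →
        IsVisibleCriticalChain v q i m →
        -- linear time, and correctness of the output
        (∃ T ≤ C * m, Halted prog (run prog (chainInput v q i m) T) ∧
          ∃ a b : ℝ, a < b ∧ IsFirstCut v q i m a ∧ IsLastCut v q i m b ∧
            Represents (run prog (chainInput v q i m) T).out (outputPoints v i m a b) ∧
            {x ∈ chain v i m | Visible v q x} =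
              {v i} ∪ curve v i '' Set.Icc a b ∪ {v (chainEnd i m)}) ∧
        -- the `α + β` registers hold words of logarithmic size
        (∀ T x, (run prog (chainInput v q i m) T).idx x ≤ C * m) ∧
        (∀ U : ℕ, (chainInput v q i m).IntBounded U →
          ∀ T r, IsIntBounded (C * (U + 1) ^ d) ((run prog (chainInput v q i m) T).num r)) := by
  -- One constant serves three purposes: it dominates the time factor `150`, the index factor `151`
  -- and the largest register coefficient `256`.
  refine ⟨6, 24, program, 256, 4, ?_⟩
  intro n _ v q i m hs hq hw hc
  obtain ⟨a, b, kA, kB, hab, ha, hb, hvis, hkA, hkB, hA, hB, hca, hcb⟩ :=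
    exists_visible_part hs hq hw hc
  have hm := hc.1
  have hkB1 := hB.1
  have hkA1 := hA.1
  have hAB : kA ≤ kB := by
    have : (kA : ℝ) < kB + 1 := hkA.1.trans_lt (hab.trans_le hkB.2)
    have : kA < kB + 1 := by exact_mod_cast this
    omega
  set I := chainInput v q i m with hI
  have hread : ∀ k < m, v (i + k) = I.read k := fun k hk => (read_chainInput v q i hk).symm
  have h0 : v i = I.read 0 := by rw [← hread 0 (by omega)]; simp
  have hend : v (chainEnd i m) = I.read (I.len - 1) := hread (m - 1) (by omega)
  have hnum : ∀ k, k + 1 < m → edgeNum (fun j => v (i + j)) q k = edgeNum I.read q k :=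
    fun k hk => edgeNum_congr (hread k (by omega)) (hread _ hk)
  have hden : ∀ d k, k + 1 < m → edgeDen (fun j => v (i + j)) q d k = edgeDen I.read q d k :=
    fun d k hk => edgeDen_congr (hread k (by omega)) (hread _ hk)
  have posA := hA.2.1.edgeDen_pos
  have posB := hB.2.1.edgeDen_pos
  obtain ⟨T, hT, hpc, hout⟩ := program_correct (I := I) hm
    (congrArg (· - q) h0) (congrArg (· - q) hend)
    (hA.congr hread fun j hj => leavesRay_congr (hread j (Nat.lt_of_succ_lt hj)) (hread _ hj))
    (hB.congr hread fun j hj => reachesRay_congr (hread j (Nat.lt_of_succ_lt hj)) (hread _ hj))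
    hAB
  have hT' : T ≤ 150 * m := hT
  refine ⟨⟨T, by omega, ?_, a, b, hab, ha, hb, ?_, hvis⟩, fun T' x => ?_,
    fun U hU T' r => isIntBounded_program hU T' r⟩
  · rw [Halted, length_program, hpc]
  · rw [hout, outputPoints_eq v i hkA hkB hAB hkB1]
    refine List.rel_append (List.rel_append ?_ ?_) ?_
    · refine .cons ?_ (.cons ?_ .nil)
      · rw [← h0]; exact affineWords_represents _
      · have e := hitWords_represents posA hca
        rwa [hnum kA hkA1, hden _ kA hkA1] at e
    · rw [List.forall₂_map_left_iff, List.forall₂_map_right_iff, List.forall₂_same]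
      intro k hk
      rw [List.mem_range'_1] at hk
      rw [hread k (by omega)]
      exact affineWords_represents _
    · refine .cons ?_ (.cons ?_ .nil)
      · have e := hitWords_represents posB hcb
        rwa [hnum kB hkB1, hden _ kB hkB1] at e
      · rw [← hend]; exact affineWords_represents _
  · exact (idx_program_le hT hpc T' x).trans (Nat.mul_le_mul_right _ (by norm_num))
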